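/- For integers $\alpha,\beta\neq 1$ let $$G(\alpha,\beta)=\langle A,B\mid A^{[A,B]}=A^{\alpha},\ B^{[B,A]}=B^{\beta}\rangle$$ be the Macdonald group, where $[x,y]=x^{-1}y^{-1}xy$ and $y^x=x^{-1}yx$, and put $C=[A,B]$. Then $G(\alpha,\beta)$ is finite and nilpotent, so that it is the direct product of its Sylow subgroups. Moreover: (1) Suppose $\alpha,\beta\equiv 7 \pmod 9$ and $\alpha\equiv\beta \pmod{27}$. Then the Sylow $3$-subgroup $G(\alpha,\beta)_3$ has order $3^{10}$ and nilpotency class $7$, and the images $a,b,c$ of $A,B,C$ under the canonical projection $G(\alpha,\beta)\to G(\alpha,\beta)_3$ have orders $o(a)=o(b)=81$ and $o(c)=27$. (2) For all integers $\alpha,\beta\neq 1$ the nilpotency class of $G(\alpha,\beta)$ is at most $7$, and it is equal to $7$ if and only if $\alpha,\beta\equiv 7\pmod 9$ and $\alpha\equiv\beta\pmod{27}$. -/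

import Mathlib

/-- The commutator `[x, y] = x⁻¹ y⁻¹ x y` (Mathlib's `⁅x, y⁆` is `x y x⁻¹ y⁻¹`). -/
def rcomm {T : Type*} [Group T] (x y : T) : T := x⁻¹ * y⁻¹ * x * y

/-- The conjugate `y ^ x = x⁻¹ y x`. -/
def rconj {T : Type*} [Group T] (y x : T) : T := x⁻¹ * y * x

/-- The two relators of the Macdonald group, in the free group on `0` (for `A`) and `1` (for `B`):
`A ^ [A, B] = A ^ α` and `B ^ [B, A] = B ^ β`. -/
def macdonaldRels (α β : ℤ) : Set (FreeGroup (Fin 2)) :=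
  let A : FreeGroup (Fin 2) := FreeGroup.of 0
  let B : FreeGroup (Fin 2) := FreeGroup.of 1
  {rconj A (rcomm A B) * (A ^ α)⁻¹, rconj B (rcomm B A) * (B ^ β)⁻¹}

/-- The Macdonald group `G(α, β) = ⟨A, B | A ^ [A, B] = A ^ α, B ^ [B, A] = B ^ β⟩`. -/
abbrev MacdonaldGroup (α β : ℤ) : Type := PresentedGroup (macdonaldRels α β)

namespace MacdonaldGroup

/-- The generator `A` of `G(α, β)`. -/
def A (α β : ℤ) : MacdonaldGroup α β := PresentedGroup.of 0

/-- The generator `B` of `G(α, β)`. -/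
def B (α β : ℤ) : MacdonaldGroup α β := PresentedGroup.of 1

/-- The element `C = [A, B]` of `G(α, β)`. -/
def C (α β : ℤ) : MacdonaldGroup α β := rcomm (A α β) (B α β)

end MacdonaldGroup

/-- `π : T → P` is the canonical projection of `T` onto its Sylow `p`-subgroup `P`: it is the
identity on `P`, and its kernel is finite of order prime to `p`. (In a finite nilpotent group, which
is the direct product of its Sylow subgroups, the kernel is then the product of the other Sylow
subgroups.) There is at most one such `π`. -/
def IsSylowProjection {T : Type*} [Group T] {p : ℕ} (P : Sylow p T) (π : T →* P) : Prop :=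
  (∀ x : P, π x = x) ∧ Finite π.ker ∧ (Nat.card π.ker).Coprime p

/-! Write `c = [a, b]`. If `s`, `t` represent `α ^ k`, `β ^ k` as exponents of `a`, `b`, then `a ^
s` and `b` are the conjugates by `c ^ k` of `a` and `b ^ t`, so `[a ^ s, b]` is the conjugate of
`[a, b ^ t]`. Expanding both commutators gives `fundamental`, a relation between one power of `a`,
one power of `b` and powers of `c`. Conjugating it by `c` (`zpow_eq_zpow_of_rel`) produces an
element that is both a power of `a` and a power of `b`; it commutes with `c`, so its exponent times
`α - 1` kills `a`.

This has two global consequences. With `k = 2` the generators have finite order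
(`isOfFinOrder_left`). Letting `k` vary and reducing modulo a prime `q` dividing the order of `a`,
an affine map preserves the subgroup generated by `α` in the units modulo `q`, which forces `q ∣ α -
1` (`prime_dvd_sub_one`). Raising both generators to an exponent that is idempotent modulo their
orders then preserves the relations (`of_splitting`). The resulting endomorphisms `primaryHom`
commute and multiply to the identity, so the group splits into primary components before anything is
known about nilpotency.

In a `p`-primary component the relation becomes `c ^ x * a ^ F = b ^ G`, where `x` is close to `α -
β` and the `p`-adic valuations of `F` and `G` come from a binomial expansion of `relExponent`.
Conjugating once more by `a` or `b` (`conj_rel`) bounds the orders of `a`, `b`, `c`; powers of `c`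
and powers of `a`, `b` then become central alternately, which bounds the class by 6. The exception
is `p = 3` with `α`, `β` congruent to 7 modulo 9 and to each other modulo 27. There `F` and `G` have
valuation 3 and `x` is divisible by 27, so only `a ^ 81 = 1` follows; but `a ^ 27` and `b ^ 27` are
central, and the class is at most 7. Finiteness follows from nilpotency and the finite orders of the
generators.

In the exceptional case everything hinges on `a ^ 27 ≠ 1`: this element lies in the last term of the
lower central series allowed by class 7, and successive central quotients then give order `3 ^ 10`.
It is nontrivial because of explicit monomial groups for `α = β = 7, 16, 25`, twisted by central
scalars to reach every pair of exponents. -/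

/-! ### Commutation rules and the fundamental relation. -/

/-- `(a, b)` satisfies the defining relations of the Macdonald group `G(α, β)`. -/
structure IsMacdonaldPair {H : Type*} [Group H] (α β : ℤ) (a b : H) : Prop where
  conj_left : rconj a (rcomm a b) = a ^ α
  conj_right : rconj b (rcomm b a) = b ^ β

/-- The sum `α + α ^ 2 + ⋯ + α ^ n`. -/
def geomSum (α : ℤ) (n : ℕ) : ℤ := ∑ i ∈ Finset.range n, α ^ (i + 1)

theorem geomSum_zero (α : ℤ) : geomSum α 0 = 0 := by simp [geomSum]

theorem geomSum_succ (α : ℤ) (n : ℕ) : geomSum α (n + 1) = geomSum α n + α ^ (n + 1) := by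
  simp [geomSum, Finset.sum_range_succ]

theorem geomSum_succ' (α : ℤ) (n : ℕ) : geomSum α (n + 1) = α + α * geomSum α n := by
  simp only [geomSum, Finset.sum_range_succ', Finset.mul_sum]
  rw [add_comm]; simp [pow_succ, mul_comm]

theorem sub_one_mul_geomSum (α : ℤ) (n : ℕ) : (α - 1) * geomSum α n = α * (α ^ n - 1) := by
  induction n with
  | zero => simp [geomSum_zero]
  | succ n ih => rw [geomSum_succ, mul_add, ih]; ring

theorem rcomm_inv {H : Type*} [Group H] (a b : H) : (rcomm a b)⁻¹ = rcomm b a := by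
  simp [rcomm, mul_assoc]

namespace IsMacdonaldPair

variable {H : Type*} [Group H] {α β : ℤ} {a b : H}

theorem symm (h : IsMacdonaldPair α β a b) : IsMacdonaldPair β α b a :=
  ⟨h.conj_right, h.conj_left⟩

theorem map {K : Type*} [Group K] (h : IsMacdonaldPair α β a b) (f : H →* K) :
    IsMacdonaldPair α β (f a) (f b) := by
  constructor
  · simpa [rconj, rcomm] using congrArg f h.conj_left
  · simpa [rconj, rcomm] using congrArg f h.conj_right

theorem congr_left (h : IsMacdonaldPair α β a b) {α' : ℤ} (hα : a ^ α = a ^ α') :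
    IsMacdonaldPair α' β a b := ⟨h.conj_left.trans hα, h.conj_right⟩

theorem congr_right (h : IsMacdonaldPair α β a b) {β' : ℤ} (hβ : b ^ β = b ^ β') :
    IsMacdonaldPair α β' a b := ⟨h.conj_left, h.conj_right.trans hβ⟩

/-- `a` moves past `c = [a, b]` at the price of the exponent `α`. -/
theorem zpow_mul_comm (h : IsMacdonaldPair α β a b) (i : ℤ) :
    a ^ i * rcomm a b = rcomm a b * a ^ (α * i) := by
  have h1 := h.conj_left
  have : (rcomm a b)⁻¹ * a ^ i * rcomm a b = a ^ (α * i) := by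
    rw [zpow_mul, ← h1, rconj]
    have := conj_zpow (a := (rcomm a b)⁻¹) (b := a) (i := i)
    simpa using this.symm
  rw [← this]; group

theorem comm_mul_zpow (h : IsMacdonaldPair α β a b) (i : ℤ) :
    rcomm a b * b ^ i = b ^ (β * i) * rcomm a b := by
  have h1 := h.symm.zpow_mul_comm i
  rw [← rcomm_inv a b] at h1
  have h2 : rcomm a b * (b ^ i * (rcomm a b)⁻¹) * rcomm a b = rcomm a b * b ^ i := by group
  rw [← h2, h1]; simp

theorem zpow_mul_comm_pow (h : IsMacdonaldPair α β a b) (i : ℤ) (n : ℕ) :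
    a ^ i * rcomm a b ^ n = rcomm a b ^ n * a ^ (i * α ^ n) := by
  induction n generalizing i with
  | zero => simp
  | succ n ih =>
    rw [pow_succ' (rcomm a b), ← mul_assoc, h.zpow_mul_comm, mul_assoc, ih,
      show α * i * α ^ n = i * α ^ (n + 1) by ring, mul_assoc]

theorem comm_pow_mul_zpow (h : IsMacdonaldPair α β a b) (i : ℤ) (n : ℕ) :
    rcomm a b ^ n * b ^ i = b ^ (i * β ^ n) * rcomm a b ^ n := by
  induction n generalizing i with
  | zero => simp
  | succ n ih =>
    rw [pow_succ (rcomm a b), mul_assoc, h.comm_mul_zpow, ← mul_assoc, ih, mul_assoc]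
    congr 2; ring

theorem mul_right_eq (a b : H) : a * b = b * (a * rcomm a b) := by simp [rcomm, mul_assoc]

/-- Since `a * c = b⁻¹ * a * b`, this power is the conjugate of `a ^ n` by `b`. The geometric sum
collects the factors `α` picked up as copies of `a` move past growing powers of `c`. -/
theorem mul_comm_pow (h : IsMacdonaldPair α β a b) (n : ℕ) :
    (a * rcomm a b) ^ n = rcomm a b ^ n * a ^ geomSum α n := by
  induction n with
  | zero => simp [geomSum_zero]
  | succ n ih =>
    have h2 := h.zpow_mul_comm_pow 1 (n + 1)
    rw [zpow_one, one_mul] at h2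
    rw [pow_succ', ih, mul_assoc a, ← mul_assoc (rcomm a b), ← pow_succ', ← mul_assoc, h2,
      mul_assoc, ← zpow_add, geomSum_succ,
      add_comm (α ^ _)]

/-- Conjugation of powers of `a` by `b`. -/
theorem pow_mul_right (h : IsMacdonaldPair α β a b) (n : ℕ) :
    a ^ n * b = b * (rcomm a b ^ n * a ^ geomSum α n) := by
  rw [← h.mul_comm_pow]
  have : (b⁻¹ * a * b) ^ n = b⁻¹ * a ^ n * b := by
    simpa using conj_pow (a := b⁻¹) (b := a) (i := n)
  have h2 : a * rcomm a b = b⁻¹ * a * b := by simp [rcomm, mul_assoc]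
  rw [h2, this]; group

theorem pow_mul_left (h : IsMacdonaldPair α β a b) (n : ℕ) :
    b ^ n * a = a * ((rcomm a b ^ n)⁻¹ * b ^ geomSum β n) := by
  rw [h.symm.pow_mul_right, ← rcomm_inv a b, inv_pow]

/-- The fundamental relation obtained by expanding `[a ^ s, b] = [a, b ^ t] ^ (c ^ k)`. -/
theorem fundamental (h : IsMacdonaldPair α β a b) {k s t : ℕ}
    (hs : a ^ (α ^ k) = a ^ s) (ht : b ^ (β ^ k) = b ^ t) :
    rcomm a b ^ s * a ^ (geomSum α s - s * α ^ s) =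
      (rcomm a b ^ k)⁻¹ * b ^ (t * β ^ t - geomSum β t) * rcomm a b ^ (t + k) := by
  have e1 := h.pow_mul_right s
  have e2 := h.pow_mul_left t
  have e3 := h.zpow_mul_comm_pow (-s) s
  have e4 := h.comm_pow_mul_zpow t t
  have eA := h.zpow_mul_comm_pow 1 k
  have eB := h.comm_pow_mul_zpow 1 k
  simp only [zpow_one, one_mul, hs, ht, zpow_neg, zpow_natCast] at e3 e4 eA eB
  generalize rcomm a b = c at *
  -- Conjugation by `c ^ k` carries `a` to `a ^ s` and `b ^ t` to `b`, hence `[a, b ^ t]` to `[a ^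
  -- s, b]`.
  have h1 : a ^ s = (c ^ k)⁻¹ * a * c ^ k := by rw [mul_assoc, eA]; group
  have h2 : b = (c ^ k)⁻¹ * b ^ t * c ^ k := by rw [mul_assoc, ← eB]; group
  have h3 : (b ^ t)⁻¹ * a = a * (b ^ geomSum β t)⁻¹ * c ^ t := by
    rw [inv_mul_eq_iff_eq_mul, ← mul_assoc, ← mul_assoc, e2]; group
  have h4 : c ^ s * a ^ geomSum α s = a ^ s * ((c ^ k)⁻¹ * ((b ^ geomSum β t)⁻¹ * (c ^ t * b ^ t)) * c ^ k) := by
    calc c ^ s * a ^ geomSum α s = b⁻¹ * (a ^ s * b) := by rw [e1]; group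
      _ = ((c ^ k)⁻¹ * b ^ t * c ^ k)⁻¹ * (((c ^ k)⁻¹ * a * c ^ k) * ((c ^ k)⁻¹ * b ^ t * c ^ k)) := by
          rw [← h2, ← h1]
      _ = (c ^ k)⁻¹ * ((b ^ t)⁻¹ * a) * b ^ t * c ^ k := by simp [mul_assoc]
      _ = _ := by rw [h3, h1]; simp [mul_assoc]
  rw [e4] at h4
  rw [sub_eq_neg_add, zpow_add, ← mul_assoc, ← neg_mul, ← e3, mul_assoc, h4, sub_eq_neg_add, zpow_add,
    pow_add]
  simp [mul_assoc]

end IsMacdonaldPair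

/-! ### Divisibility of geometric sums by prime powers. -/

theorem geomSum_eq_mul_sum (α : ℤ) (n : ℕ) :
    geomSum α n = α * ∑ j ∈ Finset.range n, α ^ j := by
  simp only [geomSum, Finset.mul_sum, pow_succ']

theorem sum_pow_range_mul (α : ℤ) (m n : ℕ) :
    ∑ j ∈ Finset.range (m * n), α ^ j =
      (∑ j ∈ Finset.range m, α ^ j) * ∑ j ∈ Finset.range n, (α ^ m) ^ j := by
  induction n with
  | zero => simp
  | succ n ih =>
    rw [Nat.mul_succ, Finset.sum_range_add, ih, Finset.sum_range_succ, mul_add, ← pow_mul]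
    congr 1
    rw [Finset.sum_mul]
    exact Finset.sum_congr rfl fun j _ => by rw [pow_add, mul_comm]

theorem sum_pow_modEq {d α : ℤ} (h : α ≡ 1 [ZMOD d]) (n : ℕ) :
    ∑ j ∈ Finset.range n, α ^ j ≡ n [ZMOD d] := by
  have : ∑ j ∈ Finset.range n, α ^ j ≡ ∑ j ∈ Finset.range n, 1 [ZMOD d] := by
    refine Int.ModEq.sum fun j _ => ?_
    simpa using h.pow j
  simpa using this

/-- One factor `p` of `n` splits off a block sum congruent to `p`, hence to 0, modulo `p`; the
remaining sum has base `α ^ p`, again congruent to 1. -/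
theorem pow_dvd_sum_pow {p : ℕ} (i : ℕ) : ∀ {α : ℤ} {n : ℕ}, (p : ℤ) ∣ α - 1 → p ^ i ∣ n →
    (p : ℤ) ^ i ∣ ∑ j ∈ Finset.range n, α ^ j := by
  induction i with
  | zero => intros; simp
  | succ i ih =>
    rintro α n hα ⟨n', rfl⟩
    have h1 : α ≡ 1 [ZMOD p] := (Int.modEq_iff_dvd.2 hα).symm
    rw [pow_succ' p, mul_assoc, sum_pow_range_mul, pow_succ']
    refine mul_dvd_mul ?_ (ih ?_ (dvd_mul_right _ _))
    · have := sum_pow_modEq h1 p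
      exact Int.modEq_zero_iff_dvd.1 (this.trans (by simp))
    · have := h1.pow p
      rw [one_pow] at this
      exact Int.modEq_iff_dvd.1 this.symm

theorem pow_dvd_geomSum {p : ℕ} {α : ℤ} (hα : (p : ℤ) ∣ α - 1) {i n : ℕ} (hn : p ^ i ∣ n) :
    (p : ℤ) ^ i ∣ geomSum α n := by
  rw [geomSum_eq_mul_sum]
  exact (pow_dvd_sum_pow i hα hn).mul_left _

theorem pow_dvd_pow_sub_one {p : ℕ} {α : ℤ} {l : ℕ} (hl : 1 ≤ l) (hα : (p : ℤ) ^ l ∣ α - 1)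
    {i n : ℕ} (hn : p ^ i ∣ n) : (p : ℤ) ^ (l + i) ∣ α ^ n - 1 := by
  rw [← mul_geom_sum, pow_add]
  exact mul_dvd_mul hα (pow_dvd_sum_pow i ((dvd_pow_self _ (by omega)).trans hα) hn)

/-- The factor 2 clears the denominator of `1 + ⋯ + p = p (p + 1) / 2`, so that `p = 2` needs no
separate statement. -/
theorem pow_dvd_two_mul_sum_prime {p : ℕ} {α : ℤ} {l : ℕ} (hl : 1 ≤ l)
    (hα : (p : ℤ) ^ l ∣ α - 1) : (p : ℤ) ^ (l + 1) ∣ 2 * (geomSum α p - p) := by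
  have h1 : α ≡ 1 [ZMOD (p : ℤ) ^ l] := (Int.modEq_iff_dvd.2 hα).symm
  have h2 : geomSum α p - p =
      (α - 1) * ∑ j ∈ Finset.range p, ∑ i ∈ Finset.range (j + 1), α ^ i := by
    simp only [Finset.mul_sum (s := Finset.range p), mul_geom_sum, geomSum, Finset.sum_sub_distrib]
    simp
  have h3 : ∑ j ∈ Finset.range p, ∑ i ∈ Finset.range (j + 1), α ^ i ≡
      ∑ j ∈ Finset.range p, ((j : ℤ) + 1) [ZMOD (p : ℤ)] := by
    refine Int.ModEq.sum fun j _ => ?_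
    exact_mod_cast (sum_pow_modEq h1 (j + 1)).of_dvd (dvd_pow_self _ (by omega))
  have h4 : (p : ℤ) ∣ 2 * ∑ j ∈ Finset.range p, ∑ i ∈ Finset.range (j + 1), α ^ i := by
    rw [← Int.modEq_zero_iff_dvd]
    refine (h3.mul_left 2).trans ?_
    rw [Int.modEq_zero_iff_dvd]
    have : ∀ n : ℕ, 2 * ∑ j ∈ Finset.range n, ((j : ℤ) + 1) = n * (n + 1) := by
      intro n
      induction n with
      | zero => simp
      | succ n ih => rw [Finset.sum_range_succ, mul_add, ih]; push_cast; ring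
    rw [this]
    exact dvd_mul_right _ _
  rw [h2, mul_left_comm, pow_succ]
  exact mul_dvd_mul hα h4

/-- Splitting off a factor `p` of `n` replaces `α` by `α ^ p`, which is one power of `p` closer to
1: the induction trades a unit of `i` for a unit of `l`. -/
theorem pow_dvd_two_mul_geomSum_sub {p : ℕ} (i : ℕ) : ∀ {α : ℤ} {l : ℕ} {n : ℕ}, 1 ≤ l →
    (p : ℤ) ^ l ∣ α - 1 → p ^ i ∣ n → (p : ℤ) ^ (l + i) ∣ 2 * (geomSum α n - n) := by
  induction i with
  | zero =>
    intro α l n hl hα _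
    have h1 : α ≡ 1 [ZMOD (p : ℤ) ^ l] := (Int.modEq_iff_dvd.2 hα).symm
    refine Dvd.dvd.mul_left ?_ 2
    rw [geomSum_eq_mul_sum]
    have := (h1.mul (sum_pow_modEq h1 n))
    rw [one_mul] at this
    exact Int.modEq_iff_dvd.1 this.symm
  | succ i ih =>
    rintro α l n hl hα ⟨n', rfl⟩
    have hp : (p : ℤ) ∣ α - 1 := (dvd_pow_self _ (by omega)).trans hα
    have hα' : (p : ℤ) ^ (l + 1) ∣ α ^ p - 1 :=
      pow_dvd_pow_sub_one (i := 1) hl hα (by simp)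
    obtain ⟨e, he⟩ := pow_dvd_two_mul_sum_prime hl hα
    obtain ⟨z, hz⟩ := ih (n := p ^ i * n') (by omega) hα' (dvd_mul_right _ _)
    obtain ⟨y, hy⟩ := pow_dvd_sum_pow (p := p) (n := p ^ i * n') i
      ((dvd_pow_self _ (by omega)).trans hα') (dvd_mul_right _ _)
    obtain ⟨x, hx⟩ := hα'
    rw [geomSum_eq_mul_sum] at he hz ⊢
    rw [pow_succ' p, mul_assoc, sum_pow_range_mul]
    set G := ∑ j ∈ Finset.range p, α ^ j
    set G' := ∑ j ∈ Finset.range (p ^ i * n'), (α ^ p) ^ j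
    refine ⟨p * (z - 2 * x * y) + e * y, ?_⟩
    push_cast at hz ⊢
    linear_combination G' * he + p * hz - 2 * p * G' * hx +
      ((p : ℤ) ^ (l + 1) * e - 2 * p * (p : ℤ) ^ (l + 1) * x) * hy

/-! ### Finite order of the generators. -/

namespace IsMacdonaldPair

variable {H : Type*} [Group H] {α β : ℤ} {a b : H}

/-- A relation of the shape given by `fundamental` yields an element that is both a power of `a`
and a power of `b`. -/
theorem zpow_eq_zpow_of_rel (h : IsMacdonaldPair α β a b) {k s t : ℕ} {f g : ℤ}
    (hr : rcomm a b ^ s * a ^ f = (rcomm a b ^ k)⁻¹ * b ^ g * rcomm a b ^ (t + k)) :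
    a ^ ((α - 1) * f) = b ^ ((1 - β) * g) := by
  set c := rcomm a b with hc
  set m := t + k + 1 with hm
  have hA : ∀ i : ℤ, a ^ i * c = c * a ^ (α * i) := h.zpow_mul_comm
  have hB : ∀ i : ℤ, c * b ^ i = b ^ (β * i) * c := h.comm_mul_zpow
  have e1 : b ^ g = c ^ k * c ^ s * a ^ f * (c ^ (t + k))⁻¹ := by
    rw [mul_assoc (c ^ k), hr]; group
  -- Conjugation by `c` multiplies the exponent of `b` by `β`; comparison with `e1` then leaves only
  -- `(1 - β) * g` and `(α - 1) * f`.
  have e2 : b ^ (β * g) = c ^ k * c ^ s * (c * a ^ f) * (c ^ m)⁻¹ := by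
    have : b ^ (β * g) = c * b ^ g * c⁻¹ := by rw [hB]; group
    rw [this, e1]
    have hcomm : c * (c ^ k * c ^ s) = c ^ k * c ^ s * c := by
      rw [← pow_add, ← pow_succ, ← pow_succ']
    rw [hm, pow_succ', mul_inv_rev]
    simp only [← mul_assoc] at hcomm ⊢
    rw [hcomm]
  have e3 : b ^ ((1 - β) * g) = c ^ m * a ^ ((α - 1) * f) * (c ^ m)⁻¹ := by
    have h1 : (1 - β) * g = -(β * g) + g := by ring
    have h2 : (α - 1) * f = -f + α * f := by ring
    have h3 : c * a ^ (α * f) * c⁻¹ = a ^ f := by rw [← hA]; group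
    rw [h1, h2, zpow_add, zpow_add, zpow_neg, zpow_neg, e2, e1, ← h3, hm, pow_succ]
    group
  -- `a` is itself a conjugate by `c ^ m` of a power of `a`, so it commutes with the right side of
  -- `e3`. The element thus commutes with `a`, `b` and `c`, and the conjugation in `e3` disappears.
  have e4 : Commute (b ^ ((1 - β) * g)) a := by
    have h1 : a = c ^ m * a ^ (α ^ m) * (c ^ m)⁻¹ := by
      have := h.zpow_mul_comm_pow 1 m
      rw [zpow_one, one_mul] at this
      rw [← this, mul_inv_cancel_right]
    have h2 : Commute (a ^ ((α - 1) * f)) (a ^ (α ^ m)) := (Commute.refl a).zpow_zpow _ _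
    rw [e3]
    nth_rw 2 [h1]
    have := h2.eq
    simp only [commute_iff_eq]
    simp only [mul_assoc, inv_mul_cancel_left, mul_right_inj]
    simp only [← mul_assoc, this]
  have e5 : Commute (b ^ ((1 - β) * g)) c := by
    have hb : Commute (b ^ ((1 - β) * g)) b := (Commute.refl b).zpow_left _
    rw [hc, rcomm]
    exact ((e4.inv_right.mul_right hb.inv_right).mul_right e4).mul_right hb
  have e6 := (e5.pow_right m).eq
  rw [eq_mul_inv_iff_mul_eq, e6, mul_right_inj] at e3
  exact e3.symm

theorem commute_comm {x : H} (ha : Commute x a) (hb : Commute x b) : Commute x (rcomm a b) := by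
  rw [rcomm]
  exact ((ha.inv_right.mul_right hb.inv_right).mul_right ha).mul_right hb

/-- A power of `a` that commutes with `c` is killed by `α - 1`. -/
theorem zpow_eq_one_of_commute (h : IsMacdonaldPair α β a b) {i : ℤ}
    (hi : Commute (a ^ i) (rcomm a b)) : a ^ ((α - 1) * i) = 1 := by
  have := h.zpow_mul_comm i
  rw [hi.eq, mul_right_inj] at this
  rw [sub_mul, one_mul, zpow_sub, ← this, mul_inv_cancel]

theorem zpow_eq_one_of_rel (h : IsMacdonaldPair α β a b) {k s t : ℕ} {f g : ℤ}
    (hr : rcomm a b ^ s * a ^ f = (rcomm a b ^ k)⁻¹ * b ^ g * rcomm a b ^ (t + k)) :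
    a ^ ((α - 1) * ((α - 1) * f)) = 1 := by
  apply h.zpow_eq_one_of_commute
  apply commute_comm
  · exact (Commute.refl a).zpow_left _
  · rw [h.zpow_eq_zpow_of_rel hr]; exact (Commute.refl b).zpow_left _

theorem left_eq_one (h : IsMacdonaldPair 0 β a b) : a = 1 := by
  have := h.conj_left
  rw [rconj, zpow_zero, mul_assoc, inv_mul_eq_one, eq_comm, mul_eq_right] at this
  exact this

/-- For `α = -1`, the square of `a` is conjugate to the square of `c`. -/
theorem sq_mul_right (h : IsMacdonaldPair (-1) β a b) : a ^ 2 * b = b * rcomm a b ^ 2 := by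
  have := h.pow_mul_right 2
  simpa [geomSum, Finset.sum_range_succ] using this

/-- `c` inverts `a ^ 2`. Conjugating by `b`, the element `b⁻¹ * c * b = b ^ (β - 1) * c` inverts `c
^ 2`, hence so does `b ^ (β - 1)`; but moving it past `c ^ 2` also multiplies its exponent by `β ^
2`. -/
theorem comm_pow_four (h : IsMacdonaldPair (-1) β a b) :
    rcomm a b ^ 4 = b ^ ((1 - β) * (β ^ 2 - 1)) := by
  have h2 := h.sq_mul_right
  have hA := h.zpow_mul_comm 2
  have hB := h.comm_mul_zpow
  have hB2 := h.comm_pow_mul_zpow (β - 1) 2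
  set c := rcomm a b with hc
  have e1 : c * b = b ^ β * c := by simpa using hB 1
  have e2 : c ^ 2 * (b ^ (β - 1) * c) = (b ^ (β - 1) * c) * (c ^ 2)⁻¹ := by
    have h3 : c ^ 2 = b⁻¹ * a ^ 2 * b := by rw [mul_assoc, h2]; group
    have h4 : b ^ (β - 1) * c = b⁻¹ * c * b := by rw [mul_assoc, e1, zpow_sub_one]; group
    have h5 : a ^ (2 : ℤ) = a ^ 2 := zpow_ofNat a 2
    rw [h3, h4]
    have h6 : a ^ 2 * c = c * (a ^ 2)⁻¹ := by
      rw [← h5, hA, ← zpow_neg]; norm_num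
    calc b⁻¹ * a ^ 2 * b * (b⁻¹ * c * b) = b⁻¹ * (a ^ 2 * c) * b := by group
      _ = _ := by rw [h6]; group
  have e3 : c ^ 2 * b ^ (β - 1) = b ^ (β - 1) * (c ^ 2)⁻¹ := by
    have h7 : c * (c ^ 2)⁻¹ = (c ^ 2)⁻¹ * c := by group
    rw [← mul_assoc, mul_assoc (b ^ (β - 1)), h7, ← mul_assoc, mul_left_inj] at e2
    exact e2
  rw [hB2] at e3
  have h8 : (1 - β) * (β ^ 2 - 1) = -((β - 1) * β ^ 2) + (β - 1) := by ring
  have h9 : (b ^ ((β - 1) * β ^ 2))⁻¹ * b ^ (β - 1) = c ^ 2 * c ^ 2 := by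
    rw [inv_mul_eq_iff_eq_mul, ← mul_assoc, e3]; group
  rw [h8, zpow_add, zpow_neg, h9, ← pow_add]

theorem isOfFinOrder_of_neg_one (h : IsMacdonaldPair (-1) β a b) (hβ : β ≠ 1) :
    IsOfFinOrder a := by
  have h4 := h.comm_pow_four
  have h2 := h.sq_mul_right
  set c := rcomm a b with hc
  have hc' : IsOfFinOrder c := by
    have hcb : Commute (c ^ 4) b := by rw [h4]; exact (Commute.refl b).zpow_left _
    -- For `β = -1` the exponent in `h4` vanishes. Otherwise `c ^ 4`, being a power of `b`, commutes
    -- with `b`, so the nonzero exponent `β ^ 4 - 1` kills `b`.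
    by_cases hβ' : β = -1
    · rw [hβ'] at h4
      exact isOfFinOrder_iff_pow_eq_one.2 ⟨4, by norm_num, by simpa using h4⟩
    · have h5 := h.comm_pow_mul_zpow 1 4
      rw [← hc, zpow_one, hcb.eq, mul_left_inj, one_mul] at h5
      have hb : b ^ (β ^ 4 - 1) = 1 := by rw [zpow_sub_one, ← h5, mul_inv_cancel]
      have hne : β ^ 4 - 1 ≠ 0 := by
        have : β ^ 4 - 1 = (β - 1) * (β + 1) * (β ^ 2 + 1) := by ring
        rw [this]
        refine mul_ne_zero (mul_ne_zero ?_ ?_) ?_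
        · omega
        · omega
        · positivity
      have hbf : IsOfFinOrder b := isOfFinOrder_iff_zpow_eq_one.2 ⟨_, hne, hb⟩
      have : IsOfFinOrder (c ^ 4) := by rw [h4]; exact hbf.zpow
      exact (isOfFinOrder_pow.1 this).resolve_right (by norm_num)
  have e : a ^ 2 = b * c ^ 2 * b⁻¹ := by rw [← h2]; group
  have : IsOfFinOrder (a ^ 2) := by
    rw [e]
    obtain ⟨n, hn, hn1⟩ := isOfFinOrder_iff_pow_eq_one.1 (hc'.pow (n := 2))
    exact isOfFinOrder_iff_pow_eq_one.2 ⟨n, hn, by rw [conj_pow, hn1]; simp⟩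
  exact (isOfFinOrder_pow.1 this).resolve_right (by norm_num)

/-- If the difference vanished, multiplying by `α - 1` and cancelling one `α` would leave a multiple
of `α` equal to 1. -/
theorem geomSum_sub_ne_zero {α : ℤ} (hα : 2 ≤ α.natAbs) :
    geomSum α (α.natAbs ^ 2) - ((α.natAbs ^ 2 : ℕ) : ℤ) * α ^ (α.natAbs ^ 2) ≠ 0 := by
  intro h0
  have h1 := sub_one_mul_geomSum α (α.natAbs ^ 2)
  obtain ⟨s, hs⟩ : ∃ s, α.natAbs ^ 2 = s + 2 := ⟨α.natAbs ^ 2 - 2, by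
    have : 2 ≤ α.natAbs ^ 2 := by nlinarith
    omega⟩
  rw [hs] at h0 h1
  have hα0 : α ≠ 0 := by rintro rfl; simp at hα
  have h2 : α * (α * (α ^ s * (α - (s + 2) * (α - 1)))) = α * 1 := by
    have : geomSum α (s + 2) = ((s + 2 : ℕ) : ℤ) * α ^ (s + 2) := by linarith
    rw [this] at h1
    push_cast at h1
    linear_combination -h1
  have h3 := mul_left_cancel₀ hα0 h2
  have h4 : IsUnit α := IsUnit.of_mul_eq_one _ h3
  rcases Int.isUnit_iff.1 h4 with rfl | rfl <;> simp at hα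

theorem isOfFinOrder_left (h : IsMacdonaldPair α β a b) (hα : α ≠ 1) (hβ : β ≠ 1) :
    IsOfFinOrder a := by
  by_cases h0 : α = 0
  · subst h0; rw [h.left_eq_one]; exact IsOfFinOrder.one
  by_cases h1 : α = -1
  · subst h1; exact h.isOfFinOrder_of_neg_one hβ
  have h2 : 2 ≤ α.natAbs := by omega
  -- An even `k` makes `α ^ k` and `β ^ k` natural numbers whatever the signs.
  have hr := h.fundamental (k := 2) (s := α.natAbs ^ 2) (t := β.natAbs ^ 2)
    (by rw [← zpow_natCast]; push_cast; rw [sq_abs])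
    (by rw [← zpow_natCast]; push_cast; rw [sq_abs])
  refine isOfFinOrder_iff_zpow_eq_one.2 ⟨_, ?_, h.zpow_eq_one_of_rel hr⟩
  have h3 : α - 1 ≠ 0 := by omega
  exact mul_ne_zero h3 (mul_ne_zero h3 (geomSum_sub_ne_zero h2))

end IsMacdonaldPair

/-! ### Primes dividing the orders of the generators. -/

/-- Otherwise `g ↦ x - (x - 1) * g` permutes the subgroup generated by `x`. The elements of a
nontrivial subgroup of units sum to 0, so comparing sums shows that its order vanishes modulo `q`,
although it divides `q - 1`. -/
theorem ZMod.eq_one_of_affine_maps_powers {q : ℕ} [Fact q.Prime] {x : ZMod q} (hx : x ≠ 0)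
    (H : ∀ k : ℕ, ∃ j : ℤ, x - (x - 1) * x ^ k = x ^ j) : x = 1 := by
  by_contra h1
  set u : (ZMod q)ˣ := Units.mk0 x hx with hu
  have hux : (u : ZMod q) = x := rfl
  have hG : Subgroup.zpowers u ≠ ⊥ := by
    rw [Ne, Subgroup.zpowers_eq_bot]
    intro h; apply h1; rw [← hux, h]; rfl
  have hψ : ∀ g : Subgroup.zpowers u, ∃ g' : Subgroup.zpowers u,
      ((g' : (ZMod q)ˣ) : ZMod q) = x - (x - 1) * ((g : (ZMod q)ˣ) : ZMod q) := by
    rintro ⟨g, hg⟩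
    rw [← mem_powers_iff_mem_zpowers] at hg
    obtain ⟨k, rfl⟩ := hg
    obtain ⟨j, hj⟩ := H k
    refine ⟨⟨u ^ j, j, rfl⟩, ?_⟩
    simp [hux, hj]
  choose ψ hψ using hψ
  have hinj : Function.Injective ψ := by
    intro g g' hgg
    have h2 := hψ g
    rw [hgg, hψ g'] at h2
    have h3 : x - 1 ≠ 0 := sub_ne_zero.2 h1
    have h4 := mul_left_cancel₀ h3 (sub_right_injective h2)
    exact Subtype.ext (Units.ext h4.symm)
  classical
  have hbij := (Finite.injective_iff_bijective.1 hinj)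
  have hsum : ∑ g : Subgroup.zpowers u, ((g : (ZMod q)ˣ) : ZMod q) = 0 :=
    FiniteField.sum_subgroup_units_eq_zero hG
  have hsum2 := hbij.sum_comp (fun g : Subgroup.zpowers u => ((g : (ZMod q)ˣ) : ZMod q))
  simp only [hψ, Finset.sum_sub_distrib, ← Finset.mul_sum, hsum, mul_zero, sub_zero,
    Finset.sum_const, nsmul_eq_mul, Finset.card_univ] at hsum2
  have h5 : ((Fintype.card (Subgroup.zpowers u) : ℕ) : ZMod q) = 0 :=
    (mul_eq_zero.1 hsum2).resolve_right hx
  rw [ZMod.natCast_eq_zero_iff] at h5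
  have h6 : Fintype.card (Subgroup.zpowers u) ∣ q - 1 := by
    rw [← ZMod.card_units q, ← Nat.card_eq_fintype_card, ← Nat.card_eq_fintype_card]
    exact Subgroup.card_subgroup_dvd_card _
  have h7 := Nat.le_of_dvd (by have := (Fact.out : q.Prime).two_le; omega) (h5.trans h6)
  have := (Fact.out : q.Prime).two_le
  omega

namespace IsMacdonaldPair

variable {H : Type*} [Group H] {α β : ℤ} {a b : H}

/-- If `q` divided `α`, conjugation by `c` would send `a ^ (orderOf a / q)` to 1. -/
theorem not_dvd_of_prime_dvd_orderOf (h : IsMacdonaldPair α β a b) (ha : IsOfFinOrder a) {q : ℕ}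
    (hq : q.Prime) (hqa : q ∣ orderOf a) : ¬ (q : ℤ) ∣ α := by
  rintro ⟨r, hr⟩
  obtain ⟨m, hm⟩ := hqa
  have h1 := h.zpow_mul_comm m
  have h2 : a ^ (α * m) = 1 := by
    rw [hr, show (q : ℤ) * r * m = (orderOf a : ℤ) * r by rw [hm]; push_cast; ring, zpow_mul]
    simp
  rw [h2, mul_one, mul_eq_right, zpow_natCast] at h1
  have h3 := orderOf_dvd_of_pow_eq_one h1
  have h4 := ha.orderOf_pos
  have h5 : 0 < m := Nat.pos_of_ne_zero (by rintro rfl; rw [mul_zero] at hm; omega)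
  have := Nat.le_of_dvd h5 h3
  have := hq.two_le
  nlinarith

theorem exists_natCast_zpow {x : H} (hx : IsOfFinOrder x) (i : ℤ) :
    ∃ s : ℕ, x ^ i = x ^ s ∧ (s : ℤ) ≡ i [ZMOD orderOf x] := by
  have h1 : 0 ≤ i % orderOf x := Int.emod_nonneg _ (by have := hx.orderOf_pos; omega)
  refine ⟨(i % orderOf x).toNat, ?_, ?_⟩
  · rw [← zpow_natCast, Int.toNat_of_nonneg h1, zpow_mod_orderOf]
  · rw [Int.toNat_of_nonneg h1]; exact Int.mod_modEq _ _

/-- Every prime divisor of the order of `a` divides `α - 1`. -/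
theorem prime_dvd_sub_one (h : IsMacdonaldPair α β a b) (ha : IsOfFinOrder a) (hb : IsOfFinOrder b)
    {q : ℕ} (hq : q.Prime) (hqa : q ∣ orderOf a) : (q : ℤ) ∣ α - 1 := by
  have hqα := h.not_dvd_of_prime_dvd_orderOf ha hq hqa
  have : Fact q.Prime := ⟨hq⟩
  by_contra hne
  have hx : (α : ZMod q) ≠ 0 := by rwa [Ne, ZMod.intCast_zmod_eq_zero_iff_dvd]
  have hx1 : (α : ZMod q) - 1 ≠ 0 := by
    intro h; apply hne; rw [← ZMod.intCast_zmod_eq_zero_iff_dvd]; push_cast; exact h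
  apply hx1
  rw [sub_eq_zero]
  refine ZMod.eq_one_of_affine_maps_powers hx fun k => ?_
  obtain ⟨s, hs, hs'⟩ := exists_natCast_zpow ha (α ^ k)
  obtain ⟨t, ht, -⟩ := exists_natCast_zpow hb (β ^ k)
  have h1 := orderOf_dvd_iff_zpow_eq_one.2 (h.zpow_eq_one_of_rel (h.fundamental hs ht))
  have h2 : (q : ℤ) ∣ _ := (Int.natCast_dvd_natCast.2 hqa).trans h1
  rw [← ZMod.intCast_zmod_eq_zero_iff_dvd] at h2
  have h3 := sub_one_mul_geomSum α s
  apply_fun ((↑) : ℤ → ZMod q) at h3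
  push_cast at h2 h3
  have h4 : (s : ZMod q) = (α : ZMod q) ^ k := by
    have := (ZMod.intCast_eq_intCast_iff _ _ q).2 (hs'.of_dvd (Int.natCast_dvd_natCast.2 hqa))
    push_cast at this; exact this
  have h5 := (mul_eq_zero.1 ((mul_eq_zero.1 h2).resolve_left hx1)).resolve_left hx1
  rw [h4] at h5
  -- As `s = α ^ k` in `ZMod q`, the vanishing in `h5`, multiplied by `α - 1`, becomes `α - (α - 1)
  -- * α ^ k = α ^ (1 - s)`.
  refine ⟨1 - s, ?_⟩
  rw [zpow_sub₀ hx, zpow_one, zpow_natCast, eq_div_iff (pow_ne_zero _ hx)]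
  linear_combination -h3 + ((α : ZMod q) - 1) * h5

theorem dvd_orderOf_geomSum (h : IsMacdonaldPair α β a b) (ha : IsOfFinOrder a)
    (hb : IsOfFinOrder b) {n : ℕ} (hn : orderOf a ∣ n) : (orderOf a : ℤ) ∣ geomSum α n := by
  rw [Int.natCast_dvd, Nat.dvd_iff_prime_pow_dvd_dvd]
  intro q k hq hqk
  rcases Nat.eq_zero_or_pos k with rfl | hk
  · simp
  rw [← Int.natCast_dvd, Nat.cast_pow]
  exact pow_dvd_geomSum (h.prime_dvd_sub_one ha hb hq ((dvd_pow_self q hk.ne').trans hqk))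
    (hqk.trans hn)

theorem comm_pow_eq_one (h : IsMacdonaldPair α β a b) (ha : IsOfFinOrder a)
    (hb : IsOfFinOrder b) {n : ℕ} (hn : orderOf a ∣ n) : rcomm a b ^ n = 1 := by
  have h1 := h.pow_mul_right n
  rw [orderOf_dvd_iff_pow_eq_one.1 hn, one_mul, left_eq_mul,
    orderOf_dvd_iff_zpow_eq_one.1 (h.dvd_orderOf_geomSum ha hb hn), mul_one] at h1
  exact h1

end IsMacdonaldPair

/-! ### Idempotent exponents and the primary decomposition. -/

/-- `e` is idempotent modulo every prime power divisor of `N`. -/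
def IsSplitting (N e : ℕ) : Prop :=
  ∀ q k : ℕ, q.Prime → 0 < k → q ^ k ∣ N → q ^ k ∣ e ∨ ∃ n, e = 1 + n ∧ q ^ k ∣ n

theorem geomSum_one_add_modEq {q k n : ℕ} {α : ℤ} (hα : (q : ℤ) ∣ α - 1) (hn : q ^ k ∣ n) :
    geomSum α (1 + n) ≡ α [ZMOD (q : ℤ) ^ k] := by
  rw [add_comm, geomSum_succ']
  have := (Int.modEq_zero_iff_dvd.2 (pow_dvd_geomSum hα hn)).mul_left α
  simpa using this.add_left α

theorem pow_modEq_one {q k n : ℕ} {α : ℤ} (hα : (q : ℤ) ∣ α - 1) (hn : q ^ k ∣ n) :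
    α ^ n ≡ 1 [ZMOD (q : ℤ) ^ k] := by
  have := pow_dvd_pow_sub_one (l := 1) le_rfl (by simpa using hα) hn
  exact (Int.modEq_iff_dvd.2 ((pow_dvd_pow _ (by omega)).trans this)).symm

theorem natCast_modEq_zero {q k n : ℕ} (hn : q ^ k ∣ n) : (n : ℤ) ≡ 0 [ZMOD (q : ℤ) ^ k] :=
  Int.modEq_zero_iff_dvd.2 (by exact_mod_cast hn)

theorem natCast_one_add_modEq {q k n : ℕ} (hn : q ^ k ∣ n) :
    ((1 + n : ℕ) : ℤ) ≡ 1 [ZMOD (q : ℤ) ^ k] := by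
  simpa using (natCast_modEq_zero hn).add_left 1

theorem IsSplitting.dvd_mul_self_sub {N e : ℕ} (he : IsSplitting N e) : N ∣ e * e - e := by
  rw [Nat.dvd_iff_prime_pow_dvd_dvd]
  intro q k hq hqk
  rcases Nat.eq_zero_or_pos k with rfl | hk
  · simp
  rw [← Nat.mul_sub_one]
  rcases he q k hq hk hqk with h | ⟨n, rfl, h⟩
  · exact h.mul_right _
  · exact Dvd.dvd.mul_left (by simpa using h) _

namespace IsMacdonaldPair

variable {H : Type*} [Group H] {α β : ℤ} {a b : H}

/-- Exponents may be compared one prime power at a time, and there `α` is congruent to 1 modulo the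
prime. -/
theorem zpow_eq_zpow (h : IsMacdonaldPair α β a b) (ha : IsOfFinOrder a) (hb : IsOfFinOrder b)
    {x y : ℤ} (H : ∀ q k : ℕ, q.Prime → 0 < k → q ^ k ∣ orderOf a → (q : ℤ) ∣ α - 1 →
      x ≡ y [ZMOD (q : ℤ) ^ k]) : a ^ x = a ^ y := by
  rw [zpow_eq_zpow_iff_modEq]
  apply Int.ModEq.symm
  rw [Int.modEq_iff_dvd, Int.natCast_dvd, Nat.dvd_iff_prime_pow_dvd_dvd]
  intro q k hq hqk
  rcases Nat.eq_zero_or_pos k with rfl | hk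
  · simp
  rw [← Int.natCast_dvd, Nat.cast_pow]
  exact Int.modEq_iff_dvd.1 (H q k hq hk hqk
    (h.prime_dvd_sub_one ha hb hq ((dvd_pow_self q hk.ne').trans hqk))).symm

theorem mul_comm_pow_pow (h : IsMacdonaldPair α β a b) (m n : ℕ) :
    (a * rcomm a b ^ m) ^ n = rcomm a b ^ (m * n) * a ^ geomSum (α ^ m) n := by
  induction n with
  | zero => simp [geomSum_zero]
  | succ n ih =>
    have h2 := h.zpow_mul_comm_pow 1 (m * (n + 1))
    rw [zpow_one, one_mul] at h2
    rw [pow_succ', ih, mul_assoc a, ← mul_assoc (rcomm a b ^ m), ← pow_add,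
      show m + m * n = m * (n + 1) by ring, ← mul_assoc, h2,
      mul_assoc, ← zpow_add, geomSum_succ, add_comm (_ ^ _), ← pow_mul]

variable {N : ℕ}

/-- Modulo each prime power `e` is 0 or 1, and in both cases `geomSum α e` agrees with `e * α ^ e`.
-/
theorem pow_mul_right_of_splitting (h : IsMacdonaldPair α β a b) (ha : IsOfFinOrder a)
    (hb : IsOfFinOrder b) (hN : orderOf a ∣ N) {e : ℕ} (he : IsSplitting N e) :
    a ^ e * b = b * (a ^ e * rcomm a b ^ e) := by
  have h1 := h.zpow_mul_comm_pow e e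
  rw [zpow_natCast] at h1
  rw [h.pow_mul_right, h1]
  congr 2
  refine h.zpow_eq_zpow ha hb fun q k hq hk hqk hα => ?_
  rcases he q k hq hk (hqk.trans hN) with h2 | ⟨n, rfl, h2⟩
  · have := Int.modEq_zero_iff_dvd.2 (pow_dvd_geomSum hα h2)
    exact this.trans (by simpa using ((natCast_modEq_zero h2).mul_right (α ^ e)).symm)
  · refine (geomSum_one_add_modEq hα h2).trans ?_
    have h3 := (natCast_one_add_modEq h2).mul ((pow_modEq_one hα h2).mul_left α)
    rw [pow_add, pow_one]
    simpa using h3.symm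

theorem mul_pow_right_of_splitting (h : IsMacdonaldPair α β a b) (ha : IsOfFinOrder a)
    (hb : IsOfFinOrder b) (hN : orderOf b ∣ N) {e : ℕ} (he : IsSplitting N e) :
    a * b ^ e = b ^ e * (a * rcomm a b ^ e) := by
  have := h.symm.pow_mul_right_of_splitting hb ha hN he
  rw [← rcomm_inv a b, inv_pow] at this
  rw [← mul_assoc, this]; group

theorem pow_mul_pow_of_splitting (h : IsMacdonaldPair α β a b) (ha : IsOfFinOrder a)
    (hb : IsOfFinOrder b) (hN : orderOf b ∣ N) {e : ℕ} (he : IsSplitting N e) (n : ℕ) :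
    a ^ n * b ^ e = b ^ e * (rcomm a b ^ (e * n) * a ^ geomSum (α ^ e) n) := by
  rw [← h.mul_comm_pow_pow]
  have h1 : a * rcomm a b ^ e = (b ^ e)⁻¹ * a * (b ^ e) := by
    rw [mul_assoc, h.mul_pow_right_of_splitting ha hb hN he]; group
  have h2 : ((b ^ e)⁻¹ * a * b ^ e) ^ n = (b ^ e)⁻¹ * a ^ n * b ^ e := by
    simpa using conj_pow (a := (b ^ e)⁻¹) (b := a) (i := n)
  rw [h1, h2]; group

/-- Orthogonal idempotents make the power of `c` in the commutation rule trivial, and the remaining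
exponent of `a` is `e` at every prime. -/
theorem commute_of_splitting (h : IsMacdonaldPair α β a b) (ha : IsOfFinOrder a)
    (hb : IsOfFinOrder b) (hNa : orderOf a ∣ N) (hNb : orderOf b ∣ N) {e e' : ℕ}
    (he : IsSplitting N e) (he' : IsSplitting N e') (hee : N ∣ e' * e) :
    Commute (a ^ e) (b ^ e') := by
  rw [commute_iff_eq, h.pow_mul_pow_of_splitting ha hb hNb he',
    h.comm_pow_eq_one ha hb (hNa.trans hee), one_mul, ← zpow_natCast a]
  congr 1
  refine h.zpow_eq_zpow ha hb fun q k hq hk hqk hα => ?_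
  have hα' : (q : ℤ) ∣ α ^ e' - 1 := hα.trans (by simpa using sub_dvd_pow_sub_pow α 1 e')
  rcases he q k hq hk (hqk.trans hNa) with h2 | ⟨n, rfl, h2⟩
  · exact (Int.modEq_zero_iff_dvd.2 (pow_dvd_geomSum hα' h2)).trans (natCast_modEq_zero h2).symm
  · refine (geomSum_one_add_modEq hα' h2).trans
      ((pow_modEq_one hα ?_).trans (natCast_one_add_modEq h2).symm)
    -- Where `e` is 1 modulo `q`, it is prime to `q`, so `q ^ k` must divide `e'`.
    refine Nat.Coprime.dvd_of_dvd_mul_right ?_ ((hqk.trans hNa).trans hee)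
    refine Nat.Coprime.pow_left k ?_
    rw [Nat.Prime.coprime_iff_not_dvd hq]
    intro hd
    have h3 : q ∣ n := (dvd_pow_self q hk.ne').trans h2
    exact hq.one_lt.ne' (Nat.dvd_one.1 ((Nat.dvd_add_left h3).1 hd))

/-- The expansion produces `c ^ (e * e)`, and `c` only sees exponents modulo the order of `a`, where
`e * e` equals `e`. -/
theorem pow_of_splitting (h : IsMacdonaldPair α β a b) (ha : IsOfFinOrder a)
    (hb : IsOfFinOrder b) (hNa : orderOf a ∣ N) (hNb : orderOf b ∣ N) {e : ℕ}
    (he : IsSplitting N e) : rcomm (a ^ e) (b ^ e) = rcomm a b ^ e := by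
  have h0 : rcomm a b ^ (e * e) = rcomm a b ^ e := by
    have h1 : e * e = (e * e - e) + e := by
      rw [Nat.sub_add_cancel]; exact Nat.le_mul_self e
    rw [h1, pow_add, h.comm_pow_eq_one ha hb (hNa.trans he.dvd_mul_self_sub), one_mul]
  have h1 : a ^ e * b ^ e = b ^ e * (a ^ e * rcomm a b ^ e) := by
    have h1 := h.zpow_mul_comm_pow e e
    rw [zpow_natCast] at h1
    rw [h.pow_mul_pow_of_splitting ha hb hNb he, h0, h1]
    congr 2
    refine h.zpow_eq_zpow ha hb fun q k hq hk hqk hα => ?_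
    have hα' : (q : ℤ) ∣ α ^ e - 1 := hα.trans (by simpa using sub_dvd_pow_sub_pow α 1 e)
    rcases he q k hq hk (hqk.trans hNa) with h2 | ⟨n, rfl, h2⟩
    · have := Int.modEq_zero_iff_dvd.2 (pow_dvd_geomSum hα' h2)
      exact this.trans (by simpa using ((natCast_modEq_zero h2).mul_right (α ^ e)).symm)
    · refine (geomSum_one_add_modEq hα' h2).trans ?_
      have h3 := (natCast_one_add_modEq h2).mul_right (α ^ (1 + n))
      simpa using h3.symm
  rw [rcomm, mul_assoc, h1]; group

theorem rconj_pow_of_splitting (h : IsMacdonaldPair α β a b) (ha : IsOfFinOrder a)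
    (hb : IsOfFinOrder b) (hNa : orderOf a ∣ N) (hNb : orderOf b ∣ N) {e : ℕ}
    (he : IsSplitting N e) : rconj (a ^ e) (rcomm (a ^ e) (b ^ e)) = (a ^ e) ^ α := by
  have h1 := h.zpow_mul_comm_pow e e
  rw [zpow_natCast] at h1
  rw [h.pow_of_splitting ha hb hNa hNb he, rconj, mul_assoc, h1, inv_mul_cancel_left,
    ← zpow_natCast, ← zpow_mul]
  refine h.zpow_eq_zpow ha hb fun q k hq hk hqk hα => ?_
  rcases he q k hq hk (hqk.trans hNa) with h2 | ⟨n, rfl, h2⟩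
  · have h3 := natCast_modEq_zero h2
    exact (h3.mul_right _).trans (by simpa using (h3.mul_right α).symm)
  · rw [pow_add, pow_one]
    simpa using ((pow_modEq_one hα h2).mul_left α).mul_left ((1 + n : ℕ) : ℤ)

/-- Raising both generators to an idempotent exponent preserves the Macdonald relations. -/
theorem of_splitting (h : IsMacdonaldPair α β a b) (ha : IsOfFinOrder a)
    (hb : IsOfFinOrder b) (hNa : orderOf a ∣ N) (hNb : orderOf b ∣ N) {e : ℕ}
    (he : IsSplitting N e) : IsMacdonaldPair α β (a ^ e) (b ^ e) :=
  ⟨h.rconj_pow_of_splitting ha hb hNa hNb he, h.symm.rconj_pow_of_splitting hb ha hNb hNa he⟩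

end IsMacdonaldPair

theorem Nat.exists_primary_idempotent {N p : ℕ} (hN : N ≠ 0) (hp : p.Prime) :
    ∃ e : ℕ, 1 ≤ e ∧ p ^ N.factorization p ∣ e - 1 ∧ N / p ^ N.factorization p ∣ e := by
  have hco : Nat.Coprime (p ^ N.factorization p) (N / p ^ N.factorization p) :=
    (Nat.coprime_ordCompl hp hN).pow_left _
  obtain ⟨e, h1, h2⟩ := Nat.chineseRemainder hco 1 0
  have h3 : p ^ N.factorization p * (N / p ^ N.factorization p) = N :=
    Nat.mul_div_cancel' (Nat.ordProj_dvd N p)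
  refine ⟨e + N, by omega, ?_, ?_⟩
  · refine (Nat.modEq_iff_dvd' (by omega)).1 ?_
    have : e + N ≡ 1 + 0 [MOD p ^ N.factorization p] :=
      h1.add (Nat.modEq_zero_iff_dvd.2 (Nat.ordProj_dvd N p))
    simpa using this.symm
  · exact dvd_add (Nat.modEq_zero_iff_dvd.1 h2) (Nat.ordCompl_dvd N p)

/-- A choice of idempotents modulo `N`, one for each prime divisor of `N`. -/
noncomputable def primaryIdempotent (N p : ℕ) : ℕ :=
  if h : N ≠ 0 ∧ p.Prime then (Nat.exists_primary_idempotent h.1 h.2).choose else 0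

section

variable {N p : ℕ}

theorem primaryIdempotent_eq (hN : N ≠ 0) (hp : p.Prime) :
    ∃ n, primaryIdempotent N p = 1 + n ∧ p ^ N.factorization p ∣ n := by
  have := (Nat.exists_primary_idempotent hN hp).choose_spec
  rw [primaryIdempotent, dif_pos ⟨hN, hp⟩]
  exact ⟨_, (Nat.add_sub_cancel' this.1).symm, this.2.1⟩

theorem ordCompl_dvd_primaryIdempotent (hN : N ≠ 0) (hp : p.Prime) :
    N / p ^ N.factorization p ∣ primaryIdempotent N p := by
  have := (Nat.exists_primary_idempotent hN hp).choose_spec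
  rw [primaryIdempotent, dif_pos ⟨hN, hp⟩]
  exact this.2.2

theorem dvd_primaryIdempotent_mul (hN : N ≠ 0) (hp : p.Prime) :
    N ∣ primaryIdempotent N p * p ^ N.factorization p := by
  conv_lhs => rw [← Nat.div_mul_cancel (Nat.ordProj_dvd N p)]
  exact mul_dvd_mul_right (ordCompl_dvd_primaryIdempotent hN hp) _

theorem dvd_primaryIdempotent_of_ne (hN : N ≠ 0) (hp : p.Prime) {q k : ℕ} (hq : q.Prime)
    (hqp : q ≠ p) (hk : q ^ k ∣ N) : q ^ k ∣ primaryIdempotent N p := by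
  refine Dvd.dvd.trans ?_ (ordCompl_dvd_primaryIdempotent hN hp)
  rw [← Nat.mul_div_cancel' (Nat.ordProj_dvd N p)] at hk
  exact (Nat.Coprime.pow _ _ ((Nat.coprime_primes hq hp).2 hqp)).dvd_of_dvd_mul_left hk

theorem primaryIdempotent_isSplitting (hN : N ≠ 0) (hp : p.Prime) :
    IsSplitting N (primaryIdempotent N p) := by
  intro q k hq _ hk
  by_cases hqp : q = p
  · subst hqp
    obtain ⟨n, h1, h2⟩ := primaryIdempotent_eq hN hq
    exact .inr ⟨n, h1, ((hq.pow_dvd_iff_dvd_ordProj hN).1 hk).trans h2⟩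
  · exact .inl (dvd_primaryIdempotent_of_ne hN hp hq hqp hk)

theorem dvd_primaryIdempotent_mul_of_ne (hN : N ≠ 0) (hp : p.Prime) {q : ℕ} (hq : q.Prime)
    (hqp : q ≠ p) : N ∣ primaryIdempotent N p * primaryIdempotent N q := by
  rw [Nat.dvd_iff_prime_pow_dvd_dvd]
  intro r k hr hk
  by_cases hrp : r = p
  · exact (dvd_primaryIdempotent_of_ne hN hq hr (hrp ▸ hqp.symm) hk).mul_left _
  · exact (dvd_primaryIdempotent_of_ne hN hp hr hrp hk).mul_right _

theorem sum_primaryIdempotent_modEq (hN : N ≠ 0) :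
    (N : ℤ) ∣ ((∑ p ∈ N.primeFactors, primaryIdempotent N p : ℕ) : ℤ) - 1 := by
  rw [Int.natCast_dvd, Nat.dvd_iff_prime_pow_dvd_dvd]
  intro q k hq hk
  rcases Nat.eq_zero_or_pos k with rfl | hk0
  · simp
  have hqN : q ∈ N.primeFactors := Nat.mem_primeFactors.2 ⟨hq, (dvd_pow_self q hk0.ne').trans hk, hN⟩
  rw [← Int.natCast_dvd, ← Finset.add_sum_erase _ _ hqN]
  obtain ⟨n, h1, h2⟩ := primaryIdempotent_eq hN hq
  rw [h1]
  push_cast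
  rw [add_assoc, add_sub_cancel_left]
  refine dvd_add ?_ (Finset.dvd_sum fun p hp => ?_)
  · exact_mod_cast ((hq.pow_dvd_iff_dvd_ordProj hN).1 hk).trans h2
  · obtain ⟨h3, h4⟩ := Finset.mem_erase.1 hp
    exact_mod_cast dvd_primaryIdempotent_of_ne hN (Nat.prime_of_mem_primeFactors h4) hq h3.symm hk

end

theorem map_rcomm {G H : Type*} [Group G] [Group H] (f : G →* H) (x y : G) :
    f (rcomm x y) = rcomm (f x) (f y) := by simp [rcomm]

theorem map_rconj {G H : Type*} [Group G] [Group H] (f : G →* H) (x y : G) :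
    f (rconj x y) = rconj (f x) (f y) := by simp [rconj]

namespace MacdonaldGroup

variable {α β : ℤ}

theorem isMacdonaldPair (α β : ℤ) : IsMacdonaldPair α β (A α β) (B α β) := by
  constructor
  · have := PresentedGroup.one_of_mem (rels := macdonaldRels α β)
      (x := rconj (FreeGroup.of 0) (rcomm (FreeGroup.of 0) (FreeGroup.of 1)) *
        (FreeGroup.of 0 ^ α)⁻¹) (by simp [macdonaldRels])
    rwa [map_mul, map_inv, mul_inv_eq_one, map_rconj, map_rcomm, map_zpow] at this
  · have := PresentedGroup.one_of_mem (rels := macdonaldRels α β)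
      (x := rconj (FreeGroup.of 1) (rcomm (FreeGroup.of 1) (FreeGroup.of 0)) *
        (FreeGroup.of 1 ^ β)⁻¹) (by simp [macdonaldRels])
    rwa [map_mul, map_inv, mul_inv_eq_one, map_rconj, map_rcomm, map_zpow] at this

theorem closure_eq_top (α β : ℤ) : Subgroup.closure {A α β, B α β} = ⊤ := by
  rw [← PresentedGroup.closure_range_of (macdonaldRels α β)]
  congr 1
  ext x
  simp [Fin.exists_fin_two, A, B, eq_comm]

/-- The universal property of the Macdonald group. -/
def lift {H : Type*} [Group H] {a b : H} (h : IsMacdonaldPair α β a b) :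
    MacdonaldGroup α β →* H :=
  PresentedGroup.toGroup (f := ![a, b]) (by
    rintro r (rfl | rfl)
    · simp [map_rconj, map_rcomm, h.conj_left]
    · simp [map_rconj, map_rcomm, h.conj_right])

@[simp]
theorem lift_A {H : Type*} [Group H] {a b : H} (h : IsMacdonaldPair α β a b) :
    lift h (A α β) = a := by simp [lift, A]

@[simp]
theorem lift_B {H : Type*} [Group H] {a b : H} (h : IsMacdonaldPair α β a b) :
    lift h (B α β) = b := by simp [lift, B]

theorem hom_ext {H : Type*} [Group H] {f g : MacdonaldGroup α β →* H}
    (hA : f (A α β) = g (A α β)) (hB : f (B α β) = g (B α β)) : f = g := by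
  refine PresentedGroup.ext fun i => ?_
  fin_cases i
  · exact hA
  · exact hB

theorem isOfFinOrder_A (hα : α ≠ 1) (hβ : β ≠ 1) : IsOfFinOrder (A α β) :=
  (isMacdonaldPair α β).isOfFinOrder_left hα hβ

theorem isOfFinOrder_B (hα : α ≠ 1) (hβ : β ≠ 1) : IsOfFinOrder (B α β) :=
  (isMacdonaldPair α β).symm.isOfFinOrder_left hβ hα

/-- A common multiple of `3` and the orders of the generators. -/
noncomputable def exponentBound (α β : ℤ) : ℕ := 3 * (orderOf (A α β) * orderOf (B α β))

theorem exponentBound_ne_zero (hα : α ≠ 1) (hβ : β ≠ 1) : exponentBound α β ≠ 0 := by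
  have h1 := (isOfFinOrder_A hα hβ).orderOf_pos
  have h2 := (isOfFinOrder_B hα hβ).orderOf_pos
  unfold exponentBound
  positivity

theorem orderOf_A_dvd (α β : ℤ) : orderOf (A α β) ∣ exponentBound α β :=
  (dvd_mul_right _ _).mul_left _

theorem orderOf_B_dvd (α β : ℤ) : orderOf (B α β) ∣ exponentBound α β :=
  (dvd_mul_left _ _).mul_left _

theorem isMacdonaldPair_primary (hα : α ≠ 1) (hβ : β ≠ 1) {p : ℕ} (hp : p.Prime) :
    IsMacdonaldPair α β (A α β ^ primaryIdempotent (exponentBound α β) p)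
      (B α β ^ primaryIdempotent (exponentBound α β) p) :=
  (isMacdonaldPair α β).of_splitting (isOfFinOrder_A hα hβ) (isOfFinOrder_B hα hβ)
    (orderOf_A_dvd α β) (orderOf_B_dvd α β)
    (primaryIdempotent_isSplitting (exponentBound_ne_zero hα hβ) hp)

/-- The projection of the Macdonald group onto its `p`-primary component. -/
noncomputable def primaryHom (hα : α ≠ 1) (hβ : β ≠ 1) {p : ℕ} (hp : p.Prime) :
    MacdonaldGroup α β →* MacdonaldGroup α β :=
  lift (isMacdonaldPair_primary hα hβ hp)

/-- An element commuting with the images of `A` and `B` commutes with the whole image, because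
conjugation by it fixes the homomorphism on generators. This reduces the claim to powers of `A` and
`B`. -/
theorem commute_primaryHom (hα : α ≠ 1) (hβ : β ≠ 1) {p q : ℕ} (hp : p.Prime) (hq : q.Prime)
    (hpq : p ≠ q) (x y : MacdonaldGroup α β) :
    Commute (primaryHom hα hβ hp x) (primaryHom hα hβ hq y) := by
  have key : ∀ (z : MacdonaldGroup α β) {r : ℕ} (hr : r.Prime),
      Commute z (primaryHom hα hβ hr (A α β)) → Commute z (primaryHom hα hβ hr (B α β)) →
      ∀ x, Commute z (primaryHom hα hβ hr x) := by
    intro z r hr h1 h2 x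
    have : (MulAut.conj z).toMonoidHom.comp (primaryHom hα hβ hr) = primaryHom hα hβ hr := by
      apply hom_ext
      · simpa [mul_inv_eq_iff_eq_mul] using h1.eq
      · simpa [mul_inv_eq_iff_eq_mul] using h2.eq
    have h3 := DFunLike.congr_fun this x
    simpa [mul_inv_eq_iff_eq_mul, commute_iff_eq] using h3
  have hN := exponentBound_ne_zero hα hβ
  have hAB : ∀ {p q : ℕ} (hp : p.Prime) (hq : q.Prime), p ≠ q →
      Commute (primaryHom hα hβ hp (A α β)) (primaryHom hα hβ hq (B α β)) := by
    intro p q hp hq hpq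
    simp only [primaryHom, lift_A, lift_B]
    exact (isMacdonaldPair α β).commute_of_splitting (isOfFinOrder_A hα hβ) (isOfFinOrder_B hα hβ)
      (orderOf_A_dvd α β) (orderOf_B_dvd α β) (primaryIdempotent_isSplitting hN hp)
      (primaryIdempotent_isSplitting hN hq) (dvd_primaryIdempotent_mul_of_ne hN hq hp hpq)
  refine key _ hq ?_ ?_ y
  · refine (key _ hp ?_ ?_ x).symm
    · simp only [primaryHom, lift_A]
      exact (Commute.refl _).pow_pow _ _
    · exact hAB hq hp hpq.symm
  · refine (key _ hp ?_ ?_ x).symm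
    · exact (hAB hp hq hpq).symm
    · simp only [primaryHom, lift_B]
      exact (Commute.refl _).pow_pow _ _

/-- The ranges commute pairwise, so the product of the `primaryHom`s is an endomorphism. It fixes
`A` and `B` because the idempotents sum to 1 modulo their orders, hence it is the identity. -/
theorem primaryHom_injective (hα : α ≠ 1) (hβ : β ≠ 1) {x : MacdonaldGroup α β}
    (hx : ∀ p (hp : p ∈ (exponentBound α β).primeFactors),
      primaryHom hα hβ (Nat.prime_of_mem_primeFactors hp) x = 1) : x = 1 := by
  set N := exponentBound α β with hNdef
  have hN : N ≠ 0 := exponentBound_ne_zero hα hβ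
  let ϕ : N.primeFactors → MacdonaldGroup α β →* MacdonaldGroup α β :=
    fun p => primaryHom hα hβ (Nat.prime_of_mem_primeFactors p.2)
  let M : N.primeFactors → Subgroup (MacdonaldGroup α β) := fun p => (ϕ p).range
  have hcomm : Pairwise fun i j => ∀ (x : M i) (y : M j),
      Commute ((M i).subtype x) ((M j).subtype y) := by
    rintro i j hij ⟨_, x, rfl⟩ ⟨_, y, rfl⟩
    exact commute_primaryHom hα hβ (Nat.prime_of_mem_primeFactors i.2)
      (Nat.prime_of_mem_primeFactors j.2) (fun h => hij (Subtype.ext h)) x y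
  let Φ := (MonoidHom.noncommPiCoprod (fun i => (M i).subtype) hcomm).comp
    (MonoidHom.pi fun i => (ϕ i).rangeRestrict)
  have hpow : ∀ (g : MacdonaldGroup α β), orderOf g ∣ N →
      ∀ hc, Finset.univ.noncommProd
        (fun i : N.primeFactors => g ^ primaryIdempotent N i) hc = g := by
    intro g hg hc
    have h1 := Finset.map_noncommProd (Finset.univ : Finset N.primeFactors)
      (fun i => Multiplicative.ofAdd (primaryIdempotent N i)) (fun _ _ _ _ _ => Commute.all _ _)
      (powersHom (MacdonaldGroup α β) g)
    simp only [powersHom_apply, toAdd_ofAdd] at h1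
    rw [← h1, Finset.noncommProd_eq_prod, ← ofAdd_sum, toAdd_ofAdd]
    rw [Finset.sum_coe_sort N.primeFactors (fun p => primaryIdempotent N p)]
    have h2 := (Int.natCast_dvd_natCast.2 hg).trans (sum_primaryIdempotent_modEq hN)
    have h3 := orderOf_dvd_iff_zpow_eq_one.1 h2
    rwa [zpow_sub_one, zpow_natCast, mul_inv_eq_one] at h3
  have hΦ' : ∀ y, Φ y = Finset.univ.noncommProd (fun i => ϕ i y)
      (fun i _ j _ hij => hcomm hij ⟨_, y, rfl⟩ ⟨_, y, rfl⟩) := fun y => rfl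
  have hΦ : Φ = MonoidHom.id _ := by
    apply hom_ext
    · rw [hΦ']
      refine Eq.trans (Finset.noncommProd_congr rfl (fun i _ => lift_A _) _)
        (hpow (A α β) (orderOf_A_dvd α β) (fun _ _ _ _ _ => (Commute.refl _).pow_pow _ _))
    · rw [hΦ']
      refine Eq.trans (Finset.noncommProd_congr rfl (fun i _ => lift_B _) _)
        (hpow (B α β) (orderOf_B_dvd α β) (fun _ _ _ _ _ => (Commute.refl _).pow_pow _ _))
  have h1 : Φ x = x := by rw [hΦ]; rfl
  have h2 : (MonoidHom.pi fun i => (ϕ i).rangeRestrict) x = 1 := by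
    ext i
    exact hx i i.2
  rw [← h1, MonoidHom.comp_apply, h2, map_one]

end MacdonaldGroup

/-! ### Central powers and the class bound for odd primes. -/

theorem Subgroup.upperCentralSeries_succ_eq_top {G : Type*} [Group G] {n : ℕ}
    (h : Subgroup.upperCentralSeries (G ⧸ Subgroup.center G) n = ⊤) :
    Subgroup.upperCentralSeries G (n + 1) = ⊤ := by
  rw [← Subgroup.comap_upperCentralSeries_quotient_center, h, Subgroup.comap_top]

theorem Subgroup.mem_center_of_closure_pair {G : Type*} [Group G] {a b x : G}
    (hG : Subgroup.closure {a, b} = ⊤) (ha : Commute x a) (hb : Commute x b) :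
    x ∈ Subgroup.center G := by
  have : Subgroup.closure {a, b} ≤ Subgroup.centralizer {x} := by
    rw [Subgroup.closure_le]
    rintro y (rfl | rfl) <;> simp only [SetLike.mem_coe, Subgroup.mem_centralizer_singleton_iff]
    · exact ha.eq.symm
    · exact hb.eq.symm
  rw [hG] at this
  rw [Subgroup.mem_center_iff]
  intro g
  exact Subgroup.mem_centralizer_singleton_iff.1 (this (Subgroup.mem_top g))

theorem Subgroup.closure_pair_map_eq_top {G K : Type*} [Group G] [Group K] {a b : G}
    (hG : Subgroup.closure {a, b} = ⊤) {f : G →* K} (hf : Function.Surjective f) :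
    Subgroup.closure {f a, f b} = ⊤ := by
  have := congrArg (Subgroup.map f) hG
  rwa [MonoidHom.map_closure, Set.image_pair, Subgroup.map_top_of_surjective f hf] at this

namespace IsMacdonaldPair

variable {H : Type*} [Group H] {α β : ℤ} {a b : H}

theorem commute_comm_pow_left (h : IsMacdonaldPair α β a b) {n : ℕ}
    (hn : a ^ (α ^ n - 1) = 1) : Commute (rcomm a b ^ n) a := by
  have := h.zpow_mul_comm_pow 1 n
  rw [zpow_sub_one, mul_inv_eq_one] at hn
  rw [zpow_one, one_mul, hn] at this
  exact this.symm

theorem commute_comm_pow_right (h : IsMacdonaldPair α β a b) {n : ℕ}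
    (hn : b ^ (β ^ n - 1) = 1) : Commute (rcomm a b ^ n) b := by
  have := h.symm.commute_comm_pow_left hn
  rw [← rcomm_inv a b, inv_pow] at this
  simpa using this.inv_left

theorem commute_pow_left (h : IsMacdonaldPair α β a b) {n : ℕ}
    (hc : rcomm a b ^ n = 1) (hn : a ^ (geomSum α n - n) = 1) : Commute (a ^ n) b := by
  have := h.pow_mul_right n
  rw [zpow_sub, mul_inv_eq_one] at hn
  rwa [hc, one_mul, hn, zpow_natCast] at this

theorem commute_pow_right (h : IsMacdonaldPair α β a b) {n : ℕ}
    (hc : rcomm a b ^ n = 1) (hn : b ^ (geomSum β n - n) = 1) : Commute (b ^ n) a :=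
  h.symm.commute_pow_left (by rw [← rcomm_inv a b, inv_pow, hc, inv_one]) hn

theorem comm_pow_mem_center (h : IsMacdonaldPair α β a b) (hH : Subgroup.closure {a, b} = ⊤)
    {n : ℕ} (ha : a ^ (α ^ n - 1) = 1) (hb : b ^ (β ^ n - 1) = 1) :
    rcomm a b ^ n ∈ Subgroup.center H :=
  Subgroup.mem_center_of_closure_pair hH (h.commute_comm_pow_left ha) (h.commute_comm_pow_right hb)

theorem left_pow_mem_center (h : IsMacdonaldPair α β a b) (hH : Subgroup.closure {a, b} = ⊤)
    {n : ℕ} (hc : rcomm a b ^ n = 1) (ha : a ^ (geomSum α n - n) = 1) :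
    a ^ n ∈ Subgroup.center H :=
  Subgroup.mem_center_of_closure_pair hH ((Commute.refl a).pow_left n) (h.commute_pow_left hc ha)

theorem right_pow_mem_center (h : IsMacdonaldPair α β a b) (hH : Subgroup.closure {a, b} = ⊤)
    {n : ℕ} (hc : rcomm a b ^ n = 1) (hb : b ^ (geomSum β n - n) = 1) :
    b ^ n ∈ Subgroup.center H :=
  Subgroup.mem_center_of_closure_pair hH (h.commute_pow_right hc hb) ((Commute.refl b).pow_left n)

theorem upperCentralSeries_one_of_comm (hH : Subgroup.closure {a, b} = ⊤) (hc : rcomm a b = 1) :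
    Subgroup.upperCentralSeries H 1 = ⊤ := by
  have hab : Commute a b := by
    have := mul_right_eq a b
    rwa [hc, mul_one] at this
  rw [Subgroup.upperCentralSeries_one, eq_top_iff, ← hH, Subgroup.closure_le]
  rintro x (rfl | rfl)
  · exact Subgroup.mem_center_of_closure_pair hH (Commute.refl _) hab
  · exact Subgroup.mem_center_of_closure_pair hH hab.symm (Commute.refl _)

theorem mk_center (h : IsMacdonaldPair α β a b) :
    IsMacdonaldPair α β (a : H ⧸ Subgroup.center H) (b : H ⧸ Subgroup.center H) :=
  h.map (QuotientGroup.mk' _)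

theorem closure_mk_center (hH : Subgroup.closure {a, b} = ⊤) :
    Subgroup.closure {(a : H ⧸ Subgroup.center H), (b : H ⧸ Subgroup.center H)} = ⊤ :=
  Subgroup.closure_pair_map_eq_top hH (f := QuotientGroup.mk' (Subgroup.center H))
    (QuotientGroup.mk'_surjective _)

theorem mk_center_pow_eq_one {x : H} {n : ℕ} (hx : x ^ n ∈ Subgroup.center H) :
    (x : H ⧸ Subgroup.center H) ^ n = 1 := by
  rw [← QuotientGroup.mk_pow, QuotientGroup.eq_one_iff]
  exact hx

theorem mk_center_comm (a b : H) : rcomm (a : H ⧸ Subgroup.center H) (b : H ⧸ Subgroup.center H) =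
    (rcomm a b : H) := (map_rcomm (QuotientGroup.mk' _) a b).symm

theorem mk_center_comm_pow_eq_one {n : ℕ} (hx : rcomm a b ^ n ∈ Subgroup.center H) :
    rcomm (a : H ⧸ Subgroup.center H) (b : H ⧸ Subgroup.center H) ^ n = 1 := by
  rw [mk_center_comm]; exact mk_center_pow_eq_one hx

end IsMacdonaldPair

theorem zpow_eq_one_of_natCast_pow_dvd {H : Type*} [Group H] {x : H} {p n : ℕ} {z : ℤ}
    (hx : x ^ p ^ n = 1) (hz : (p : ℤ) ^ n ∣ z) : x ^ z = 1 := by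
  obtain ⟨y, rfl⟩ := hz
  rw [zpow_mul, ← Nat.cast_pow, zpow_natCast, hx, one_zpow]

theorem pow_pow_eq_one_of_le {H : Type*} [Group H] {x : H} {p m n : ℕ}
    (hx : x ^ p ^ m = 1) (hmn : m ≤ n) : x ^ p ^ n = 1 :=
  orderOf_dvd_iff_pow_eq_one.1 ((orderOf_dvd_of_pow_eq_one hx).trans (pow_dvd_pow p hmn))

theorem pow_dvd_geomSum_sub {p : ℕ} (hp : p.Prime) (hp2 : p ≠ 2) {α : ℤ} {l i n : ℕ} (hl : 1 ≤ l)
    (hα : (p : ℤ) ^ l ∣ α - 1) (hn : p ^ i ∣ n) : (p : ℤ) ^ (l + i) ∣ geomSum α n - n := by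
  refine IsCoprime.dvd_of_dvd_mul_left ?_ (pow_dvd_two_mul_geomSum_sub i hl hα hn)
  refine IsCoprime.pow_left ?_
  exact_mod_cast Nat.isCoprime_iff_coprime.2 ((Nat.coprime_primes hp Nat.prime_two).2 hp2)

/-- Each unit of `j` costs two central layers: `c ^ p ^ (m * j)` is central, and once it is killed
so are `a ^ p ^ (m * j)` and `b ^ p ^ (m * j)`. As `m ≤ μ, ν`, killing these gives the hypotheses
for `j - 1`. At `j = 0` the element `c` itself is central. -/
theorem IsMacdonaldPair.upperCentralSeries_of_odd {p : ℕ} (hp : p.Prime) (hp2 : p ≠ 2) {α β : ℤ}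
    {m μ ν : ℕ} (hm : 1 ≤ m) (hμ : m ≤ μ) (hν : m ≤ ν) (hα : (p : ℤ) ^ μ ∣ α - 1)
    (hβ : (p : ℤ) ^ ν ∣ β - 1) (j : ℕ) : ∀ {H : Type*} [Group H] {a b : H},
      IsMacdonaldPair α β a b → Subgroup.closure {a, b} = ⊤ →
      a ^ p ^ (μ + m * j) = 1 → b ^ p ^ (ν + m * j) = 1 →
      Subgroup.upperCentralSeries H (2 * j + 2) = ⊤ := by
  induction j with
  | zero =>
    intro H _ a b h hH ha hb
    refine Subgroup.upperCentralSeries_succ_eq_top ?_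
    refine upperCentralSeries_one_of_comm (closure_mk_center hH) ?_
    have := mk_center_comm_pow_eq_one (h.comm_pow_mem_center (n := 1) hH ?_ ?_)
    · simpa using this
    · exact zpow_eq_one_of_natCast_pow_dvd ha (by simpa using hα)
    · exact zpow_eq_one_of_natCast_pow_dvd hb (by simpa using hβ)
  | succ j ih =>
    intro H _ a b h hH ha hb
    refine Subgroup.upperCentralSeries_succ_eq_top (n := 2 * j + 3) ?_
    have h1 := mk_center_comm_pow_eq_one (h.comm_pow_mem_center (n := p ^ (m * (j + 1))) hH
      (zpow_eq_one_of_natCast_pow_dvd ha (pow_dvd_pow_sub_one (by omega) hα dvd_rfl))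
      (zpow_eq_one_of_natCast_pow_dvd hb (pow_dvd_pow_sub_one (by omega) hβ dvd_rfl)))
    have ha1 := mk_center_pow_eq_one (ha ▸ Subgroup.one_mem _)
    have hb1 := mk_center_pow_eq_one (hb ▸ Subgroup.one_mem _)
    have hH1 := closure_mk_center hH
    replace h := h.mk_center
    refine Subgroup.upperCentralSeries_succ_eq_top (n := 2 * j + 2) ?_
    have ha2 := mk_center_pow_eq_one (h.left_pow_mem_center hH1 h1
      (zpow_eq_one_of_natCast_pow_dvd ha1 (by
        exact_mod_cast pow_dvd_geomSum_sub hp hp2 (by omega) hα dvd_rfl)))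
    have hb2 := mk_center_pow_eq_one (h.right_pow_mem_center hH1 h1
      (zpow_eq_one_of_natCast_pow_dvd hb1 (by
        exact_mod_cast pow_dvd_geomSum_sub hp hp2 (by omega) hβ dvd_rfl)))
    exact ih h.mk_center (closure_mk_center hH1)
      (pow_pow_eq_one_of_le ha2 (by rw [Nat.mul_succ]; omega))
      (pow_pow_eq_one_of_le hb2 (by rw [Nat.mul_succ]; omega))

/-! ### Expansion and valuation of the exponents in the fundamental relation. -/

theorem exists_six_mul_eq (n : ℕ) : ∃ t : ℤ, (n : ℤ) * (n - 1) * (n - 2) = 6 * t := by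
  induction n with
  | zero => exact ⟨0, by simp⟩
  | succ n ih =>
    obtain ⟨t, ht⟩ := ih
    obtain ⟨r, hr⟩ := Int.even_mul_pred_self n
    refine ⟨t + r, ?_⟩
    push_cast
    linear_combination ht + 3 * hr

/-- The binomial expansion in `α - 1` up to third order; the factor 24 clears all denominators, here
and after summation over the exponents. -/
theorem exists_pow_expansion (α : ℤ) (n : ℕ) : ∃ y : ℤ,
    24 * α ^ n = 24 + 24 * n * (α - 1) + 12 * n * (n - 1) * (α - 1) ^ 2 +
      4 * n * (n - 1) * (n - 2) * (α - 1) ^ 3 + 24 * (α - 1) ^ 4 * y := by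
  induction n with
  | zero => exact ⟨0, by simp⟩
  | succ n ih =>
    obtain ⟨y, hy⟩ := ih
    obtain ⟨t, ht⟩ := exists_six_mul_eq n
    refine ⟨t + y * α, ?_⟩
    push_cast
    rw [pow_succ]
    linear_combination α * hy + 4 * (α - 1) ^ 4 * ht

theorem exists_geomSum_expansion (α : ℤ) (n : ℕ) : ∃ y : ℤ,
    24 * geomSum α n = 24 * n + 12 * n * (n + 1) * (α - 1) +
      4 * (n + 1) * n * (n - 1) * (α - 1) ^ 2 +
      (n + 1) * n * (n - 1) * (n - 2) * (α - 1) ^ 3 + 24 * (α - 1) ^ 4 * y := by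
  induction n with
  | zero => exact ⟨0, by simp [geomSum_zero]⟩
  | succ n ih =>
    obtain ⟨y, hy⟩ := ih
    obtain ⟨z, hz⟩ := exists_pow_expansion α (n + 1)
    refine ⟨y + z, ?_⟩
    rw [geomSum_succ]
    push_cast at hz ⊢
    linear_combination hy + hz

/-- The exponent of `a` in the fundamental relation. -/
def relExponent (α : ℤ) (s : ℕ) : ℤ := geomSum α s - s * α ^ s

theorem exists_relExponent_expansion (α : ℤ) (s : ℕ) : ∃ y : ℤ,
    24 * relExponent α s = - (s * (s - 1) * (α - 1)) *
      (12 - 4 * (α - 1) * (1 - 2 * s) - (α - 1) ^ 2 * (s - 2) * (1 - 3 * s)) +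
      24 * (α - 1) ^ 4 * y := by
  obtain ⟨y, hy⟩ := exists_geomSum_expansion α s
  obtain ⟨z, hz⟩ := exists_pow_expansion α s
  refine ⟨y - s * z, ?_⟩
  rw [relExponent]
  linear_combination hy - s * hz

/-- Equal base and exponent merge the factors `s - 1` and `α - 1` into a square, so the leading term
has twice the valuation of `s - 1`. -/
theorem exists_relExponent_self_expansion (s : ℕ) : ∃ y z : ℤ,
    24 * relExponent s s = -12 * s * ((s : ℤ) - 1) ^ 2 +
      ((s : ℤ) - 1) ^ 3 * (4 * y + ((s : ℤ) - 1) * (s * (s - 2) * (1 - 3 * s) + 24 * z)) := by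
  obtain ⟨y, hy⟩ := exists_relExponent_expansion s s
  exact ⟨s * (1 - 2 * s), y, by linear_combination hy⟩

section

variable {p : ℕ} {s m : ℕ}

theorem not_dvd_of_dvd_sub_one (hp : p.Prime) {x : ℤ} (h : (p : ℤ) ∣ x - 1) : ¬ (p : ℤ) ∣ x := by
  intro h2
  have h3 : (p : ℤ) ∣ 1 := by simpa using dvd_sub h2 h
  have := Int.natAbs_dvd_natAbs.2 h3
  simp at this
  exact hp.one_lt.ne' this

theorem pow_dvd_relExponent_of_five_le (hp : p.Prime) (hp5 : 5 ≤ p) (hm : 1 ≤ m)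
    (hs : (p : ℤ) ^ m ∣ s - 1) (hs' : ¬ (p : ℤ) ^ (m + 1) ∣ s - 1) :
    (p : ℤ) ^ (2 * m) ∣ relExponent s s ∧ ¬ (p : ℤ) ^ (2 * m + 1) ∣ relExponent s s := by
  obtain ⟨y, z, h⟩ := exists_relExponent_self_expansion s
  have hpz := Nat.prime_iff_prime_int.1 hp
  have hsp := not_dvd_of_dvd_sub_one hp ((dvd_pow_self _ (by omega)).trans hs)
  obtain ⟨u, hu⟩ := hs
  have hu' : ¬ (p : ℤ) ∣ u := by
    rintro ⟨v, rfl⟩; exact hs' ⟨v, by rw [hu]; ring⟩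
  obtain ⟨n, rfl⟩ : ∃ n, m = n + 1 := ⟨m - 1, by omega⟩
  generalize 4 * y + ((s : ℤ) - 1) * (s * (s - 2) * (1 - 3 * s) + 24 * z) = Z at h
  have h24 : IsCoprime (p : ℤ) 24 := by
    rw [Int.isCoprime_iff_gcd_eq_one]
    have : Nat.Coprime p 24 := by
      rw [hp.coprime_iff_not_dvd]
      intro hd
      have : p ∣ 2 ^ 3 * 3 := hd
      rcases (Nat.Prime.dvd_mul hp).1 this with h1 | h1
      · have := Nat.le_of_dvd (by norm_num) (hp.dvd_of_dvd_pow h1); omega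
      · have := Nat.le_of_dvd (by norm_num) h1; omega
    exact this
  constructor
  · refine (h24.pow_left).dvd_of_dvd_mul_left (?_ : (p : ℤ) ^ (2 * (n + 1)) ∣ 24 * _)
    rw [h, hu]
    exact ⟨-12 * s * u ^ 2 + (p : ℤ) ^ (n + 1) * u ^ 3 * Z, by ring⟩
  · rintro ⟨v, hv⟩
    rw [hv, hu] at h
    have h1 : (p : ℤ) ^ (2 * (n + 1)) * (12 * (s * u ^ 2)) =
        (p : ℤ) ^ (2 * (n + 1)) * (p * (p ^ n * u ^ 3 * Z - 24 * v)) := by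
      linear_combination h
    have h2 := mul_left_cancel₀ (pow_ne_zero _ hpz.ne_zero) h1
    have h3 : (p : ℤ) ∣ 24 * (s * u ^ 2) := ⟨2 * (p ^ n * u ^ 3 * Z - 24 * v), by
      linear_combination 2 * h2⟩
    rcases hpz.dvd_or_dvd (h24.dvd_of_dvd_mul_left h3) with h4 | h4
    · exact hsp h4
    · exact hu' (hpz.dvd_of_dvd_pow h4)

/-- Dividing `12 / 24` costs one factor 2. For `m = 1` the quartic term would compete with the
leading one, were it not that `1 - 3 * s` is even. -/
theorem pow_dvd_relExponent_two (hm : 1 ≤ m)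
    (hs : (2 : ℤ) ^ m ∣ s - 1) (hs' : ¬ (2 : ℤ) ^ (m + 1) ∣ s - 1) :
    (2 : ℤ) ^ (2 * m - 1) ∣ relExponent s s ∧ ¬ (2 : ℤ) ^ (2 * m) ∣ relExponent s s := by
  obtain ⟨y, z, h⟩ := exists_relExponent_self_expansion s
  obtain ⟨n, rfl⟩ : ∃ n, m = n + 1 := ⟨m - 1, by omega⟩
  obtain ⟨u, hu⟩ := hs
  have hu' : ¬ (2 : ℤ) ∣ u := by
    rintro ⟨v, rfl⟩; exact hs' ⟨v, by rw [hu]; ring⟩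
  have hs2 : ∃ r : ℤ, (1 - 3 * (s : ℤ)) = 2 * r :=
    ⟨-1 - 3 * (2 ^ n * u), by linear_combination (-3) * hu⟩
  obtain ⟨r, hr⟩ := hs2
  obtain ⟨t, ht⟩ : ∃ t : ℤ, (s : ℤ) = 2 * t + 1 := ⟨2 ^ n * u, by linear_combination hu⟩
  obtain ⟨v, hv⟩ : ∃ v : ℤ, u = 2 * v + 1 := ⟨u / 2, by omega⟩
  rw [hr, hu] at h
  set W := 2 ^ n * u ^ 3 * y + 2 ^ (2 * n) * u ^ 4 * (s * (s - 2) * r + 12 * z) with hW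
  have h3 : 3 * relExponent s s = 2 ^ (2 * n + 1) * (-3 * s * u ^ 2 + 2 * W) := by
    have : 8 * (3 * relExponent s s) = 8 * (2 ^ (2 * n + 1) * (-3 * s * u ^ 2 + 2 * W)) := by
      rw [hW]
      linear_combination h
    linarith
  have h32 : ∀ i, IsCoprime ((2 : ℤ) ^ i) 3 := fun i => IsCoprime.pow_left (by norm_num)
  rw [show 2 * (n + 1) - 1 = 2 * n + 1 by omega, show 2 * (n + 1) = 2 * n + 1 + 1 by ring]
  constructor
  · exact (h32 _).dvd_of_dvd_mul_left (h3 ▸ dvd_mul_right _ _)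
  · rintro ⟨x, hx⟩
    rw [hx, pow_succ, mul_assoc, mul_left_comm] at h3
    have h4 := mul_left_cancel₀ (by positivity) h3
    rw [ht, hv] at h4
    generalize (2 * t + 1) * (2 * v + 1) ^ 2 = q at *
    have h5 : (-3 * (2 * t + 1) * (2 * v + 1) ^ 2 + 2 * W) =
        2 * (-3 * (2 * v + 1) ^ 2 * t - 6 * v ^ 2 - 6 * v - 2 + W) + 1 := by ring
    rw [h5] at h4
    omega

/-- When `α - 1` has 3-adic valuation 1, the higher terms compete with the leading one, so the
quotient by 9 is needed exactly modulo 9. Of the denominator 24, the 3 cancels and 8 is `-1` modulo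
9. -/
theorem exists_relExponent_eq_nine_mul {α : ℤ} {s : ℕ} {u v : ℤ} (hα : α = 1 + 3 * u)
    (hs : (s : ℤ) = 1 + 3 * v) : ∃ x : ℤ, relExponent α s = 9 * x ∧
      (x : ZMod 9) = (1 + 3 * v) * v * u *
        (4 + 4 * u * (1 + 6 * v) + 3 * u ^ 2 * (3 * v - 1) * (2 + 9 * v)) := by
  obtain ⟨y, hy⟩ := exists_relExponent_expansion α s
  rw [hα, hs] at hy
  have h1 : 8 * relExponent α s = 9 * (-(1 + 3 * v) * v * u *
      (4 + 4 * u * (1 + 6 * v) + 3 * u ^ 2 * (3 * v - 1) * (2 + 9 * v)) + 9 * (8 * u ^ 4 * y)) := by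
    have h2 : 3 * (8 * relExponent α s) = 3 * (9 * (-(1 + 3 * v) * v * u * (4 + 4 * u * (1 + 6 * v)
      + 3 * u ^ 2 * (3 * v - 1) * (2 + 9 * v)) + 9 * (8 * u ^ 4 * y))) := by
      rw [hα]
      linear_combination hy
    linarith
  have h3 : (9 : ℤ) ∣ relExponent α s :=
    IsCoprime.dvd_of_dvd_mul_left (by norm_num : IsCoprime (9 : ℤ) 8) (h1 ▸ dvd_mul_right _ _)
  obtain ⟨x, hx⟩ := h3
  refine ⟨x, hx, ?_⟩
  rw [hx, mul_left_comm] at h1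
  have h4 := congrArg (Int.cast : ℤ → ZMod 9) (mul_left_cancel₀ (by norm_num) h1)
  push_cast at h4
  rw [show (8 : ZMod 9) = -1 by decide, show (9 : ZMod 9) = 0 by decide] at h4
  rw [show (9 : ZMod 9) = 0 by decide]
  linear_combination -h4

theorem three_dvd_iff_zmod_nine {x : ℤ} : 3 ∣ x ↔ 3 * (x : ZMod 9) = 0 := by
  rw [show (3 : ZMod 9) * x = ((3 * x : ℤ) : ZMod 9) by push_cast; rfl,
    ZMod.intCast_zmod_eq_zero_iff_dvd]
  omega

theorem pow_dvd_relExponent_three (hm : 1 ≤ m)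
    (hs : (3 : ℤ) ^ m ∣ s - 1) (hs' : ¬ (3 : ℤ) ^ (m + 1) ∣ s - 1)
    (h7 : ¬ (s : ℤ) ≡ 7 [ZMOD 9]) :
    (3 : ℤ) ^ (2 * m) ∣ relExponent s s ∧ ¬ (3 : ℤ) ^ (2 * m + 1) ∣ relExponent s s := by
  obtain ⟨u, hu⟩ := hs
  have hu' : ¬ (3 : ℤ) ∣ u := by
    rintro ⟨v, rfl⟩; exact hs' ⟨v, by rw [hu]; ring⟩
  obtain rfl | hm2 : m = 1 ∨ 2 ≤ m := by omega
  · obtain ⟨x, hx, hx'⟩ := exists_relExponent_eq_nine_mul (α := s) (s := s) (u := u) (v := u)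
      (by linarith) (by linarith)
    -- Excluding the residue 7 modulo 9 excludes `u` congruent to 2 modulo 3, the one nonzero class
    -- where the quotient `x` is divisible by 3.
    obtain ⟨v, hv⟩ : ∃ v, u = 3 * v + 1 := by
      refine ⟨u / 3, ?_⟩
      rw [Int.ModEq] at h7
      omega
    have h3 : ¬ 3 ∣ x := by
      rw [three_dvd_iff_zmod_nine, hx', hv]
      push_cast
      generalize (v : ZMod 9) = r
      revert r
      decide
    omega
  · obtain ⟨n, rfl⟩ : ∃ n, m = n + 2 := ⟨m - 2, by omega⟩
    obtain ⟨y, hy⟩ := exists_relExponent_expansion s s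
    rw [hu] at hy
    set Q := ((s : ℤ) - 2) * (1 - 3 * s) with hQ
    set W := s * 4 * 3 ^ n * u ^ 3 * (1 - 2 * s) + 3 ^ (2 * n + 2) * (s * u ^ 4 * Q) +
      8 * 3 ^ (2 * n + 3) * u ^ 4 * y
    have h2 : 8 * relExponent s s = 3 ^ (2 * (n + 2)) * (-4 * s * u ^ 2 + 3 * W) := by
      have : 3 * (8 * relExponent s s) = 3 * (3 ^ (2 * (n + 2)) * (-4 * s * u ^ 2 + 3 * W)) := by
        linear_combination hy
      linarith
    have h32 : ∀ i, IsCoprime ((3 : ℤ) ^ i) 8 := fun i => IsCoprime.pow_left (by norm_num)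
    constructor
    · exact (h32 _).dvd_of_dvd_mul_left (h2 ▸ dvd_mul_right _ _)
    · rintro ⟨x, hx⟩
      rw [hx, pow_succ, mul_assoc, mul_left_comm] at h2
      have h4 := mul_left_cancel₀ (by positivity) h2
      have h5 : (3 : ℤ) ∣ s * u ^ 2 := ⟨W - 8 * x - s * u ^ 2, by linear_combination h4⟩
      rcases Int.prime_three.dvd_or_dvd h5 with h6 | h6
      · have h7 : (3 : ℤ) ∣ s - 1 := hu ▸ (dvd_pow_self _ (by omega)).mul_right u
        omega
      · exact hu' (Int.prime_three.dvd_of_dvd_pow h6)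

theorem dvd_relExponent_of_modEq_seven (h7 : (s : ℤ) ≡ 7 [ZMOD 9]) :
    (3 : ℤ) ^ 3 ∣ relExponent s s := by
  obtain ⟨v, hv⟩ : ∃ v : ℤ, (s : ℤ) = 1 + 3 * (3 * v + 2) := by
    rw [Int.ModEq] at h7
    exact ⟨s / 9, by omega⟩
  obtain ⟨x, hx, hx'⟩ := exists_relExponent_eq_nine_mul hv hv
  have h3 : 3 ∣ x := by
    rw [three_dvd_iff_zmod_nine, hx']
    push_cast
    generalize (v : ZMod 9) = r
    revert r
    decide
  omega

/-- The residues 7 and 16 modulo 27 are those with `v` congruent to 2 or 5 modulo 9; for the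
remaining 25 the quotient `x` does vanish modulo 9. -/
theorem not_dvd_relExponent_self (h7 : (s : ℤ) ≡ 7 [ZMOD 9]) (h25 : ¬ (s : ℤ) ≡ 25 [ZMOD 27]) :
    ¬ (3 : ℤ) ^ 4 ∣ relExponent s s := by
  obtain ⟨v, hv⟩ : ∃ v : ℤ, (s : ℤ) = 1 + 3 * v := by
    rw [Int.ModEq] at h7
    exact ⟨s / 3, by omega⟩
  obtain ⟨x, hx, hx'⟩ := exists_relExponent_eq_nine_mul hv hv
  obtain ⟨r, hr⟩ : ∃ r, v = 9 * r + 2 ∨ v = 9 * r + 5 := by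
    rw [Int.ModEq] at h7 h25
    exact ⟨v / 9, by omega⟩
  have h9 : ¬ 9 ∣ x := by
    rw [← Nat.cast_ofNat, ← ZMod.intCast_zmod_eq_zero_iff_dvd, hx']
    rcases hr with rfl | rfl <;> push_cast <;> rw [show (9 : ZMod 9) = 0 by decide] <;>
      simp only [zero_mul, zero_add] <;> decide
  omega

/-- For the residue 25, using `α ^ 2` in place of `α` as exponent brings the valuation back down to
3. -/
theorem dvd_relExponent_sq {α : ℤ} (h25 : α ≡ 25 [ZMOD 27]) (hs : (s : ℤ) ≡ α ^ 2 [ZMOD 27]) :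
    (3 : ℤ) ^ 3 ∣ relExponent α s ∧ ¬ (3 : ℤ) ^ 4 ∣ relExponent α s := by
  have h4 : (s : ℤ) ≡ 4 [ZMOD 27] := hs.trans ((h25.pow 2).trans (by decide))
  obtain ⟨u, hu⟩ : ∃ u : ℤ, α = 1 + 3 * (9 * u + 8) := by
    rw [Int.ModEq] at h25
    exact ⟨α / 27, by omega⟩
  obtain ⟨v, hv⟩ : ∃ v : ℤ, (s : ℤ) = 1 + 3 * (9 * v + 1) := by
    rw [Int.ModEq] at h4
    exact ⟨s / 27, by omega⟩
  obtain ⟨x, hx, hx'⟩ := exists_relExponent_eq_nine_mul hu hv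
  push_cast at hx'
  rw [show (9 : ZMod 9) = 0 by decide] at hx'
  simp only [zero_mul, zero_add] at hx'
  have h3 : 3 ∣ x := by
    rw [three_dvd_iff_zmod_nine, hx']
    decide
  have h9 : ¬ 9 ∣ x := by
    rw [← Nat.cast_ofNat, ← ZMod.intCast_zmod_eq_zero_iff_dvd, hx']
    decide
  omega

end

/-! ### Exact valuations and powers of elements of prime power order. -/

theorem Int.ModEq.dvd_iff_dvd {n d x y : ℤ} (h : x ≡ y [ZMOD n]) (hd : d ∣ n) :
    d ∣ x ↔ d ∣ y := by
  rw [← Int.modEq_zero_iff_dvd, ← Int.modEq_zero_iff_dvd]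
  exact ⟨fun hx => (h.of_dvd hd).symm.trans hx, fun hy => (h.of_dvd hd).trans hy⟩

/-- `p ^ i` exactly divides `z`. -/
def IsVal (p i : ℕ) (z : ℤ) : Prop := (p : ℤ) ^ i ∣ z ∧ ¬ (p : ℤ) ^ (i + 1) ∣ z

namespace IsVal

variable {p i j : ℕ} {x y : ℤ}

theorem mul (hp : p.Prime) (hx : IsVal p i x) (hy : IsVal p j y) : IsVal p (i + j) (x * y) := by
  refine ⟨?_, fun h => ?_⟩
  · rw [pow_add]; exact mul_dvd_mul hx.1 hy.1
  · rcases succ_dvd_or_succ_dvd_of_succ_sum_dvd_mul (Nat.prime_iff_prime_int.1 hp) hx.1 hy.1 h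
      with h | h
    · exact hx.2 h
    · exact hy.2 h

theorem neg (hx : IsVal p i x) : IsVal p i (-x) := by
  simpa [IsVal] using hx

theorem one_sub (hx : IsVal p i (x - 1)) : IsVal p i (1 - x) := by
  simpa using hx.neg

theorem dvd (hx : IsVal p i x) (h : j ≤ i) : (p : ℤ) ^ j ∣ x := (pow_dvd_pow _ h).trans hx.1

theorem exists_of_ne_zero (hp : p.Prime) (hx : x ≠ 0) : ∃ i, IsVal p i x := by
  have hf : FiniteMultiplicity (p : ℤ) x := by
    rw [Int.finiteMultiplicity_iff]
    exact ⟨by simpa using hp.ne_one, hx⟩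
  exact ⟨_, pow_multiplicity_dvd _ _, hf.not_pow_dvd_of_multiplicity_lt (Nat.lt_succ_self _)⟩

theorem congr (hx : IsVal p i x) {k : ℕ} (hk : i < k) (h : y ≡ x [ZMOD (p : ℤ) ^ k]) :
    IsVal p i y := by
  have h1 : ∀ n ≤ k, (p : ℤ) ^ n ∣ y ↔ (p : ℤ) ^ n ∣ x := fun n hn =>
    h.dvd_iff_dvd (pow_dvd_pow _ hn)
  exact ⟨(h1 i hk.le).2 hx.1, fun h2 => hx.2 ((h1 _ hk).1 h2)⟩

theorem self_natCast (hp : p.Prime) : IsVal p 1 (p : ℤ) := by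
  refine ⟨by simp, fun h => ?_⟩
  have h1 : p ^ 2 ∣ p := by exact_mod_cast h
  have := Nat.le_of_dvd hp.pos h1
  nlinarith [hp.two_le]

/-- Lifting the exponent: `geomSum x n` differs from `n` by a multiple of `p ^ (j + 1)`, so the sum
of powers has the valuation of `n`. For `p = 2` the lost factor 2 is recovered from `2 ≤ i`. -/
theorem pow_sub_one (hp : p.Prime) (hx : IsVal p i (x - 1)) (hi : 1 ≤ i) (hpi : p ≠ 2 ∨ 2 ≤ i)
    {n : ℕ} (hn : IsVal p j n) : IsVal p (i + j) (x ^ n - 1) := by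
  rw [← mul_geom_sum]
  have hnd : p ^ j ∣ n := by exact_mod_cast hn.1
  have hp1 : (p : ℤ) ∣ x - 1 := (dvd_pow_self _ (by omega)).trans hx.1
  refine hx.mul hp ⟨pow_dvd_sum_pow j hp1 hnd, fun h => hn.2 ?_⟩
  have h1 : (p : ℤ) ^ (j + 1) ∣ geomSum x n - n := by
    rcases eq_or_ne p 2 with rfl | h2
    · have := pow_dvd_two_mul_geomSum_sub j hi hx.1 hnd
      obtain ⟨l, rfl⟩ : ∃ l, i = l + 2 := ⟨i - 2, by omega⟩
      rw [show l + 2 + j = (l + j + 1) + 1 by ring, pow_succ', Nat.cast_ofNat] at this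
      exact (pow_dvd_pow _ (by omega)).trans (Int.dvd_of_mul_dvd_mul_left (by norm_num) this)
    · exact (pow_dvd_pow _ (by omega)).trans (pow_dvd_geomSum_sub hp h2 hi hx.1 hnd)
  have h2 : (p : ℤ) ^ (j + 1) ∣ geomSum x n := by
    rw [geomSum_eq_mul_sum]; exact h.mul_left _
  simpa using dvd_sub h2 h1

end IsVal

section

variable {H : Type*} [Group H] {x y : H} {p k n : ℕ} {z w : ℤ}

/-- Bézout for `z` and `p ^ k`: their gcd is `p ^ j` with `j ≤ n`, so `x ^ p ^ n` is already a power
of `x ^ z`. -/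
theorem zpow_mem_zpowers_of_dvd (hp : p.Prime) (hx : x ^ p ^ k = 1)
    (hz : ¬ (p : ℤ) ^ (n + 1) ∣ z) (hw : (p : ℤ) ^ n ∣ w) : x ^ w ∈ Subgroup.zpowers (x ^ z) := by
  have h1 : ∃ u : ℤ, x ^ (z * u) = x ^ (p ^ n : ℤ) := by
    obtain ⟨j, hj, hj'⟩ := (Nat.dvd_prime_pow hp).1 (show Int.gcd z ((p : ℤ) ^ k) ∣ p ^ k by
        exact_mod_cast Int.gcd_dvd_right z ((p : ℤ) ^ k))
    have hjn : j ≤ n := by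
      by_contra hlt
      apply hz
      have h2 : (Int.gcd z ((p : ℤ) ^ k) : ℤ) ∣ z := Int.gcd_dvd_left ..
      rw [hj'] at h2
      push_cast at h2
      exact (pow_dvd_pow _ (by omega)).trans h2
    have h3 := Int.gcd_eq_gcd_ab z ((p : ℤ) ^ k)
    rw [hj'] at h3
    refine ⟨Int.gcdA z ((p : ℤ) ^ k) * p ^ (n - j), ?_⟩
    have h4 : z * (Int.gcdA z ((p : ℤ) ^ k) * p ^ (n - j)) = (p : ℤ) ^ n -
        (p : ℤ) ^ k * (Int.gcdB z ((p : ℤ) ^ k) * p ^ (n - j)) := by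
      have h5 : (p : ℤ) ^ n = (p : ℤ) ^ j * p ^ (n - j) := by rw [← pow_add]; congr 1; omega
      push_cast at h3
      rw [h5, h3]; ring
    have h6 : x ^ ((p : ℤ) ^ k) = 1 := by rw [← Nat.cast_pow, zpow_natCast, hx]
    rw [h4, zpow_sub, zpow_mul x ((p : ℤ) ^ k), h6]
    simp
  obtain ⟨u, hu⟩ := h1
  obtain ⟨v, rfl⟩ := hw
  exact ⟨u * v, by simp only; rw [zpow_mul, ← zpow_mul x, hu, ← zpow_mul]⟩

theorem zpow_eq_one_of_val (hp : p.Prime) (hx : x ^ p ^ k = 1) (hz : IsVal p n z)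
    (hxz : x ^ z = 1) (hw : (p : ℤ) ^ n ∣ w) : x ^ w = 1 := by
  have := zpow_mem_zpowers_of_dvd hp hx hz.2 hw
  rwa [hxz, Subgroup.zpowers_one_eq_bot, Subgroup.mem_bot] at this

theorem pow_eq_one_of_val (hp : p.Prime) (hx : x ^ p ^ k = 1) (hz : IsVal p n z)
    (hxz : x ^ z = 1) : x ^ p ^ n = 1 := by
  have := zpow_eq_one_of_val hp hx hz hxz dvd_rfl
  rwa [← Nat.cast_pow, zpow_natCast] at this

theorem commute_zpow_of_val (hp : p.Prime) (hx : x ^ p ^ k = 1) (hz : IsVal p n z)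
    (hxz : Commute (x ^ z) y) (hw : (p : ℤ) ^ n ∣ w) : Commute (x ^ w) y := by
  obtain ⟨u, hu⟩ := zpow_mem_zpowers_of_dvd hp hx hz.2 hw
  simp only at hu
  rw [← hu]
  exact hxz.zpow_left u

end

/-! ### The relation `c ^ x * a ^ F = b ^ G` and the order bounds it forces. -/

namespace IsMacdonaldPair

variable {H : Type*} [Group H] {α β : ℤ} {a b : H} {p k : ℕ}

theorem comm_pow_prime_pow_eq_one (h : IsMacdonaldPair α β a b) (hα : (p : ℤ) ∣ α - 1)
    (ha : a ^ p ^ k = 1) : rcomm a b ^ p ^ k = 1 := by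
  have h1 := h.pow_mul_right (p ^ k)
  rwa [ha, one_mul, left_eq_mul,
    zpow_eq_one_of_natCast_pow_dvd ha (pow_dvd_geomSum hα dvd_rfl), mul_one] at h1

/-- In a `p`-primary quotient, the fundamental relation takes the form `c ^ x * a ^ F = b ^ G`. -/
theorem exists_rel (h : IsMacdonaldPair α β a b) (hp : p.Prime) (hα : (p : ℤ) ∣ α - 1)
    (ha : a ^ p ^ k = 1) (hb : b ^ p ^ k = 1) {κ s t : ℕ} (hs : a ^ (α ^ κ) = a ^ s)
    (ht : b ^ (β ^ κ) = b ^ t) : ∃ x F G : ℕ, rcomm a b ^ x * a ^ F = b ^ G ∧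
      (x : ℤ) ≡ s - t [ZMOD (p : ℤ) ^ k] ∧
      (∀ i ≤ k, (p : ℤ) ^ i ∣ F ↔ (p : ℤ) ^ i ∣ relExponent α s) ∧
      (∀ i ≤ k, (p : ℤ) ^ i ∣ G ↔ (p : ℤ) ^ i ∣ relExponent β t) := by
  have hr := h.fundamental hs ht
  have hpz := Nat.prime_iff_prime_int.1 hp
  have hc := h.comm_pow_prime_pow_eq_one hα ha
  set c := rcomm a b with hcdef
  have hpos : (0 : ℤ) < (p : ℤ) ^ k := by have := hp.pos; positivity
  -- A natural exponent with `c ^ n = (c ^ (t + κ))⁻¹`, so that all powers of `c` can be collected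
  -- on one side.
  set n := p ^ k * (t + κ) - (t + κ) with hn
  have hle : t + κ ≤ p ^ k * (t + κ) := Nat.le_mul_of_pos_left _ (Nat.pow_pos hp.pos)
  have hcn : c ^ n * c ^ (t + κ) = 1 := by
    rw [← pow_add, hn, Nat.sub_add_cancel hle, pow_mul, hc, one_pow]
  have hred : ∀ {y : H} (_ : y ^ p ^ k = 1) (z : ℤ),
      y ^ (z % (p : ℤ) ^ k).toNat = y ^ z := by
    intro y hy z
    rw [← zpow_natCast, Int.toNat_of_nonneg (Int.emod_nonneg _ hpos.ne')]
    conv_rhs => rw [← Int.emod_add_mul_ediv z ((p : ℤ) ^ k), zpow_add, zpow_mul]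
    rw [← Nat.cast_pow, zpow_natCast y (p ^ k), hy]
    simp
  have hdvd : ∀ (z : ℤ), ∀ i ≤ k, (p : ℤ) ^ i ∣ ((z % (p : ℤ) ^ k).toNat : ℤ) ↔ (p : ℤ) ^ i ∣ z := by
    intro z i hi
    rw [Int.toNat_of_nonneg (Int.emod_nonneg _ hpos.ne')]
    exact Int.ModEq.dvd_iff_dvd (Int.mod_modEq z ((p : ℤ) ^ k)) (pow_dvd_pow _ hi)
  refine ⟨κ + s + n, (relExponent α s * α ^ n % (p : ℤ) ^ k).toNat,
    (-relExponent β t % (p : ℤ) ^ k).toNat, ?_, ?_, ?_, ?_⟩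
  · rw [hred ha, hred hb, relExponent, relExponent, neg_sub]
    have h1 : b ^ (t * β ^ t - geomSum β t) =
        c ^ (κ + s) * a ^ (geomSum α s - s * α ^ s) * c ^ n := by
      have h2 : c ^ n = (c ^ (t + κ))⁻¹ := eq_inv_of_mul_eq_one_left hcn
      rw [pow_add, mul_assoc (c ^ κ), hr, h2]; group
    rw [h1, mul_assoc, h.zpow_mul_comm_pow, ← mul_assoc, ← pow_add]
  · have h1 : (n : ℤ) = (p : ℤ) ^ k * (t + κ) - (t + κ) := by
      rw [hn, Nat.cast_sub hle]; push_cast; ring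
    push_cast
    rw [h1]
    exact (Int.modEq_iff_dvd.2 ⟨-(t + κ), by ring⟩)
  · intro i hi
    rw [hdvd _ i hi]
    -- Moving the power of `a` past `c ^ n` multiplies its exponent by `α ^ n`, which is prime to
    -- `p`.
    have hαp : ¬ (p : ℤ) ∣ α := not_dvd_of_dvd_sub_one hp hα
    have hco : IsCoprime ((p : ℤ) ^ i) (α ^ n) :=
      IsCoprime.pow ((Prime.coprime_iff_not_dvd hpz).2 hαp)
    exact ⟨fun h => hco.dvd_of_dvd_mul_right h, fun h => h.mul_right _⟩
  · intro i hi
    rw [hdvd _ i hi, dvd_neg]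

variable {x F G : ℕ}

theorem symm_rel (hr : rcomm a b ^ x * a ^ F = b ^ G) : rcomm b a ^ x * b ^ G = a ^ F := by
  rw [← hr, ← rcomm_inv a b]; group

theorem zpow_eq_zpow_of_rel' (h : IsMacdonaldPair α β a b)
    (hr : rcomm a b ^ x * a ^ F = b ^ G) : a ^ ((α - 1) * F) = b ^ ((1 - β) * G) :=
  h.zpow_eq_zpow_of_rel (k := 0) (t := 0) (s := x) (by simpa using hr)

theorem commute_left_of_rel (h : IsMacdonaldPair α β a b)
    (hr : rcomm a b ^ x * a ^ F = b ^ G) : Commute (a ^ ((α - 1) * F)) b := by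
  rw [h.zpow_eq_zpow_of_rel' hr]; exact (Commute.refl b).zpow_left _

theorem zpow_sq_eq_one_of_rel (h : IsMacdonaldPair α β a b)
    (hr : rcomm a b ^ x * a ^ F = b ^ G) : a ^ ((α - 1) * ((α - 1) * F)) = 1 :=
  h.zpow_eq_one_of_rel (k := 0) (t := 0) (s := x) (f := F) (g := G) (by simpa using hr)

/-- The conjugate of the relation `c ^ x * a ^ F = b ^ G` by `a`. -/
theorem conj_rel (h : IsMacdonaldPair α β a b) (hr : rcomm a b ^ x * a ^ F = b ^ G) :
    rcomm a b ^ G * a ^ (1 - α ^ x) = b ^ (geomSum β G - G * β ^ G) := by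
  have h1 := h.pow_mul_left G
  have h2 := h.zpow_mul_comm_pow (-1) x
  have h3 := h.comm_pow_mul_zpow G G
  set c := rcomm a b with hc
  rw [zpow_natCast] at h3
  have h4 : c ^ G * (b ^ G * a ^ (1 - α ^ x)) = b ^ geomSum β G := by
    have h5 : b ^ G * a ^ (1 - α ^ x) = a ⁻¹ * b ^ G * a := by
      rw [← hr, ← mul_assoc a⁻¹, ← zpow_neg_one a, h2, mul_assoc, mul_assoc, mul_assoc,
        ← zpow_natCast a F, ← zpow_add_one a, ← zpow_add a, ← zpow_add a]
      congr 2; ring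
    rw [h5, mul_assoc, h1]; group
  rw [← mul_assoc, h3, mul_assoc] at h4
  rw [sub_eq_neg_add (geomSum β G), zpow_add, ← h4, zpow_neg, inv_mul_cancel_left]

theorem dvd_geomSum_sub_mul {l i : ℕ} (hp : p.Prime) (hp2 : p ≠ 2) (hl : 1 ≤ l)
    (hβ : (p : ℤ) ^ l ∣ β - 1) (hG : p ^ i ∣ G) :
    (p : ℤ) ^ (l + i) ∣ geomSum β G - G * β ^ G := by
  have h1 := pow_dvd_geomSum_sub hp hp2 hl hβ hG
  have h2 := (pow_dvd_pow_sub_one hl hβ hG).mul_left (G : ℤ)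
  have : geomSum β G - G * β ^ G = (geomSum β G - G) - G * (β ^ G - 1) := by ring
  rw [this]
  exact dvd_sub h1 h2

theorem dvd_two_mul_geomSum_sub_mul {l i : ℕ} (hl : 1 ≤ l)
    (hβ : (p : ℤ) ^ l ∣ β - 1) (hG : p ^ i ∣ G) :
    (p : ℤ) ^ (l + i) ∣ 2 * (geomSum β G - G * β ^ G) := by
  have h1 := pow_dvd_two_mul_geomSum_sub i hl hβ hG
  have h2 := (pow_dvd_pow_sub_one hl hβ hG).mul_left (2 * G : ℤ)
  have : 2 * (geomSum β G - G * β ^ G) = 2 * (geomSum β G - G) - 2 * G * (β ^ G - 1) := by ring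
  rw [this]
  exact dvd_sub h1 h2

theorem commute_right_of_rel_odd (h : IsMacdonaldPair α β a b) (hp : p.Prime) (hp2 : p ≠ 2)
    (hb : b ^ p ^ k = 1) (hr : rcomm a b ^ x * a ^ F = b ^ G) {ν γ : ℕ} (hν : 1 ≤ ν)
    (hβ : IsVal p ν (β - 1)) (hG : IsVal p γ G) :
    Commute (b ^ (geomSum β G - G * β ^ G)) a := by
  have h2 : Commute (b ^ ((1 - β) * G)) a := by
    rw [← h.zpow_eq_zpow_of_rel' hr]; exact (Commute.refl a).zpow_left _
  exact commute_zpow_of_val hp hb (hβ.one_sub.mul hp hG) h2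
    (dvd_geomSum_sub_mul hp hp2 hν hβ.1 (by exact_mod_cast hG.1))

/-- For odd `p`, the relation forces `a ^ (p ^ (μ + γ)) = 1`. -/
theorem left_pow_eq_one_of_rel_odd (h : IsMacdonaldPair α β a b) (hp : p.Prime) (hp2 : p ≠ 2)
    (ha : a ^ p ^ k = 1) (hb : b ^ p ^ k = 1) (hr : rcomm a b ^ x * a ^ F = b ^ G) {μ ν γ : ℕ}
    (hμ : 1 ≤ μ) (hα : IsVal p μ (α - 1)) (hν : 1 ≤ ν)
    (hβ : IsVal p ν (β - 1)) (hG : IsVal p γ G) : a ^ p ^ (μ + γ) = 1 := by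
  have h1 := h.commute_right_of_rel_odd hp hp2 hb hr hν hβ hG
  -- The conjugated relation turns this power of `b` into `c ^ G` times a power of `a`, so `c ^ G`
  -- commutes with `a`.
  rw [← h.conj_rel hr] at h1
  have h2 : Commute (rcomm a b ^ G) a := by
    have := h1.mul_left ((Commute.refl a).zpow_left (-(1 - α ^ x)))
    rwa [mul_assoc, ← zpow_add, add_neg_cancel, zpow_zero, mul_one] at this
  have h3 := h.zpow_mul_comm_pow 1 G
  rw [zpow_one, one_mul, ← h2.eq, mul_right_inj] at h3
  have h4 : a ^ (α ^ G - 1) = 1 := by rw [zpow_sub_one, ← h3, mul_inv_cancel]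
  exact pow_eq_one_of_val hp ha (hα.pow_sub_one hp hμ (.inl hp2) hG) h4

/-- For `p = 2`, the relation forces `c ^ (2 * G)` to commute with `a`, in terms of exponents. -/
theorem left_zpow_eq_one_of_rel_two (h : IsMacdonaldPair α β a b)
    (hb : b ^ 2 ^ k = 1) (hr : rcomm a b ^ x * a ^ F = b ^ G) {ν γ : ℕ}
    (hν : 1 ≤ ν) (hβ : IsVal 2 ν (β - 1)) (hγ : 1 ≤ γ) (hG : IsVal 2 γ G) :
    a ^ (α ^ (2 * G) - 1) = 1 := by
  have hp := Nat.prime_two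
  have hGd : 2 ^ γ ∣ G := by exact_mod_cast hG.1
  set e := geomSum β G - G * β ^ G with he
  have h2e : (2 : ℤ) ^ (ν + γ) ∣ 2 * e := dvd_two_mul_geomSum_sub_mul hν hβ.1 hGd
  have h1 : Commute (b ^ (2 * e)) a := by
    have h2 : Commute (b ^ ((1 - β) * G)) a := by
      rw [← h.zpow_eq_zpow_of_rel' hr]; exact (Commute.refl a).zpow_left _
    exact commute_zpow_of_val hp hb (hβ.one_sub.mul hp hG) h2 h2e
  have hconj := h.conj_rel hr
  have hsq := h.symm.zpow_sq_eq_one_of_rel (symm_rel hr)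
  -- Only `2 * e` is known to have valuation `ν + γ`, so the conjugated relation must be squared,
  -- which needs commuting factors. The exponent `e * (β ^ G - 1)` has valuation at least `2 * ν + 2
  -- * γ - 1`, and `1 ≤ γ` makes this enough.
  have hcb : Commute (rcomm a b ^ G) (b ^ e) := by
    have h3 := h.comm_pow_mul_zpow e G
    have h4 : b ^ (e * (β ^ G - 1)) = 1 := by
      refine zpow_eq_one_of_val hp hb (hβ.mul hp (hβ.mul hp hG)) hsq ?_
      obtain ⟨n, hn⟩ : ∃ n, ν + γ = n + 1 := ⟨ν + γ - 1, by omega⟩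
      rw [hn, pow_succ'] at h2e
      have h5 := mul_dvd_mul (Int.dvd_of_mul_dvd_mul_left (by norm_num) h2e)
        (pow_dvd_pow_sub_one hν hβ.1 hGd)
      refine Dvd.dvd.trans ?_ h5
      rw [Nat.cast_ofNat, ← pow_add]
      exact pow_dvd_pow _ (by omega)
    rw [mul_sub_one, zpow_sub, mul_inv_eq_one] at h4
    rwa [h4] at h3
  have hub : Commute (a ^ (1 - α ^ x)) (b ^ e) := by
    rw [show a ^ (1 - α ^ x) = (rcomm a b ^ G)⁻¹ * b ^ e by rw [← hconj]; group]
    exact hcb.inv_left.mul_left (Commute.refl _)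
  have h6 : rcomm a b ^ (2 * G) = b ^ (2 * e) * ((a ^ (1 - α ^ x))⁻¹) ^ 2 := by
    rw [mul_comm 2 G, pow_mul, mul_comm 2 e, zpow_mul, show rcomm a b ^ G =
      b ^ e * (a ^ (1 - α ^ x))⁻¹ by rw [← hconj, mul_inv_cancel_right],
      hub.inv_left.symm.mul_pow]
    norm_cast
  have h7 : Commute (rcomm a b ^ (2 * G)) a := by
    rw [h6]
    exact h1.mul_left ((((Commute.refl a).zpow_left _).inv_left).pow_left 2)
  have h8 := h.zpow_mul_comm_pow 1 (2 * G)
  rw [zpow_one, one_mul, ← h7.eq, mul_right_inj] at h8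
  rw [zpow_sub_one, ← h8, mul_inv_cancel]

end IsMacdonaldPair

/-! ### Class at most six for odd primes. -/

namespace IsMacdonaldPair

/-- Natural representatives of `α` and `β` make base and exponent coincide in `relExponent`. They
are taken modulo `p ^ (k + n)`, so that divisibility by powers up to `p ^ n` survives the reduction
of exponents. -/
theorem exists_rel_val {H : Type*} [Group H] {α β : ℤ} {a b : H} (h : IsMacdonaldPair α β a b)
    {p k : ℕ} (hp : p.Prime) (hα : (p : ℤ) ∣ α - 1)
    (ha : a ^ p ^ k = 1) (hb : b ^ p ^ k = 1) {n : ℕ} (hn : 1 ≤ n) : ∃ x F G s t : ℕ,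
      rcomm a b ^ x * a ^ F = b ^ G ∧ (x : ℤ) ≡ α - β [ZMOD (p : ℤ) ^ n] ∧
      (s : ℤ) ≡ α [ZMOD (p : ℤ) ^ n] ∧ (t : ℤ) ≡ β [ZMOD (p : ℤ) ^ n] ∧
      (∀ i ≤ n, (p : ℤ) ^ i ∣ F ↔ (p : ℤ) ^ i ∣ relExponent s s) ∧
      (∀ i ≤ n, (p : ℤ) ^ i ∣ G ↔ (p : ℤ) ^ i ∣ relExponent t t) := by
  have hK := pow_pow_eq_one_of_le ha (Nat.le_add_right k n)
  have hK' := pow_pow_eq_one_of_le hb (Nat.le_add_right k n)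
  have hpos : (0 : ℤ) < (p : ℤ) ^ (k + n) := by have := hp.pos; positivity
  have hnat : ∀ z : ℤ, ∃ s : ℕ, (s : ℤ) ≡ z [ZMOD (p : ℤ) ^ (k + n)] := fun z =>
    ⟨(z % (p : ℤ) ^ (k + n)).toNat, by
      rw [Int.toNat_of_nonneg (Int.emod_nonneg _ hpos.ne')]; exact Int.mod_modEq _ _⟩
  obtain ⟨s, hs⟩ := hnat α
  obtain ⟨t, ht⟩ := hnat β
  have hz : ∀ {y : H} {z w : ℤ}, y ^ p ^ (k + n) = 1 → w ≡ z [ZMOD (p : ℤ) ^ (k + n)] →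
      y ^ z = y ^ w := fun {y z w} hy hzw => by
    have := zpow_eq_one_of_natCast_pow_dvd hy hzw.dvd
    rwa [zpow_sub, mul_inv_eq_one] at this
  have h1 : a ^ (s : ℤ) = a ^ α := (hz hK hs).symm
  have h2 : b ^ (t : ℤ) = b ^ β := (hz hK' ht).symm
  have h' := (h.congr_left h1.symm).congr_right h2.symm
  have hsp : (p : ℤ) ∣ s - 1 := by
    have := dvd_sub hα (hs.of_dvd (dvd_pow_self (p : ℤ) (by omega : k + n ≠ 0))).dvd
    simpa using this
  obtain ⟨x, F, G, hr, hx, hF, hG⟩ := h'.exists_rel hp hsp hK hK' (κ := 1) (s := s) (t := t)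
    (by simp) (by simp)
  have hd : (p : ℤ) ^ n ∣ (p : ℤ) ^ (k + n) := pow_dvd_pow _ (Nat.le_add_left _ _)
  exact ⟨x, F, G, s, t, hr, (hx.trans (hs.sub ht)).of_dvd hd, hs.of_dvd hd, ht.of_dvd hd,
    fun i hi => hF i (by omega), fun i hi => hG i (by omega)⟩

variable {H : Type*} [Group H] {α β : ℤ} {a b : H} {p k : ℕ}

theorem exists_rel_isVal (h : IsMacdonaldPair α β a b) (hp : p.Prime) (hα : (p : ℤ) ∣ α - 1)
    (ha : a ^ p ^ k = 1) (hb : b ^ p ^ k = 1) {n φ γ : ℕ} (hn : 1 ≤ n)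
    (hφ : ∀ s : ℕ, (s : ℤ) ≡ α [ZMOD (p : ℤ) ^ n] → IsVal p φ (relExponent s s))
    (hγ : ∀ s : ℕ, (s : ℤ) ≡ β [ZMOD (p : ℤ) ^ n] → IsVal p γ (relExponent s s)) :
    ∃ x F G : ℕ, rcomm a b ^ x * a ^ F = b ^ G ∧ (x : ℤ) ≡ α - β [ZMOD (p : ℤ) ^ n] ∧
      IsVal p φ F ∧ IsVal p γ G := by
  obtain ⟨x, F, G, s, t, hr, hx, hs, ht, hF, hG⟩ :=
    h.exists_rel_val hp hα ha hb (n := n + φ + γ + 1) (by omega)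
  have hd : (p : ℤ) ^ n ∣ (p : ℤ) ^ (n + φ + γ + 1) := pow_dvd_pow _ (by omega)
  refine ⟨x, F, G, hr, hx.of_dvd hd, ?_, ?_⟩
  · have := hφ s (hs.of_dvd hd)
    exact ⟨(hF _ (by omega)).2 this.1, fun h => this.2 ((hF _ (by omega)).1 h)⟩
  · have := hγ t (ht.of_dvd hd)
    exact ⟨(hG _ (by omega)).2 this.1, fun h => this.2 ((hG _ (by omega)).1 h)⟩

theorem isVal_relExponent_of_odd (hp : p.Prime) (hp2 : p ≠ 2) {μ : ℕ} (hμ : 1 ≤ μ)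
    (hα : IsVal p μ (α - 1)) (h7 : p = 3 → ¬ α ≡ 7 [ZMOD 9]) {n : ℕ} (hn : μ + 1 ≤ n) (s : ℕ)
    (hs : (s : ℤ) ≡ α [ZMOD (p : ℤ) ^ n]) : IsVal p (2 * μ) (relExponent s s) := by
  have h1 : IsVal p μ ((s : ℤ) - 1) := hα.congr hn (hs.sub_right 1)
  rcases eq_or_ne p 3 with rfl | h3
  · refine pow_dvd_relExponent_three hμ h1.1 h1.2 fun h => h7 rfl (Int.ModEq.trans ?_ h)
    exact (hs.of_dvd (pow_dvd_pow (3 : ℤ) (show 2 ≤ n by omega))).symm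
  · have h5 : 5 ≤ p := by
      have := hp.two_le
      have h4 : p ≠ 4 := by rintro rfl; exact absurd hp (by norm_num)
      omega
    exact pow_dvd_relExponent_of_five_le hp h5 hμ h1.1 h1.2

theorem isVal_relExponent_two {μ : ℕ} (hμ : 1 ≤ μ)
    (hα : IsVal 2 μ (α - 1)) {n : ℕ} (hn : μ + 1 ≤ n) (s : ℕ)
    (hs : (s : ℤ) ≡ α [ZMOD ((2 : ℕ) : ℤ) ^ n]) : IsVal 2 (2 * μ - 1) (relExponent s s) := by
  have h1 : IsVal 2 μ ((s : ℤ) - 1) := hα.congr hn (hs.sub_right 1)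
  have h2 := pow_dvd_relExponent_two hμ h1.1 h1.2
  rwa [IsVal, show 2 * μ - 1 + 1 = 2 * μ by omega]

/-- The class is at most six when `p ≥ 5`, and when `p = 3` away from the residue `7` modulo `9`. -/
theorem upperCentralSeries_six_of_odd (h : IsMacdonaldPair α β a b)
    (hH : Subgroup.closure {a, b} = ⊤) (hp : p.Prime) (hp2 : p ≠ 2)
    (ha : a ^ p ^ k = 1) (hb : b ^ p ^ k = 1) {μ ν : ℕ} (hμ : 1 ≤ μ) (hμν : μ ≤ ν)
    (hα : IsVal p μ (α - 1)) (hβ : IsVal p ν (β - 1))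
    (h7 : p = 3 → ¬ α ≡ 7 [ZMOD 9] ∧ ¬ β ≡ 7 [ZMOD 9]) :
    Subgroup.upperCentralSeries H 6 = ⊤ := by
  obtain ⟨x, F, G, hr, -, hF, hG⟩ := h.exists_rel_isVal hp ((dvd_pow_self _ (by omega)).trans hα.1)
    ha hb (n := μ + ν + 1) (by omega)
    (isVal_relExponent_of_odd hp hp2 hμ hα (fun h => (h7 h).1) (by omega))
    (isVal_relExponent_of_odd hp hp2 (by omega) hβ (fun h => (h7 h).2) (by omega))
  have hb1 := h.symm.left_pow_eq_one_of_rel_odd hp hp2 hb ha (symm_rel hr) (by omega) hβ hμ hα hF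
  have h1 := h.zpow_eq_zpow_of_rel' hr
  -- Here `ν + 2 * ν ≥ ν + 2 * μ`, so the power of `b` vanishes, which gives `a` the bound `p ^ (3 *
  -- μ)`.
  rw [zpow_eq_one_of_natCast_pow_dvd hb1
    ((hβ.one_sub.mul hp hG).dvd (by omega))] at h1
  have ha1 := pow_eq_one_of_val hp ha (hα.mul hp hF) h1
  exact upperCentralSeries_of_odd hp hp2 hμ le_rfl hμν hα.1 hβ.1 2 h hH
    (by rwa [mul_comm μ 2]) (by rwa [mul_comm μ 2])

theorem pow_val_three_of_modEq_seven (hα : α ≡ 7 [ZMOD 9]) : IsVal 3 1 (α - 1) := by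
  have := hα.dvd
  constructor <;> norm_num <;> omega

/-- `G` has valuation 2, which yields `a ^ 27 = 1`; as `27 ∣ F`, the common power of `a` and `b` is
trivial, and then `b ^ 27 = 1`. -/
theorem upperCentralSeries_six_of_modEq_seven_of_modEq_four (h : IsMacdonaldPair α β a b)
    (hH : Subgroup.closure {a, b} = ⊤) (ha : a ^ 3 ^ k = 1) (hb : b ^ 3 ^ k = 1)
    (hα7 : α ≡ 7 [ZMOD 9]) (hβ4 : IsVal 3 1 (β - 1)) (hβ7 : ¬ β ≡ 7 [ZMOD 9]) :
    Subgroup.upperCentralSeries H 6 = ⊤ := by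
  have hp := Nat.prime_three
  have hα := pow_val_three_of_modEq_seven hα7
  obtain ⟨x, F, G, s, t, hr, -, hs, ht, hF, hG⟩ :=
    h.exists_rel_val hp (by simpa using hα.1) ha hb (n := 3) (by omega)
  have hF3 : ((3 : ℕ) : ℤ) ^ 3 ∣ F := (hF 3 le_rfl).2
    (dvd_relExponent_of_modEq_seven ((hs.of_dvd (by norm_num)).trans hα7))
  have hG2 : IsVal 3 2 G := by
    have := isVal_relExponent_of_odd hp (by norm_num) le_rfl hβ4 (fun _ => hβ7) (by norm_num) t ht
    exact ⟨(hG _ (by omega)).2 this.1, fun h => this.2 ((hG _ (by omega)).1 h)⟩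
  have ha1 := h.left_pow_eq_one_of_rel_odd hp (by norm_num) ha hb hr le_rfl hα le_rfl hβ4 hG2
  have h1 := h.zpow_eq_zpow_of_rel' hr
  rw [zpow_eq_one_of_natCast_pow_dvd ha1 (hF3.mul_left _)] at h1
  have hb1 := pow_eq_one_of_val hp hb (hβ4.one_sub.mul hp hG2) h1.symm
  exact upperCentralSeries_of_odd hp (by norm_num) le_rfl le_rfl le_rfl hα.1 hβ4.1 2 h hH ha1 hb1

/-- The large valuation of `G` gives only a weak bound on `a`. Instead, `x` has valuation exactly 1,
so the conjugated relation makes `a ^ 9` commute with `c`, whence `a ^ 27 = 1`. The bounds on `b`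
and `c` are then improved in turn until they fit class 6. -/
theorem upperCentralSeries_six_of_modEq_seven_of_nine_dvd (h : IsMacdonaldPair α β a b)
    (hH : Subgroup.closure {a, b} = ⊤) (ha : a ^ 3 ^ k = 1) (hb : b ^ 3 ^ k = 1)
    (hα7 : α ≡ 7 [ZMOD 9]) {ν : ℕ} (hν : 2 ≤ ν) (hβ : IsVal 3 ν (β - 1)) :
    Subgroup.upperCentralSeries H 6 = ⊤ := by
  have hp := Nat.prime_three
  have hp2 : 3 ≠ 2 := by norm_num
  have hα := pow_val_three_of_modEq_seven hα7
  have h9 : (9 : ℤ) ∣ β - 1 := (pow_dvd_pow (3 : ℤ) hν).trans hβ.1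
  have hβ7 : ¬ β ≡ 7 [ZMOD 9] := fun h => by have := h.dvd; omega
  obtain ⟨x, F, G, s, t, hr, hx, hs, ht, hF, hG⟩ :=
    h.exists_rel_val hp (by simpa using hα.1) ha hb (n := 2 * ν + 3) (by omega)
  have hd : (9 : ℤ) ∣ 3 ^ (2 * ν + 3) := pow_dvd_pow (3 : ℤ) (show 2 ≤ 2 * ν + 3 by omega)
  have hF3 : ((3 : ℕ) : ℤ) ^ 3 ∣ F := (hF 3 (by omega)).2
    (dvd_relExponent_of_modEq_seven ((hs.of_dvd hd).trans hα7))
  have hG2 : IsVal 3 (2 * ν) G := by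
    have := isVal_relExponent_of_odd hp hp2 (by omega) hβ (fun _ => hβ7) (by omega) t ht
    exact ⟨(hG _ (by omega)).2 this.1, fun h => this.2 ((hG _ (by omega)).1 h)⟩
  have hx1 : IsVal 3 1 (x : ℤ) := by
    have h1 := (hx.of_dvd hd).dvd
    have := hα7.dvd
    constructor <;> norm_num <;> omega
  set c := rcomm a b with hc
  have hconj := h.conj_rel hr
  have hcomm := h.commute_right_of_rel_odd hp hp2 hb hr (by omega) hβ hG2
  -- `a ^ 9` commutes with `c`
  have hbc : Commute (b ^ (geomSum β G - G * β ^ G)) c := by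
    have hbb : Commute (b ^ (geomSum β G - G * β ^ G)) b := (Commute.refl b).zpow_left _
    exact ((hcomm.inv_right.mul_right hbb.inv_right).mul_right hcomm).mul_right hbb
  have hac : Commute (a ^ (1 - α ^ x)) c := by
    have : a ^ (1 - α ^ x) = (c ^ G)⁻¹ * b ^ (geomSum β G - G * β ^ G) := by
      rw [← hconj, inv_mul_cancel_left]
    rw [this]
    exact (((Commute.refl c).pow_left G).inv_left).mul_left hbc
  have hv : IsVal 3 2 (1 - α ^ x) := (hα.pow_sub_one hp le_rfl (.inl hp2) hx1).one_sub
  have ha27 : a ^ 3 ^ 3 = 1 := by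
    have h2 := h.zpow_mul_comm (1 - α ^ x)
    rw [hac.eq, mul_right_inj] at h2
    refine pow_eq_one_of_val hp ha (hα.mul hp hv) (?_ : a ^ ((α - 1) * (1 - α ^ x)) = 1)
    rw [sub_one_mul, zpow_sub, ← h2, mul_inv_cancel]
  have hb1 : b ^ 3 ^ (3 * ν) = 1 := by
    have h1 := h.zpow_eq_zpow_of_rel' hr
    rw [zpow_eq_one_of_natCast_pow_dvd ha27 (hF3.mul_left _)] at h1
    have := pow_eq_one_of_val hp hb (hβ.one_sub.mul hp hG2) h1.symm
    rwa [show ν + 2 * ν = 3 * ν by ring] at this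
  -- a power of `b` lies in `⟨c⟩`
  have hbF : b ^ (1 - β ^ x) = c ^ F := by
    have h2 := h.symm.conj_rel (symm_rel hr)
    rw [zpow_eq_one_of_natCast_pow_dvd ha27 ((pow_dvd_pow _ (by omega : 3 ≤ 1 + 3)).trans
      (dvd_geomSum_sub_mul hp hp2 le_rfl hα.1 (by exact_mod_cast hF3))), ← rcomm_inv a b,
      inv_pow] at h2
    exact (inv_mul_eq_one.1 h2).symm
  have hv' : IsVal 3 (ν + 1) (1 - β ^ x) :=
    (hβ.pow_sub_one hp (by omega) (.inl hp2) hx1).one_sub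
  have hb2 : b ^ 3 ^ (2 * ν + 1) = 1 := by
    have h2 := h.symm.zpow_mul_comm (1 - β ^ x)
    have h3 : Commute (b ^ (1 - β ^ x)) (rcomm b a) := by
      rw [hbF, ← rcomm_inv a b]; exact ((Commute.refl c).pow_left F).inv_right
    rw [h3.eq, mul_right_inj] at h2
    have := pow_eq_one_of_val hp hb (hβ.mul hp hv')
      (?_ : b ^ ((β - 1) * (1 - β ^ x)) = 1)
    · rwa [show ν + (ν + 1) = 2 * ν + 1 by ring] at this
    · rw [sub_one_mul, zpow_sub, ← h2, mul_inv_cancel]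
  -- With `a ^ F = 1` the relation reads `c ^ x = b ^ G`; raised to the 9th power it is trivial, and
  -- `9 * x` has valuation 3.
  have hc27 : c ^ 3 ^ 3 = 1 := by
    refine pow_eq_one_of_val hp (h.comm_pow_prime_pow_eq_one (by simpa using hα.1) ha)
      (hx1.mul hp (⟨by norm_num, by norm_num⟩ : IsVal 3 2 9)) ?_
    have haF : a ^ F = 1 := by
      rw [← zpow_natCast]; exact zpow_eq_one_of_natCast_pow_dvd ha27 hF3
    rw [haF, mul_one] at hr
    rw [zpow_mul, zpow_natCast, hr, ← zpow_natCast, ← zpow_mul]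
    refine zpow_eq_one_of_natCast_pow_dvd hb2 ?_
    rw [show 2 * ν + 1 = 2 * ν + 1 from rfl, pow_add]
    exact mul_dvd_mul hG2.1 (by norm_num)
  have hb3 : b ^ 3 ^ (ν + 1) = 1 := by
    refine pow_eq_one_of_val hp hb hv' ?_
    rw [hbF, ← zpow_natCast]
    exact zpow_eq_one_of_natCast_pow_dvd hc27 hF3
  exact upperCentralSeries_of_odd hp hp2 le_rfl le_rfl (by omega) hα.1 hβ.1 2 h hH ha27
    (pow_pow_eq_one_of_le hb3 (by omega))

/-- Now `x` has valuation 2, and `c ^ 27` is central. The conjugated relation expresses a power of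
`a` of exponent valuation 3 through `c ^ G`, so `a ^ F` is central; the cube of the relation then
gives `c ^ 27 = 1`, and this kills `a ^ 27` and `b ^ 27`. -/
theorem upperCentralSeries_six_of_modEq_seven_of_not_modEq (h : IsMacdonaldPair α β a b)
    (hH : Subgroup.closure {a, b} = ⊤) (ha : a ^ 3 ^ k = 1) (hb : b ^ 3 ^ k = 1)
    (hα7 : α ≡ 7 [ZMOD 9]) (hβ7 : β ≡ 7 [ZMOD 9]) (hαβ : ¬ α ≡ β [ZMOD 27])
    (hβ25 : ¬ β ≡ 25 [ZMOD 27]) :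
    Subgroup.upperCentralSeries H 6 = ⊤ := by
  have hp := Nat.prime_three
  have hp2 : 3 ≠ 2 := by norm_num
  have hα := pow_val_three_of_modEq_seven hα7
  have hβ := pow_val_three_of_modEq_seven hβ7
  obtain ⟨x, F, G, s, t, hr, hx, hs, ht, hF, hG⟩ :=
    h.exists_rel_val hp (by simpa using hα.1) ha hb (n := 4) (by omega)
  have hF3 : ((3 : ℕ) : ℤ) ^ 3 ∣ F := (hF 3 (by omega)).2
    (dvd_relExponent_of_modEq_seven ((hs.of_dvd (by norm_num)).trans hα7))
  have hG3 : IsVal 3 3 G := by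
    refine ⟨(hG _ (by omega)).2 (dvd_relExponent_of_modEq_seven
      ((ht.of_dvd (by norm_num)).trans hβ7)), fun h => not_dvd_relExponent_self
      ((ht.of_dvd (by norm_num)).trans hβ7) (fun h25 => hβ25 ?_) ((hG _ (by omega)).1 h)⟩
    exact (ht.of_dvd (by norm_num)).symm.trans h25
  have hx2 : IsVal 3 2 (x : ℤ) := by
    have h1 : (27 : ℤ) ∣ α - β - x := (hx.of_dvd (by norm_num)).dvd
    have h2 := hα7.dvd
    have h3 := hβ7.dvd
    have h4 : ¬ (27 : ℤ) ∣ β - α := fun h => hαβ (Int.modEq_iff_dvd.2 h)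
    constructor <;> norm_num <;> omega
  have ha81 : a ^ 3 ^ 4 = 1 :=
    h.left_pow_eq_one_of_rel_odd hp hp2 ha hb hr le_rfl hα le_rfl hβ hG3
  have hdF : ((3 : ℕ) : ℤ) ^ 4 ∣ (α - 1) * F := by
    rw [pow_succ']; exact mul_dvd_mul (by simpa using hα.1) hF3
  have hb81 : b ^ 3 ^ 4 = 1 := by
    have h1 := h.zpow_eq_zpow_of_rel' hr
    rw [zpow_eq_one_of_natCast_pow_dvd ha81 hdF] at h1
    exact pow_eq_one_of_val hp hb (hβ.one_sub.mul hp hG3) h1.symm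
  set c := rcomm a b with hc
  have hc27 : ∀ n : ℕ, 3 ^ 3 ∣ n → c ^ n ∈ Subgroup.center H := fun n hn =>
    h.comm_pow_mem_center hH
      (zpow_eq_one_of_natCast_pow_dvd ha81 (pow_dvd_pow_sub_one le_rfl hα.1 hn))
      (zpow_eq_one_of_natCast_pow_dvd hb81 (pow_dvd_pow_sub_one le_rfl hβ.1 hn))
  have haG : a ^ (1 - α ^ x) = (c ^ G)⁻¹ := by
    have h2 := h.conj_rel hr
    rw [zpow_eq_one_of_natCast_pow_dvd hb81
      (dvd_geomSum_sub_mul hp hp2 le_rfl hβ.1 (by exact_mod_cast hG3.1))] at h2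
    exact eq_inv_of_mul_eq_one_right h2
  have hbF : b ^ (1 - β ^ x) = c ^ F := by
    have h2 := h.symm.conj_rel (symm_rel hr)
    rw [zpow_eq_one_of_natCast_pow_dvd ha81
      (dvd_geomSum_sub_mul hp hp2 le_rfl hα.1 (by exact_mod_cast hF3)), ← rcomm_inv a b,
      inv_pow] at h2
    exact (inv_mul_eq_one.1 h2).symm
  have hva : IsVal 3 3 (1 - α ^ x) := (hα.pow_sub_one hp le_rfl (.inl hp2) hx2).one_sub
  have hvb : IsVal 3 3 (1 - β ^ x) := (hβ.pow_sub_one hp le_rfl (.inl hp2) hx2).one_sub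
  have haZ : Commute (a ^ ((F : ℤ))) b := by
    refine commute_zpow_of_val hp ha hva ?_ hF3
    rw [haG]
    exact (Subgroup.mem_center_iff.1 (inv_mem (hc27 G (by exact_mod_cast hG3.1))) b).symm
  have hc1 : c ^ 3 ^ 3 = 1 := by
    refine pow_eq_one_of_val hp (h.comm_pow_prime_pow_eq_one (by simpa using hα.1) ha)
      (hx2.mul hp (IsVal.self_natCast hp)) ?_
    have h5 : c ^ x = b ^ G * (a ^ F)⁻¹ := by rw [← hr, mul_inv_cancel_right]
    rw [zpow_natCast] at haZ
    have h6 : Commute (b ^ G) (a ^ F)⁻¹ := (haZ.symm.pow_left G).inv_right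
    rw [zpow_mul, zpow_natCast c, h5, zpow_natCast, h6.mul_pow, ← pow_mul, inv_pow, ← pow_mul]
    have h7 : b ^ (G * 3) = 1 := by
      rw [← zpow_natCast]; push_cast
      exact zpow_eq_one_of_natCast_pow_dvd hb81 (by rw [pow_succ]; exact mul_dvd_mul hG3.1 (by simp))
    have h8 : a ^ (F * 3) = 1 := by
      rw [← zpow_natCast]; push_cast
      exact zpow_eq_one_of_natCast_pow_dvd ha81 (by rw [pow_succ]; exact mul_dvd_mul hF3 (by simp))
    rw [h7, h8, inv_one, mul_one]
  have hcn : ∀ n : ℕ, ((3 : ℕ) : ℤ) ^ 3 ∣ n → c ^ n = 1 := fun n hn => by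
    rw [← zpow_natCast]; exact zpow_eq_one_of_natCast_pow_dvd hc1 hn
  rw [hcn G hG3.1, inv_one] at haG
  rw [hcn F hF3] at hbF
  exact upperCentralSeries_of_odd hp hp2 le_rfl le_rfl le_rfl hα.1 hβ.1 2 h hH
    (pow_eq_one_of_val hp ha hva haG) (pow_eq_one_of_val hp hb hvb hbF)

end IsMacdonaldPair

/-! ### Class at most six for the prime 2. -/

namespace IsMacdonaldPair

variable {H : Type*} [Group H] {α β : ℤ} {a b : H} {k : ℕ}

theorem zpow_eq_one_of_two_dvd {n : ℕ} {x : H} {z : ℤ} (hx : x ^ 2 ^ n = 1)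
    (hz : (2 : ℤ) ^ n ∣ z) : x ^ z = 1 :=
  zpow_eq_one_of_natCast_pow_dvd (p := 2) hx (by simpa using hz)

theorem two_pow_dvd_geomSum_sub {l i n : ℕ} (hl : 1 ≤ l) (hα : (2 : ℤ) ^ l ∣ α - 1)
    (hn : 2 ^ i ∣ n) : (2 : ℤ) ^ (l + i - 1) ∣ geomSum α n - n := by
  have := pow_dvd_two_mul_geomSum_sub (p := 2) i hl (by simpa using hα) hn
  obtain ⟨m, hm⟩ : ∃ m, l + i = m + 1 := ⟨l + i - 1, by omega⟩
  rw [hm, Nat.cast_ofNat, pow_succ'] at this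
  rw [hm, Nat.add_sub_cancel]
  exact Int.dvd_of_mul_dvd_mul_left (by norm_num) this

theorem two_pow_dvd_pow_sub_one {l i n : ℕ} (hl : 1 ≤ l) (hα : (2 : ℤ) ^ l ∣ α - 1)
    (hn : 2 ^ i ∣ n) : (2 : ℤ) ^ (l + i) ∣ α ^ n - 1 := by
  simpa using pow_dvd_pow_sub_one (p := 2) hl (by simpa using hα) hn

section Chain

variable {m μ ν : ℕ}

theorem two_comm_pow_mem_center (h : IsMacdonaldPair α β a b) (hH : Subgroup.closure {a, b} = ⊤)
    (hμ : 1 ≤ μ) (hν : 1 ≤ ν) (hα : (2 : ℤ) ^ μ ∣ α - 1) (hβ : (2 : ℤ) ^ ν ∣ β - 1) {i j l : ℕ}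
    (ha : a ^ 2 ^ i = 1) (hb : b ^ 2 ^ j = 1) (hi : i ≤ μ + l) (hj : j ≤ ν + l) :
    rcomm a b ^ 2 ^ l ∈ Subgroup.center H :=
  h.comm_pow_mem_center hH
    (zpow_eq_one_of_two_dvd ha ((pow_dvd_pow _ hi).trans (two_pow_dvd_pow_sub_one hμ hα dvd_rfl)))
    (zpow_eq_one_of_two_dvd hb ((pow_dvd_pow _ hj).trans (two_pow_dvd_pow_sub_one hν hβ dvd_rfl)))

theorem two_left_pow_mem_center (h : IsMacdonaldPair α β a b)
    (hH : Subgroup.closure {a, b} = ⊤)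
    (hμ : 1 ≤ μ) (hα : (2 : ℤ) ^ μ ∣ α - 1) {i j l : ℕ}
    (ha : a ^ 2 ^ i = 1) (hc : rcomm a b ^ 2 ^ j = 1) (hi : i ≤ μ + l - 1) (hj : j ≤ l) :
    a ^ 2 ^ l ∈ Subgroup.center H :=
  h.left_pow_mem_center hH (pow_pow_eq_one_of_le hc hj) (zpow_eq_one_of_two_dvd ha
    ((pow_dvd_pow _ hi).trans (two_pow_dvd_geomSum_sub hμ hα dvd_rfl)))

theorem two_right_pow_mem_center (h : IsMacdonaldPair α β a b)
    (hH : Subgroup.closure {a, b} = ⊤)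
    (hν : 1 ≤ ν) (hβ : (2 : ℤ) ^ ν ∣ β - 1) {i j l : ℕ}
    (hb : b ^ 2 ^ i = 1) (hc : rcomm a b ^ 2 ^ j = 1) (hi : i ≤ ν + l - 1) (hj : j ≤ l) :
    b ^ 2 ^ l ∈ Subgroup.center H :=
  h.symm.two_left_pow_mem_center (by rwa [Set.pair_comm]) hν hβ hb
    (by rw [← rcomm_inv a b, inv_pow, hc, inv_one]) hi hj

theorem upperCentralSeries_two_of_comm_mem_center
    (hH : Subgroup.closure {a, b} = ⊤) (hc : rcomm a b ∈ Subgroup.center H) :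
    Subgroup.upperCentralSeries H 2 = ⊤ :=
  Subgroup.upperCentralSeries_succ_eq_top <|
    upperCentralSeries_one_of_comm (closure_mk_center hH) <| by
      simpa using mk_center_comm_pow_eq_one (n := 1) (by simpa using hc)

/-- The lost factor 2 is absorbed by a finer descent: in successive central quotients the exponent
of 2 bounding the order of `a` falls through `μ + 2 * m - 1`, `2 * m`, `2 * m - 1`, `m`, and that
for `c` through `2 * m`, `2 * m - 1`, `m`. After four layers `c` is central. The bounds `2 ≤ m ≤ μ,
ν` are what the third layer needs. -/
theorem upperCentralSeries_six_of_two (h : IsMacdonaldPair α β a b)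
    (hH : Subgroup.closure {a, b} = ⊤) (hm : 2 ≤ m) (hμ : m ≤ μ) (hν : m ≤ ν)
    (hα : (2 : ℤ) ^ μ ∣ α - 1) (hβ : (2 : ℤ) ^ ν ∣ β - 1)
    (ha : a ^ 2 ^ (μ + 2 * m) = 1) (hb : b ^ 2 ^ (ν + 2 * m) = 1)
    (haZ : a ^ 2 ^ (μ + 2 * m - 1) ∈ Subgroup.center H)
    (hbZ : b ^ 2 ^ (ν + 2 * m - 1) ∈ Subgroup.center H) :
    Subgroup.upperCentralSeries H 6 = ⊤ := by
  have hμ1 : 1 ≤ μ := by omega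
  have hν1 : 1 ≤ ν := by omega
  have hcZ := h.two_comm_pow_mem_center hH hμ1 hν1 hα hβ ha hb le_rfl le_rfl
  replace h := h.mk_center
  replace hH := closure_mk_center hH
  replace ha := mk_center_pow_eq_one haZ
  replace hb := mk_center_pow_eq_one hbZ
  have hc := mk_center_comm_pow_eq_one hcZ
  refine Subgroup.upperCentralSeries_succ_eq_top ?_
  clear haZ hbZ hcZ
  have haZ := h.two_left_pow_mem_center hH hμ1 hα ha hc le_rfl le_rfl
  have hbZ := h.two_right_pow_mem_center hH hν1 hβ hb hc le_rfl le_rfl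
  have hcZ := h.two_comm_pow_mem_center hH hμ1 hν1 hα hβ ha hb (l := 2 * m - 1)
    (by omega) (by omega)
  replace h := h.mk_center
  replace hH := closure_mk_center hH
  replace ha := mk_center_pow_eq_one haZ
  replace hb := mk_center_pow_eq_one hbZ
  replace hc := mk_center_comm_pow_eq_one hcZ
  refine Subgroup.upperCentralSeries_succ_eq_top ?_
  clear haZ hbZ hcZ
  have haZ := h.two_left_pow_mem_center hH hμ1 hα ha hc (l := 2 * m - 1) (by omega) le_rfl
  have hbZ := h.two_right_pow_mem_center hH hν1 hβ hb hc (l := 2 * m - 1) (by omega) le_rfl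
  have hcZ := h.two_comm_pow_mem_center hH hμ1 hν1 hα hβ ha hb (l := m) (by omega) (by omega)
  replace h := h.mk_center
  replace hH := closure_mk_center hH
  replace ha := mk_center_pow_eq_one haZ
  replace hb := mk_center_pow_eq_one hbZ
  replace hc := mk_center_comm_pow_eq_one hcZ
  refine Subgroup.upperCentralSeries_succ_eq_top ?_
  clear haZ hbZ hcZ
  have haZ := h.two_left_pow_mem_center hH hμ1 hα ha hc (l := m) (by omega) le_rfl
  have hbZ := h.two_right_pow_mem_center hH hν1 hβ hb hc (l := m) (by omega) le_rfl
  replace h := h.mk_center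
  replace hH := closure_mk_center hH
  replace ha := mk_center_pow_eq_one haZ
  replace hb := mk_center_pow_eq_one hbZ
  refine Subgroup.upperCentralSeries_succ_eq_top ?_
  have hcZ := h.two_comm_pow_mem_center hH hμ1 hν1 hα hβ ha hb (l := 0) (by omega) (by omega)
  exact upperCentralSeries_two_of_comm_mem_center hH (by simpa using hcZ)

end Chain

theorem upperCentralSeries_six_of_four_dvd (h : IsMacdonaldPair α β a b)
    (hH : Subgroup.closure {a, b} = ⊤)
    (ha : a ^ 2 ^ k = 1) (hb : b ^ 2 ^ k = 1) {μ ν : ℕ} (hμ : 2 ≤ μ) (hμν : μ ≤ ν)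
    (hα : IsVal 2 μ (α - 1)) (hβ : IsVal 2 ν (β - 1)) :
    Subgroup.upperCentralSeries H 6 = ⊤ := by
  have hp := Nat.prime_two
  have hα' : (2 : ℤ) ^ μ ∣ α - 1 := by simpa using hα.1
  have hβ' : (2 : ℤ) ^ ν ∣ β - 1 := by simpa using hβ.1
  obtain ⟨x, F, G, hr, -, hF, hG⟩ := h.exists_rel_isVal hp ((dvd_pow_self _ (by omega)).trans hα.1)
    ha hb (n := μ + ν + 1) (by omega)
    (isVal_relExponent_two (by omega) hα (by omega))
    (isVal_relExponent_two (by omega) hβ (by omega))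
  have h2 : IsVal 2 1 ((2 : ℕ) : ℤ) := IsVal.self_natCast hp
  have h2F : IsVal 2 (1 + (2 * μ - 1)) ((2 * F : ℕ) : ℤ) := by
    rw [Nat.cast_mul]; exact h2.mul hp hF
  have h2G : IsVal 2 (1 + (2 * ν - 1)) ((2 * G : ℕ) : ℤ) := by
    rw [Nat.cast_mul]; exact h2.mul hp hG
  have ha1 := pow_eq_one_of_val hp ha (hα.pow_sub_one hp (by omega) (.inr hμ) h2G)
    (h.left_zpow_eq_one_of_rel_two hb hr (by omega) hβ (by omega) hG)
  have hb1 := pow_eq_one_of_val hp hb (hβ.pow_sub_one hp (by omega) (.inr (by omega)) h2F)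
    (h.symm.left_zpow_eq_one_of_rel_two ha (symm_rel hr) (by omega) hα (by omega) hF)
  rw [show ν + (1 + (2 * μ - 1)) = ν + 2 * μ by omega] at hb1
  have hvF := hα.mul hp hF
  have hvG := hβ.one_sub.mul hp hG
  have hrel := h.zpow_eq_zpow_of_rel' hr
  have ha3 : IsVal 2 (μ + 2 * μ - 1) ((α - 1) * F) := by
    rwa [show μ + 2 * μ - 1 = μ + (2 * μ - 1) by omega]
  have hnat : ∀ (y z : H) (n : ℕ), Commute (y ^ (((2 : ℕ) : ℤ) ^ n)) z → Commute (y ^ 2 ^ n) z := by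
    intro y z n hy
    rwa [← Nat.cast_pow, zpow_natCast] at hy
  have haZ : a ^ 2 ^ (μ + 2 * μ - 1) ∈ Subgroup.center H :=
    Subgroup.mem_center_of_closure_pair hH ((Commute.refl a).pow_left _)
      (hnat _ _ _ (commute_zpow_of_val hp ha ha3 (h.commute_left_of_rel hr) dvd_rfl))
  rcases hμν.eq_or_lt with rfl | hlt
  · refine h.upperCentralSeries_six_of_two hH hμ le_rfl le_rfl hα' hβ' ?_ hb1 haZ ?_
    · rwa [show μ + 2 * μ = μ + (1 + (2 * μ - 1)) by omega]
    · refine Subgroup.mem_center_of_closure_pair hH (hnat _ _ _ ?_) ((Commute.refl b).pow_left _)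
      exact commute_zpow_of_val hp hb hvG (by
        rw [← hrel]; exact (Commute.refl a).zpow_left _) (pow_dvd_pow _ (by omega))
  · have ha2 : a ^ 2 ^ (μ + 2 * μ - 1) = 1 := by
      refine pow_eq_one_of_val hp ha ha3 ?_
      rw [hrel]
      exact zpow_eq_one_of_natCast_pow_dvd hb1 (hvG.dvd (by omega))
    have hc := h.comm_pow_prime_pow_eq_one (p := 2)
      ((dvd_pow_self _ (by omega)).trans hα.1) ha2
    exact h.upperCentralSeries_six_of_two hH hμ le_rfl hμν hα' hβ'
      (pow_pow_eq_one_of_le ha2 (by omega)) hb1 haZ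
      (h.two_right_pow_mem_center hH (by omega) hβ' hb1 hc (by omega) (by omega))

/-- `geomSum α 2 = α * (α + 1)` is divisible by 4, so `a ^ 2 * b = b * z` with `z` central, and
cancelling `b` identifies `a ^ 2` with `z`. -/
theorem sq_mem_center (h : IsMacdonaldPair α β a b)
    (hα : (4 : ℤ) ∣ α + 1) (ha4 : a ^ 4 ∈ Subgroup.center H)
    (hc : rcomm a b ^ 2 ∈ Subgroup.center H) : a ^ 2 ∈ Subgroup.center H := by
  have h1 := h.pow_mul_right 2
  obtain ⟨l, hl⟩ := hα
  have h2 : geomSum α 2 = 4 * (α * l) := by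
    rw [show (2 : ℕ) = 0 + 1 + 1 by rfl, geomSum_succ, geomSum_succ, geomSum_zero]
    linear_combination α * hl
  have h3 : rcomm a b ^ 2 * a ^ geomSum α 2 ∈ Subgroup.center H := by
    rw [h2, zpow_mul]
    exact mul_mem hc (zpow_mem (by exact_mod_cast ha4) _)
  rw [Subgroup.mem_center_iff.1 h3 b, mul_left_inj] at h1
  rwa [h1]

theorem four_dvd_add_one (hα : IsVal 2 1 (α - 1)) : (4 : ℤ) ∣ α + 1 := by
  obtain ⟨h1, h2⟩ := hα
  norm_num at h1 h2
  omega

theorem eight_dvd_sq_sub_one (hα : IsVal 2 1 (α - 1)) : (8 : ℤ) ∣ α ^ 2 - 1 := by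
  have h1 : (2 : ℤ) ∣ α - 1 := by simpa using hα.1
  have := mul_dvd_mul h1 (four_dvd_add_one hα)
  rw [show α ^ 2 - 1 = (α - 1) * (α + 1) by ring]
  simpa using this

theorem upperCentralSeries_three_of_val_one (h : IsMacdonaldPair α β a b)
    (hH : Subgroup.closure {a, b} = ⊤)
    (ha : a ^ 2 ^ k = 1) (hb : b ^ 2 ^ k = 1)
    (hα : IsVal 2 1 (α - 1)) (hβ : IsVal 2 1 (β - 1)) :
    Subgroup.upperCentralSeries H 3 = ⊤ := by
  have hp := Nat.prime_two
  obtain ⟨x, F, G, hr, -, hF, hG⟩ := h.exists_rel_isVal hp (by simpa using hα.1)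
    ha hb (n := 2) (by omega) (isVal_relExponent_two (by omega) hα (by omega))
    (isVal_relExponent_two (by omega) hβ (by omega))
  have ha8 := pow_eq_one_of_val hp ha (hα.mul hp (hα.mul hp hF)) (h.zpow_sq_eq_one_of_rel hr)
  have hb8 := pow_eq_one_of_val hp hb (hβ.mul hp (hβ.mul hp hG))
    (h.symm.zpow_sq_eq_one_of_rel (symm_rel hr))
  have ha4 : a ^ 4 ∈ Subgroup.center H := by
    refine Subgroup.mem_center_of_closure_pair hH ((Commute.refl a).pow_left _) ?_
    exact_mod_cast commute_zpow_of_val hp ha (hα.mul hp hF) (w := 4) (h.commute_left_of_rel hr)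
      (by norm_num)
  have hb4 : b ^ 4 ∈ Subgroup.center H := by
    refine Subgroup.mem_center_of_closure_pair hH ?_ ((Commute.refl b).pow_left _)
    exact_mod_cast commute_zpow_of_val hp hb (hβ.mul hp hG) (w := 4)
      (h.symm.commute_left_of_rel (symm_rel hr)) (by norm_num)
  have hc : rcomm a b ^ 2 ∈ Subgroup.center H :=
    h.comm_pow_mem_center hH
      (zpow_eq_one_of_two_dvd (n := 3) ha8 (by simpa using eight_dvd_sq_sub_one hα))
      (zpow_eq_one_of_two_dvd (n := 3) hb8 (by simpa using eight_dvd_sq_sub_one hβ))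
  have ha2 := h.sq_mem_center (four_dvd_add_one hα) ha4 hc
  have hb2 := h.symm.sq_mem_center (four_dvd_add_one hβ) hb4
    (by rw [← rcomm_inv a b, inv_pow]; exact inv_mem hc)
  refine Subgroup.upperCentralSeries_succ_eq_top ?_
  refine upperCentralSeries_two_of_comm_mem_center (closure_mk_center hH) ?_
  have := h.mk_center.two_comm_pow_mem_center (closure_mk_center hH) (i := 1) (j := 1) (l := 0)
    (μ := 1) (ν := 1) le_rfl le_rfl (by simpa using hα.1) (by simpa using hβ.1)
    (by simpa using mk_center_pow_eq_one ha2) (by simpa using mk_center_pow_eq_one hb2) le_rfl le_rfl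
  simpa using this

theorem upperCentralSeries_four_of_val_one (h : IsMacdonaldPair α β a b)
    (hH : Subgroup.closure {a, b} = ⊤)
    (ha : a ^ 2 ^ k = 1) (hb : b ^ 2 ^ k = 1) {ν : ℕ} (hν : 2 ≤ ν)
    (hα : IsVal 2 1 (α - 1)) (hβ : IsVal 2 ν (β - 1)) :
    Subgroup.upperCentralSeries H 4 = ⊤ := by
  have hp := Nat.prime_two
  have hν1 : 1 ≤ ν := by omega
  have hα' : (2 : ℤ) ^ 1 ∣ α - 1 := by simpa using hα.1
  have hβ' : (2 : ℤ) ^ ν ∣ β - 1 := by simpa using hβ.1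
  obtain ⟨x, F, G, hr, -, hF, hG⟩ := h.exists_rel_isVal hp (by simpa using hα.1)
    ha hb (n := ν + 1) (by omega) (isVal_relExponent_two (by omega) hα (by omega))
    (isVal_relExponent_two (by omega) hβ (by omega))
  have ha8 : a ^ 2 ^ 3 = 1 :=
    pow_eq_one_of_val hp ha (hα.mul hp (hα.mul hp hF)) (h.zpow_sq_eq_one_of_rel hr)
  have ha4 : a ^ 4 ∈ Subgroup.center H := by
    refine Subgroup.mem_center_of_closure_pair hH ((Commute.refl a).pow_left _) ?_
    exact_mod_cast commute_zpow_of_val hp ha (hα.mul hp hF) (w := 4) (h.commute_left_of_rel hr)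
      (by norm_num)
  have h2F : IsVal 2 (1 + 1) ((2 * F : ℕ) : ℤ) := by
    rw [Nat.cast_mul]; exact (IsVal.self_natCast hp).mul hp hF
  have hb1 := pow_eq_one_of_val hp hb (hβ.pow_sub_one hp (by omega) (.inr hν) h2F)
    (h.symm.left_zpow_eq_one_of_rel_two ha (symm_rel hr) le_rfl hα le_rfl hF)
  have hc8 := h.comm_pow_prime_pow_eq_one (p := 2) (by simpa using hα.1) ha8
  have hbZ := h.two_right_pow_mem_center hH hν1 hβ' hb1 hc8 (l := ν + 1) (by omega) (by omega)
  have hcZ := h.two_comm_pow_mem_center hH le_rfl hν1 hα' hβ' ha8 hb1 (l := 2) le_rfl (by omega)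
  replace h := h.mk_center
  replace hH := closure_mk_center hH
  replace ha4 : (a : H ⧸ Subgroup.center H) ^ 4 = 1 := mk_center_pow_eq_one ha4
  replace hb := mk_center_pow_eq_one hbZ
  have hc := mk_center_comm_pow_eq_one hcZ
  refine Subgroup.upperCentralSeries_succ_eq_top ?_
  have hbZ := h.two_right_pow_mem_center hH hν1 hβ' hb hc (l := ν) (by omega) hν
  have hcZ : rcomm (a : H ⧸ Subgroup.center H) (b : H ⧸ Subgroup.center H) ^ 2 ∈
      Subgroup.center _ :=
    h.two_comm_pow_mem_center hH le_rfl hν1 hα' hβ' (i := 2) (l := 1) ha4 hb (by omega) (by omega)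
  have haZ := h.sq_mem_center (four_dvd_add_one hα) (by rw [ha4]; exact one_mem _) hcZ
  replace h := h.mk_center
  replace hH := closure_mk_center hH
  replace ha := mk_center_pow_eq_one haZ
  replace hb := mk_center_pow_eq_one hbZ
  refine Subgroup.upperCentralSeries_succ_eq_top ?_
  refine upperCentralSeries_two_of_comm_mem_center hH ?_
  have := h.two_comm_pow_mem_center hH (i := 1) (l := 0) le_rfl hν1 hα' hβ' (by simpa using ha) hb
    le_rfl le_rfl
  simpa using this

end IsMacdonaldPair

/-! ### The exceptional case at the prime 3, and the case distinction. -/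

namespace IsMacdonaldPair

variable {H : Type*} [Group H] {α β : ℤ} {a b : H} {k : ℕ}

theorem isVal_relExponent_of_modEq_seven {α : ℤ} (hα7 : α ≡ 7 [ZMOD 9])
    (h25 : ¬ α ≡ 25 [ZMOD 27]) (s : ℕ) (hs : (s : ℤ) ≡ α [ZMOD ((3 : ℕ) : ℤ) ^ 3]) :
    IsVal 3 3 (relExponent s s) := by
  have hs7 : (s : ℤ) ≡ 7 [ZMOD 9] := (hs.of_dvd (by norm_num)).trans hα7
  exact ⟨dvd_relExponent_of_modEq_seven hs7,
    not_dvd_relExponent_self hs7 fun h => h25 ((hs.of_dvd (by norm_num)).symm.trans h)⟩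

/-- The relation with `κ = 1` has exponents of valuation 3 except for the residue 25 modulo 27,
where `κ = 2` is used instead. -/
theorem exists_rel_of_modEq_seven (h : IsMacdonaldPair α β a b)
    (ha : a ^ 3 ^ k = 1) (hb : b ^ 3 ^ k = 1)
    (hα7 : α ≡ 7 [ZMOD 9]) (hβ7 : β ≡ 7 [ZMOD 9]) (hαβ : α ≡ β [ZMOD 27]) :
    ∃ x F G : ℕ, rcomm a b ^ x * a ^ F = b ^ G ∧ 3 ^ 3 ∣ x ∧ IsVal 3 3 F ∧ IsVal 3 3 G := by
  have hp := Nat.prime_three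
  have hα := pow_val_three_of_modEq_seven hα7
  by_cases h25 : α ≡ 25 [ZMOD 27]
  · have h25' : β ≡ 25 [ZMOD 27] := hαβ.symm.trans h25
    have hK := pow_pow_eq_one_of_le ha (Nat.le_add_right k 4)
    have hK' := pow_pow_eq_one_of_le hb (Nat.le_add_right k 4)
    have hpos : (0 : ℤ) < ((3 : ℕ) : ℤ) ^ (k + 4) := by positivity
    have hnat : ∀ z : ℤ, ∃ s : ℕ, (s : ℤ) ≡ z [ZMOD ((3 : ℕ) : ℤ) ^ (k + 4)] := fun z =>
      ⟨(z % ((3 : ℕ) : ℤ) ^ (k + 4)).toNat, by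
        rw [Int.toNat_of_nonneg (Int.emod_nonneg _ hpos.ne')]; exact Int.mod_modEq _ _⟩
    obtain ⟨s, hs⟩ := hnat (α ^ 2)
    obtain ⟨t, ht⟩ := hnat (β ^ 2)
    have hz : ∀ {y : H} {z w : ℤ}, y ^ 3 ^ (k + 4) = 1 → w ≡ z [ZMOD ((3 : ℕ) : ℤ) ^ (k + 4)] →
        y ^ z = y ^ w := fun {y z w} hy hzw => by
      have := zpow_eq_one_of_natCast_pow_dvd hy hzw.dvd
      rwa [zpow_sub, mul_inv_eq_one] at this
    obtain ⟨x, F, G, hr, hx, hF, hG⟩ := h.exists_rel hp (by simpa using hα.1) hK hK'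
      (κ := 2) (s := s) (t := t) (by rw [hz hK hs, zpow_natCast]) (by rw [hz hK' ht, zpow_natCast])
    have hd : (27 : ℤ) ∣ ((3 : ℕ) : ℤ) ^ (k + 4) :=
      pow_dvd_pow (3 : ℤ) (show 3 ≤ k + 4 by omega)
    have h1 := dvd_relExponent_sq h25 (hs.of_dvd hd)
    have h2 := dvd_relExponent_sq h25' (ht.of_dvd hd)
    refine ⟨x, F, G, hr, ?_, ⟨(hF _ (by omega)).2 h1.1, fun h => h1.2 ((hF _ (by omega)).1 h)⟩,
      ⟨(hG _ (by omega)).2 h2.1, fun h => h2.2 ((hG _ (by omega)).1 h)⟩⟩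
    have h3 : (x : ℤ) ≡ 0 [ZMOD 27] := by
      have h4 := ((hs.of_dvd hd).sub (ht.of_dvd hd)).trans ((h25.pow 2).sub (h25'.pow 2))
      simpa using (hx.of_dvd hd).trans h4
    exact_mod_cast (Int.modEq_zero_iff_dvd.1 h3 : ((27 : ℕ) : ℤ) ∣ x)
  · have h25' : ¬ β ≡ 25 [ZMOD 27] := fun h => h25 (hαβ.trans h)
    obtain ⟨x, F, G, hr, hx, hF, hG⟩ := h.exists_rel_isVal hp (by simpa using hα.1) ha hb
      (n := 3) (by omega) (isVal_relExponent_of_modEq_seven hα7 h25)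
      (isVal_relExponent_of_modEq_seven hβ7 h25')
    refine ⟨x, F, G, hr, ?_, hF, hG⟩
    have h3 : (x : ℤ) ≡ 0 [ZMOD 27] := by
      have := (hx.of_dvd (by norm_num : (27 : ℤ) ∣ _)).trans (hαβ.sub_right β)
      simpa using this
    exact_mod_cast (Int.modEq_zero_iff_dvd.1 h3 : ((27 : ℕ) : ℤ) ∣ x)

/-- The relations forced in the exceptional case. -/
theorem relations_of_modEq_seven (h : IsMacdonaldPair α β a b)
    (ha : a ^ 3 ^ k = 1) (hb : b ^ 3 ^ k = 1)
    (hα7 : α ≡ 7 [ZMOD 9]) (hβ7 : β ≡ 7 [ZMOD 9]) (hαβ : α ≡ β [ZMOD 27]) :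
    a ^ 3 ^ 4 = 1 ∧ b ^ 3 ^ 4 = 1 ∧ rcomm a b ^ 3 ^ 3 = 1 ∧
      b ^ 3 ^ 3 ∈ Subgroup.zpowers (a ^ 3 ^ 3) := by
  have hp := Nat.prime_three
  have hp2 : 3 ≠ 2 := by norm_num
  have hα := pow_val_three_of_modEq_seven hα7
  have hβ := pow_val_three_of_modEq_seven hβ7
  obtain ⟨x, F, G, hr, hx, hF, hG⟩ := h.exists_rel_of_modEq_seven ha hb hα7 hβ7 hαβ
  have ha81 : a ^ 3 ^ 4 = 1 :=
    h.left_pow_eq_one_of_rel_odd hp hp2 ha hb hr le_rfl hα le_rfl hβ hG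
  have hb81 : b ^ 3 ^ 4 = 1 :=
    h.symm.left_pow_eq_one_of_rel_odd hp hp2 hb ha (symm_rel hr) le_rfl hβ le_rfl hα hF
  have hc27 : rcomm a b ^ 3 ^ 3 = 1 := by
    have h1 := h.conj_rel hr
    rw [zpow_eq_one_of_natCast_pow_dvd hb81
      (dvd_geomSum_sub_mul hp hp2 le_rfl hβ.1 (by exact_mod_cast hG.1)),
      zpow_eq_one_of_natCast_pow_dvd ha81, mul_one, ← zpow_natCast] at h1
    · exact pow_eq_one_of_val hp (h.comm_pow_prime_pow_eq_one (by simpa using hα.1) ha) hG h1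
    · rw [dvd_sub_comm]; exact pow_dvd_pow_sub_one le_rfl hα.1 hx
  refine ⟨ha81, hb81, hc27, ?_⟩
  obtain ⟨x, rfl⟩ := hx
  rw [pow_mul, hc27, one_pow, one_mul] at hr
  have h1 := zpow_mem_zpowers_of_dvd hp hb hG.2 (dvd_refl (((3 : ℕ) : ℤ) ^ 3))
  rw [zpow_natCast, ← hr] at h1
  obtain ⟨F, rfl⟩ : 3 ^ 3 ∣ F := by exact_mod_cast hF.1
  rw [pow_mul] at h1
  have h2 := Subgroup.zpowers_le.2 (Subgroup.pow_mem _ (Subgroup.mem_zpowers (a ^ 3 ^ 3)) F) h1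
  rwa [← Nat.cast_pow, zpow_natCast] at h2

/-- By the symmetric form of the relations `a ^ 27` is also a power of `b ^ 27`, so it commutes with
both generators. -/
theorem left_pow_mem_center_of_modEq_seven (h : IsMacdonaldPair α β a b)
    (hH : Subgroup.closure {a, b} = ⊤) (ha : a ^ 3 ^ k = 1) (hb : b ^ 3 ^ k = 1)
    (hα7 : α ≡ 7 [ZMOD 9]) (hβ7 : β ≡ 7 [ZMOD 9]) (hαβ : α ≡ β [ZMOD 27]) :
    a ^ 3 ^ 3 ∈ Subgroup.center H := by
  refine Subgroup.mem_center_of_closure_pair hH ((Commute.refl a).pow_left _) ?_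
  obtain ⟨n, hn⟩ := (h.symm.relations_of_modEq_seven hb ha hβ7 hα7 hαβ.symm).2.2.2
  simp only at hn
  rw [← hn]
  exact ((Commute.refl b).pow_left _).zpow_left n

theorem upperCentralSeries_seven_of_modEq_seven (h : IsMacdonaldPair α β a b)
    (hH : Subgroup.closure {a, b} = ⊤) (ha : a ^ 3 ^ k = 1) (hb : b ^ 3 ^ k = 1)
    (hα7 : α ≡ 7 [ZMOD 9]) (hβ7 : β ≡ 7 [ZMOD 9]) (hαβ : α ≡ β [ZMOD 27]) :
    Subgroup.upperCentralSeries H 7 = ⊤ := by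
  have haZ := h.left_pow_mem_center_of_modEq_seven hH ha hb hα7 hβ7 hαβ
  have hbZ := h.symm.left_pow_mem_center_of_modEq_seven (by rwa [Set.pair_comm]) hb ha hβ7 hα7
    hαβ.symm
  refine Subgroup.upperCentralSeries_succ_eq_top ?_
  exact upperCentralSeries_of_odd Nat.prime_three (by norm_num) le_rfl le_rfl le_rfl
    (pow_val_three_of_modEq_seven hα7).1 (pow_val_three_of_modEq_seven hβ7).1 2
    h.mk_center (closure_mk_center hH) (mk_center_pow_eq_one haZ) (mk_center_pow_eq_one hbZ)

theorem upperCentralSeries_one_of_left_eq_one (hH : Subgroup.closure {a, b} = ⊤) (ha : a = 1) :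
    Subgroup.upperCentralSeries H 1 = ⊤ :=
  upperCentralSeries_one_of_comm hH (by simp [rcomm, ha])

theorem eq_one_of_not_dvd_sub_one (h : IsMacdonaldPair α β a b) {p : ℕ} (hp : p.Prime)
    (ha : a ^ p ^ k = 1) (hb : b ^ p ^ k = 1) (hα : ¬ (p : ℤ) ∣ α - 1) : a = 1 := by
  have hpos : 0 < p ^ k := Nat.pow_pos hp.pos
  by_contra hne
  refine hα (h.prime_dvd_sub_one (isOfFinOrder_iff_pow_eq_one.2 ⟨_, hpos, ha⟩)
    (isOfFinOrder_iff_pow_eq_one.2 ⟨_, hpos, hb⟩) hp ?_)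
  obtain ⟨i, -, hi⟩ := (Nat.dvd_prime_pow hp).1 (orderOf_dvd_of_pow_eq_one ha)
  rcases Nat.eq_zero_or_pos i with rfl | h0
  · exact absurd (orderOf_eq_one_iff.1 (by simpa using hi)) hne
  · rw [hi]; exact dvd_pow_self p h0.ne'

theorem upperCentralSeries_six (h : IsMacdonaldPair α β a b)
    (hH : Subgroup.closure {a, b} = ⊤) {p : ℕ} (hp : p.Prime)
    (ha : a ^ p ^ k = 1) (hb : b ^ p ^ k = 1) (hα : α ≠ 1) (hβ : β ≠ 1)
    (hs : ¬ (p = 3 ∧ α ≡ 7 [ZMOD 9] ∧ β ≡ 7 [ZMOD 9] ∧ α ≡ β [ZMOD 27])) :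
    Subgroup.upperCentralSeries H 6 = ⊤ := by
  have hmono : ∀ n ≤ 6, Subgroup.upperCentralSeries H n = ⊤ →
      Subgroup.upperCentralSeries H 6 = ⊤ := fun n hn hU =>
    top_le_iff.1 (hU ▸ Subgroup.upperCentralSeries_mono H hn)
  by_cases hα1 : (p : ℤ) ∣ α - 1
  swap
  · exact hmono 1 (by omega) (upperCentralSeries_one_of_left_eq_one hH
      (h.eq_one_of_not_dvd_sub_one hp ha hb hα1))
  by_cases hβ1 : (p : ℤ) ∣ β - 1
  swap
  · exact hmono 1 (by omega) (upperCentralSeries_one_of_left_eq_one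
      (by rwa [Set.pair_comm]) (h.symm.eq_one_of_not_dvd_sub_one hp hb ha hβ1))
  obtain ⟨μ, hμ⟩ := IsVal.exists_of_ne_zero hp (sub_ne_zero.2 hα)
  obtain ⟨ν, hν⟩ := IsVal.exists_of_ne_zero hp (sub_ne_zero.2 hβ)
  wlog hμν : μ ≤ ν generalizing α β a b μ ν
  · exact this h.symm (by rwa [Set.pair_comm]) hb ha hβ hα
      (fun h => hs ⟨h.1, h.2.2.1, h.2.1, h.2.2.2.symm⟩) hβ1 hα1 ν hν μ hμ (by omega)
  have hμ1 : 1 ≤ μ := by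
    by_contra h0
    exact hμ.2 (by simpa [show μ = 0 by omega] using hα1)
  rcases eq_or_ne p 2 with rfl | hp2
  · rcases hμ1.eq_or_lt with rfl | hμ2
    · rcases hμν.eq_or_lt with rfl | hν2
      · exact hmono 3 (by omega) (h.upperCentralSeries_three_of_val_one hH ha hb hμ hν)
      · exact hmono 4 (by omega) (h.upperCentralSeries_four_of_val_one hH ha hb hν2 hμ hν)
    · exact h.upperCentralSeries_six_of_four_dvd hH ha hb hμ2 hμν hμ hν
  by_cases h7 : p = 3 → ¬ α ≡ 7 [ZMOD 9] ∧ ¬ β ≡ 7 [ZMOD 9]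
  · exact h.upperCentralSeries_six_of_odd hH hp hp2 ha hb hμ1 hμν hμ hν h7
  obtain ⟨rfl, h7⟩ := Classical.not_imp.1 h7
  have h71 : ∀ {z : ℤ} {i : ℕ}, z ≡ 7 [ZMOD 9] → IsVal 3 i (z - 1) → i < 2 := by
    intro z i hz hi
    by_contra hlt
    have h1 := hi.dvd (show 2 ≤ i by omega)
    have h2 := hz.dvd
    norm_num at h1
    omega
  by_cases hα7 : α ≡ 7 [ZMOD 9]
  · by_cases hβ7 : β ≡ 7 [ZMOD 9]
    · have hαβ : ¬ α ≡ β [ZMOD 27] := fun h => hs ⟨rfl, hα7, hβ7, h⟩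
      -- At most one of `α`, `β` is 25 modulo 27, so after a possible swap the second exponent
      -- avoids this residue.
      by_cases h25 : β ≡ 25 [ZMOD 27]
      · exact h.symm.upperCentralSeries_six_of_modEq_seven_of_not_modEq (by rwa [Set.pair_comm])
          hb ha hβ7 hα7 (fun h => hαβ h.symm) (fun h => hαβ (h.trans h25.symm))
      · exact h.upperCentralSeries_six_of_modEq_seven_of_not_modEq hH ha hb hα7 hβ7 hαβ h25
    · rcases (show ν = 1 ∨ 2 ≤ ν by omega) with rfl | hν2
      · exact h.upperCentralSeries_six_of_modEq_seven_of_modEq_four hH ha hb hα7 hν hβ7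
      · exact h.upperCentralSeries_six_of_modEq_seven_of_nine_dvd hH ha hb hα7 hν2 hν
  · have hβ7 : β ≡ 7 [ZMOD 9] := by tauto
    have := h71 hβ7 hν
    obtain rfl : μ = 1 := by omega
    exact h.symm.upperCentralSeries_six_of_modEq_seven_of_modEq_four (by rwa [Set.pair_comm])
      hb ha hβ7 hμ hα7

end IsMacdonaldPair

/-! ### Order and lower central series in the exceptional case. -/

theorem IsVal.natCast_pow {p : ℕ} (hp : p.Prime) (j : ℕ) : IsVal p j ((p ^ j : ℕ) : ℤ) := by
  refine ⟨by simp, fun h => ?_⟩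
  have h2 : p ^ (j + 1) ∣ p ^ j := by exact_mod_cast h
  have := (Nat.pow_dvd_pow_iff_le_right hp.one_lt).1 h2
  omega

theorem pow_mem_of_zpow_mem_of_val {H : Type*} [Group H] {p k n : ℕ} {x : H} {z w : ℤ}
    {S : Subgroup H} (hp : p.Prime) (hx : x ^ p ^ k = 1) (hz : IsVal p n z) (hS : x ^ z ∈ S)
    (hw : (p : ℤ) ^ n ∣ w) : x ^ w ∈ S :=
  Subgroup.zpowers_le.2 hS (zpow_mem_zpowers_of_dvd hp hx hz.2 hw)

universe u in
/-- The quotient by a central subgroup of order `p`. -/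
theorem exists_central_quotient {H : Type u} [Group H] {p : ℕ} (hp : p.Prime) {z : H}
    (hz : z ∈ Subgroup.center H) (hzp : z ^ p = 1) (hz1 : z ≠ 1) :
    ∃ (K : Type u) (_ : Group K) (f : H →* K), Function.Surjective f ∧
      (∀ x, f x = 1 ↔ x ∈ Subgroup.zpowers z) ∧ Nat.card H = p * Nat.card K := by
  have hN : (Subgroup.zpowers z).Normal :=
    ⟨fun x hx g => by
      rwa [Subgroup.mem_center_iff.1 (Subgroup.zpowers_le.2 hz hx) g, mul_inv_cancel_right]⟩
  refine ⟨H ⧸ Subgroup.zpowers z, inferInstance, QuotientGroup.mk' _,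
    QuotientGroup.mk'_surjective _, fun x => by simp, ?_⟩
  rw [Subgroup.card_eq_card_quotient_mul_card_subgroup (Subgroup.zpowers z), Nat.card_zpowers,
    (orderOf_eq_prime_iff (hp := ⟨hp⟩)).2 ⟨hzp, hz1⟩, mul_comm]

namespace IsMacdonaldPair

section Card

variable {p : ℕ} {α β : ℤ}

/-- Modulo the order of `a`, `geomSum α (p ^ j)` is `p ^ j`, so the rule for conjugating `a ^ p ^ j`
by `b` leaves exactly `c ^ p ^ j`. -/
theorem comm_mem_of_pow_central {H : Type*} [Group H] {a b : H} (h : IsMacdonaldPair α β a b)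
    (hp : p.Prime) (hp2 : p ≠ 2)
    (hα : IsVal p 1 (α - 1)) {j : ℕ} (ha : a ^ p ^ (j + 1) = 1) (hab : Commute (a ^ p ^ j) b) :
    rcomm a b ^ p ^ j = 1 := by
  have h1 := h.pow_mul_right (p ^ j)
  have h2 : a ^ geomSum α (p ^ j) = a ^ p ^ j := by
    have := zpow_eq_one_of_natCast_pow_dvd ha ((pow_dvd_pow _ (by omega : j + 1 ≤ 1 + j)).trans
      (pow_dvd_geomSum_sub (i := j) hp hp2 le_rfl hα.1 dvd_rfl))
    rwa [zpow_sub, mul_inv_eq_one, zpow_natCast] at this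
  rwa [h2, hab.eq, mul_right_inj, right_eq_mul] at h1

theorem zpow_eq_one_of_commute_comm_pow {H : Type*} [Group H] {a b : H}
    (h : IsMacdonaldPair α β a b) {n : ℕ} (hc : Commute (rcomm a b ^ n) a) :
    a ^ (α ^ n - 1) = 1 := by
  have h1 := h.zpow_mul_comm_pow 1 n
  rw [zpow_one, one_mul, ← hc.eq, mul_right_inj] at h1
  rw [zpow_sub_one, ← h1, mul_inv_cancel]

-- The elements `c ^ p ^ j`, `a ^ p ^ j`, `b ^ p ^ j` are factored out in turn; each is central of
-- order `p` when its turn comes. If one of the latter two were already trivial, a power of `a` or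
-- `b` would commute with the other generator, forcing `c ^ p ^ j = 1`. If `c ^ p ^ (j - 1)` died,
-- it would have been central before the last two quotients, forcing `a ^ p ^ j` to be trivial
-- there.
universe u in
theorem exists_quotient_of_comm_pow_ne_one (hp : p.Prime) (hp2 : p ≠ 2)
    (hα : IsVal p 1 (α - 1)) (hβ : IsVal p 1 (β - 1)) (j : ℕ) {H : Type u} [Group H] {a b : H}
    (h : IsMacdonaldPair α β a b) (hH : Subgroup.closure {a, b} = ⊤)
    (ha : a ^ p ^ (j + 1) = 1) (hb : b ^ p ^ (j + 1) = 1) (hc : rcomm a b ^ p ^ j ≠ 1) :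
    ∃ (K : Type u) (_ : Group K) (a' b' : K), IsMacdonaldPair α β a' b' ∧
      Subgroup.closure {a', b'} = ⊤ ∧ a' ^ p ^ j = 1 ∧ b' ^ p ^ j = 1 ∧
      (∀ i, i + 1 = j → rcomm a' b' ^ p ^ i ≠ 1) ∧ Nat.card H = p ^ 3 * Nat.card K := by
  have hαp : (p : ℤ) ∣ α - 1 := by simpa using hα.1
  have hpow : ∀ {x : H}, x ^ p ^ (j + 1) = 1 → (x ^ p ^ j) ^ p = 1 := fun {x} hx => by
    rwa [← pow_mul, ← pow_succ]
  have hcZ : rcomm a b ^ p ^ j ∈ Subgroup.center H := h.comm_pow_mem_center hH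
    (zpow_eq_one_of_natCast_pow_dvd ha (by
      rw [add_comm]; exact pow_dvd_pow_sub_one le_rfl hα.1 dvd_rfl))
    (zpow_eq_one_of_natCast_pow_dvd hb (by
      rw [add_comm]; exact pow_dvd_pow_sub_one le_rfl hβ.1 dvd_rfl))
  have hcZ' : Subgroup.zpowers (rcomm a b ^ p ^ j) ≤ Subgroup.center H :=
    Subgroup.zpowers_le.2 hcZ
  -- the quotient by `c ^ (p ^ j)`
  obtain ⟨K₁, _, f₁, hs₁, hf₁, hcard₁⟩ := exists_central_quotient hp hcZ
    (hpow (h.comm_pow_prime_pow_eq_one hαp ha)) hc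
  have h₁ := h.map f₁
  have hH₁ := Subgroup.closure_pair_map_eq_top hH hs₁
  have hc₁ : rcomm (f₁ a) (f₁ b) ^ p ^ j = 1 := by
    rw [← map_rcomm, ← map_pow, hf₁]; exact Subgroup.mem_zpowers _
  have ha₁ : f₁ a ^ p ^ (j + 1) = 1 := by rw [← map_pow, ha, map_one]
  have hb₁ : f₁ b ^ p ^ (j + 1) = 1 := by rw [← map_pow, hb, map_one]
  have haZ₁ : f₁ a ^ p ^ j ∈ Subgroup.center K₁ := h₁.left_pow_mem_center hH₁ hc₁
    (zpow_eq_one_of_natCast_pow_dvd ha₁ (by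
      rw [add_comm]; exact pow_dvd_geomSum_sub hp hp2 le_rfl hα.1 dvd_rfl))
  have hbZ₁ : f₁ b ^ p ^ j ∈ Subgroup.center K₁ := h₁.right_pow_mem_center hH₁ hc₁
    (zpow_eq_one_of_natCast_pow_dvd hb₁ (by
      rw [add_comm]; exact pow_dvd_geomSum_sub hp hp2 le_rfl hβ.1 dvd_rfl))
  have hane : f₁ a ^ p ^ j ≠ 1 := by
    rw [← map_pow, Ne, hf₁]
    exact fun hm => hc (h.comm_mem_of_pow_central hp hp2 hα ha
      (Subgroup.mem_center_iff.1 (hcZ' hm) b).symm)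
  -- the quotient by `a ^ (p ^ j)`
  obtain ⟨K₂, _, f₂, hs₂, hf₂, hcard₂⟩ := exists_central_quotient hp haZ₁
    (by rwa [← pow_mul, ← pow_succ]) hane
  have hbne : f₂ (f₁ b) ^ p ^ j ≠ 1 := by
    rw [← map_pow, Ne, hf₂]
    rintro ⟨n, hn⟩
    have hm : b ^ p ^ j * ((a ^ p ^ j) ^ n)⁻¹ ∈ Subgroup.zpowers (rcomm a b ^ p ^ j) := by
      simp only at hn
      rw [← hf₁, map_mul, map_inv, map_zpow, map_pow, map_pow, hn, mul_inv_cancel]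
    have hcomm : Commute (b ^ p ^ j) a := by
      have h1 : Commute (b ^ p ^ j * ((a ^ p ^ j) ^ n)⁻¹) a :=
        (Subgroup.mem_center_iff.1 (hcZ' hm) a).symm
      have h2 : Commute ((a ^ p ^ j) ^ n) a := ((Commute.refl a).pow_left _).zpow_left n
      have := h1.mul_left h2
      rwa [inv_mul_cancel_right] at this
    have := h.symm.comm_mem_of_pow_central hp hp2 hβ hb hcomm
    rw [← rcomm_inv a b, inv_pow, inv_eq_one] at this
    exact hc this
  have hH₂ := Subgroup.closure_pair_map_eq_top hH₁ hs₂
  have ha₂ : f₂ (f₁ a) ^ p ^ j = 1 := by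
    rw [← map_pow, hf₂]; exact Subgroup.mem_zpowers _
  have hbZ₂ : f₂ (f₁ b) ^ p ^ j ∈ Subgroup.center K₂ := by
    rw [← map_pow]
    refine Subgroup.mem_center_iff.2 fun g => ?_
    obtain ⟨g, rfl⟩ := hs₂ g
    rw [← map_mul, ← map_mul, Subgroup.mem_center_iff.1 hbZ₁ g]
  -- the quotient by `b ^ (p ^ j)`
  obtain ⟨K₃, _, f₃, hs₃, hf₃, hcard₃⟩ := exists_central_quotient hp hbZ₂
    (by rw [← pow_mul, ← pow_succ, ← map_pow, hb₁, map_one]) hbne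
  refine ⟨K₃, _, f₃ (f₂ (f₁ a)), f₃ (f₂ (f₁ b)), (h₁.map f₂).map f₃,
    Subgroup.closure_pair_map_eq_top hH₂ hs₃, by rw [← map_pow, ha₂, map_one], ?_, ?_, ?_⟩
  · rw [← map_pow, hf₃]; exact Subgroup.mem_zpowers _
  · rintro i rfl hci
    rw [← map_rcomm, ← map_pow, hf₃] at hci
    obtain ⟨n, hn⟩ := hci
    have hm : rcomm (f₁ a) (f₁ b) ^ p ^ i * ((f₁ b ^ p ^ (i + 1)) ^ n)⁻¹ ∈
        Subgroup.zpowers (f₁ a ^ p ^ (i + 1)) := by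
      simp only at hn
      rw [← hf₂, map_mul, map_inv, map_zpow, map_pow, map_pow, hn, map_rcomm, mul_inv_cancel]
    have hz := mul_mem (Subgroup.zpowers_le.2 haZ₁ hm) (zpow_mem hbZ₁ n)
    rw [inv_mul_cancel_right] at hz
    have h1 := h₁.zpow_eq_one_of_commute_comm_pow (Subgroup.mem_center_iff.1 hz (f₁ a)).symm
    refine hane ?_
    rw [add_comm i 1]
    exact pow_eq_one_of_val hp ha₁ (hα.pow_sub_one hp le_rfl (.inl hp2)
      (.natCast_pow hp i)) h1
  · rw [hcard₁, hcard₂, hcard₃]; ring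

universe u in
theorem card_eq_of_comm_pow_ne_one (hp : p.Prime) (hp2 : p ≠ 2)
    (hα : IsVal p 1 (α - 1)) (hβ : IsVal p 1 (β - 1)) (j : ℕ) :
    ∀ {H : Type u} [Group H] {a b : H}, IsMacdonaldPair α β a b → Subgroup.closure {a, b} = ⊤ →
      a ^ p ^ (j + 1) = 1 → b ^ p ^ (j + 1) = 1 → rcomm a b ^ p ^ j ≠ 1 →
      Nat.card H = (p ^ 3) ^ (j + 1) := by
  induction j with
  | zero =>
    intro H _ a b h hH ha hb hc
    obtain ⟨K, _, a', b', h', hK, ha', hb', -, hcard⟩ :=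
      h.exists_quotient_of_comm_pow_ne_one hp hp2 hα hβ 0 hH ha hb hc
    rw [pow_zero, pow_one] at ha' hb'
    have : Subsingleton K := by
      rw [ha', hb', Set.pair_eq_singleton, Subgroup.closure_singleton_one] at hK
      exact Subgroup.subsingleton_iff.1 (subsingleton_of_bot_eq_top hK)
    rw [hcard, Nat.card_unique, mul_one, zero_add, pow_one]
  | succ j ih =>
    intro H _ a b h hH ha hb hc
    obtain ⟨K, _, a', b', h', hK, ha', hb', hc', hcard⟩ :=
      h.exists_quotient_of_comm_pow_ne_one hp hp2 hα hβ (j + 1) hH ha hb hc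
    rw [hcard, ih h' hK ha' hb' (hc' j rfl), pow_succ' (p ^ 3) (j + 1)]

end Card

section Exceptional

open scoped commutatorElement

variable {H : Type*} [Group H] {α β : ℤ} {a b : H} {k : ℕ}

/-- Otherwise `c ^ 9` would be central, and `a ^ (α ^ 9 - 1) = 1` would follow with an exponent of
valuation 3. -/
theorem comm_pow_nine_notMem_zpowers (h : IsMacdonaldPair α β a b)
    (hH : Subgroup.closure {a, b} = ⊤) (ha : a ^ 3 ^ k = 1) (hb : b ^ 3 ^ k = 1)
    (hα7 : α ≡ 7 [ZMOD 9]) (hβ7 : β ≡ 7 [ZMOD 9]) (hαβ : α ≡ β [ZMOD 27])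
    (hne : a ^ 3 ^ 3 ≠ 1) : rcomm a b ^ 3 ^ 2 ∉ Subgroup.zpowers (a ^ 3 ^ 3) := by
  intro hm
  have hz := Subgroup.zpowers_le.2
    (h.left_pow_mem_center_of_modEq_seven hH ha hb hα7 hβ7 hαβ) hm
  have h1 := h.zpow_eq_one_of_commute_comm_pow (Subgroup.mem_center_iff.1 hz a).symm
  refine hne (pow_eq_one_of_val Nat.prime_three ha ?_ h1)
  exact (pow_val_three_of_modEq_seven hα7).pow_sub_one Nat.prime_three le_rfl (.inl (by norm_num))
    (j := 2) ⟨by norm_num, by norm_num⟩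

theorem card_of_modEq_seven (h : IsMacdonaldPair α β a b)
    (hH : Subgroup.closure {a, b} = ⊤) (ha : a ^ 3 ^ k = 1) (hb : b ^ 3 ^ k = 1)
    (hα7 : α ≡ 7 [ZMOD 9]) (hβ7 : β ≡ 7 [ZMOD 9]) (hαβ : α ≡ β [ZMOD 27])
    (hne : a ^ 3 ^ 3 ≠ 1) : Nat.card H = 3 ^ 10 := by
  obtain ⟨ha81, hb81, hc27, hba⟩ := h.relations_of_modEq_seven ha hb hα7 hβ7 hαβ
  obtain ⟨K, _, f, hs, hf, hcard⟩ := exists_central_quotient Nat.prime_three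
    (h.left_pow_mem_center_of_modEq_seven hH ha hb hα7 hβ7 hαβ)
    (by rw [← pow_mul, ← pow_succ, ha81]) hne
  have hK := card_eq_of_comm_pow_ne_one Nat.prime_three (by norm_num)
    (pow_val_three_of_modEq_seven hα7) (pow_val_three_of_modEq_seven hβ7) 2 (h.map f)
    (Subgroup.closure_pair_map_eq_top hH hs)
    (by rw [← map_pow, hf]; exact Subgroup.mem_zpowers _) (by rwa [← map_pow, hf])
    (by
      rw [← map_rcomm, ← map_pow, Ne, hf]
      exact h.comm_pow_nine_notMem_zpowers hH ha hb hα7 hβ7 hαβ hne)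
  rw [hcard, hK]; norm_num

theorem orderOf_left_of_modEq_seven (h : IsMacdonaldPair α β a b)
    (ha : a ^ 3 ^ k = 1) (hb : b ^ 3 ^ k = 1)
    (hα7 : α ≡ 7 [ZMOD 9]) (hβ7 : β ≡ 7 [ZMOD 9]) (hαβ : α ≡ β [ZMOD 27])
    (hne : a ^ 3 ^ 3 ≠ 1) : orderOf a = 81 := by
  have : Fact (Nat.Prime 3) := ⟨Nat.prime_three⟩
  exact orderOf_eq_prime_pow hne (h.relations_of_modEq_seven ha hb hα7 hβ7 hαβ).1

theorem orderOf_right_of_modEq_seven (h : IsMacdonaldPair α β a b)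
    (ha : a ^ 3 ^ k = 1) (hb : b ^ 3 ^ k = 1)
    (hα7 : α ≡ 7 [ZMOD 9]) (hβ7 : β ≡ 7 [ZMOD 9]) (hαβ : α ≡ β [ZMOD 27])
    (hne : a ^ 3 ^ 3 ≠ 1) : orderOf b = 81 := by
  refine h.symm.orderOf_left_of_modEq_seven hb ha hβ7 hα7 hαβ.symm fun hb1 => hne ?_
  have := (h.symm.relations_of_modEq_seven hb ha hβ7 hα7 hαβ.symm).2.2.2
  rwa [hb1, Subgroup.zpowers_one_eq_bot, Subgroup.mem_bot] at this

theorem orderOf_comm_of_modEq_seven (h : IsMacdonaldPair α β a b)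
    (hH : Subgroup.closure {a, b} = ⊤) (ha : a ^ 3 ^ k = 1) (hb : b ^ 3 ^ k = 1)
    (hα7 : α ≡ 7 [ZMOD 9]) (hβ7 : β ≡ 7 [ZMOD 9]) (hαβ : α ≡ β [ZMOD 27])
    (hne : a ^ 3 ^ 3 ≠ 1) : orderOf (rcomm a b) = 27 := by
  have : Fact (Nat.Prime 3) := ⟨Nat.prime_three⟩
  refine orderOf_eq_prime_pow (p := 3) (n := 2) (fun h1 => ?_)
    (h.relations_of_modEq_seven ha hb hα7 hβ7 hαβ).2.2.1
  exact h.comm_pow_nine_notMem_zpowers hH ha hb hα7 hβ7 hαβ hne (h1 ▸ one_mem _)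

theorem left_pow_mem_lowerCentralSeries_succ (h : IsMacdonaldPair α β a b)
    (ha : a ^ 3 ^ k = 1) (hα : IsVal 3 1 (α - 1)) {n j : ℕ}
    (hc : rcomm a b ^ 3 ^ j ∈ (⊤ : Subgroup H).lowerCentralSeries n) :
    a ^ 3 ^ (j + 1) ∈ (⊤ : Subgroup H).lowerCentralSeries (n + 1) := by
  have h1 : a ^ (α ^ 3 ^ j - 1) ∈ (⊤ : Subgroup H).lowerCentralSeries (n + 1) := by
    have h2 := h.zpow_mul_comm_pow 1 (3 ^ j)
    rw [zpow_one, one_mul] at h2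
    have h3 : a ^ (α ^ 3 ^ j - 1) = ⁅(rcomm a b ^ 3 ^ j)⁻¹, a⁆ := by
      rw [commutatorElement_def, inv_inv, mul_assoc _ a, h2, inv_mul_cancel_left, zpow_sub_one]
    rw [h3]
    exact Subgroup.commutator_mem_commutator (inv_mem hc) (Subgroup.mem_top a)
  have h2 := pow_mem_of_zpow_mem_of_val Nat.prime_three ha (hα.pow_sub_one Nat.prime_three le_rfl
    (.inl (by norm_num)) (.natCast_pow Nat.prime_three j)) h1 dvd_rfl
  rwa [add_comm 1 j, ← Nat.cast_pow, zpow_natCast] at h2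

theorem comm_pow_mem_lowerCentralSeries_succ (h : IsMacdonaldPair α β a b)
    (hα : IsVal 3 1 (α - 1)) {n j : ℕ} (ha : a ^ 3 ^ k = 1)
    (hc : a ^ 3 ^ j ∈ (⊤ : Subgroup H).lowerCentralSeries n) :
    rcomm a b ^ 3 ^ j ∈ (⊤ : Subgroup H).lowerCentralSeries (n + 1) := by
  have h1 : rcomm a b ^ 3 ^ j * a ^ (geomSum α (3 ^ j) - (3 ^ j : ℕ)) ∈
      (⊤ : Subgroup H).lowerCentralSeries (n + 1) := by
    have h2 := h.pow_mul_right (3 ^ j)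
    have h3 : rcomm a b ^ 3 ^ j * a ^ (geomSum α (3 ^ j) - (3 ^ j : ℕ)) =
        ⁅a ^ 3 ^ j, b⁻¹⁆⁻¹ := by
      rw [commutatorElement_inv, commutatorElement_def, inv_inv, mul_assoc _ (a ^ 3 ^ j), h2,
        inv_mul_cancel_left, zpow_sub, zpow_natCast, mul_assoc]
    rw [h3]
    exact inv_mem (Subgroup.commutator_mem_commutator hc (Subgroup.mem_top _))
  -- The commutator with `b` gives `c ^ 3 ^ j` only up to a power of `a`. Its exponent is divisible
  -- by `3 ^ (j + 1)`, and the commutator of `a ^ 3 ^ j` with `c` supplies such powers.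
  have h2 : a ^ ((α - 1) * (3 ^ j : ℕ)) ∈ (⊤ : Subgroup H).lowerCentralSeries (n + 1) := by
    have h3 := h.zpow_mul_comm ((3 ^ j : ℕ) : ℤ)
    have h4 : a ^ ((α - 1) * (3 ^ j : ℕ)) = ⁅a ^ 3 ^ j, (rcomm a b)⁻¹⁆⁻¹ := by
      rw [zpow_natCast] at h3
      rw [commutatorElement_inv, commutatorElement_def, inv_inv, mul_assoc _ (a ^ 3 ^ j), h3,
        inv_mul_cancel_left, sub_one_mul, zpow_sub, zpow_natCast a (3 ^ j)]
    rw [h4]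
    exact inv_mem (Subgroup.commutator_mem_commutator hc (Subgroup.mem_top _))
  have h3 := pow_mem_of_zpow_mem_of_val Nat.prime_three ha (hα.mul Nat.prime_three
    (.natCast_pow Nat.prime_three j)) h2
    (pow_dvd_geomSum_sub (i := j) Nat.prime_three (by norm_num) le_rfl hα.1 dvd_rfl)
  simpa using mul_mem h1 (inv_mem h3)

/-- The ladder `a, c, a ^ 3, c ^ 3, a ^ 9, c ^ 9, a ^ 27` descends one term at each step; indices
start at 0. -/
theorem left_pow_mem_lowerCentralSeries_six (h : IsMacdonaldPair α β a b)
    (ha : a ^ 3 ^ k = 1) (hα : IsVal 3 1 (α - 1)) :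
    a ^ 3 ^ 3 ∈ (⊤ : Subgroup H).lowerCentralSeries 6 := by
  have h0 : a ^ 3 ^ 0 ∈ (⊤ : Subgroup H).lowerCentralSeries 0 := Subgroup.mem_top _
  have h1 := h.comm_pow_mem_lowerCentralSeries_succ hα ha h0
  have h2 := h.left_pow_mem_lowerCentralSeries_succ ha hα h1
  have h3 := h.comm_pow_mem_lowerCentralSeries_succ hα ha h2
  have h4 := h.left_pow_mem_lowerCentralSeries_succ ha hα h3
  have h5 := h.comm_pow_mem_lowerCentralSeries_succ hα ha h4
  exact h.left_pow_mem_lowerCentralSeries_succ ha hα h5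

end Exceptional

end IsMacdonaldPair

/-! Monomial representations of degree `81` over the group of `27`-th roots of unity. The point `(x, t)`
of `Fin 81 × ZMod 27` is encoded by the number `27 * x + t`, and a monomial map by the number whose
digits in base `2187` are the codes of the images of the points `(x, 0)`. -/

/-- The action on codes of the monomial map with code `N`. -/
def monomialStep (N u : ℕ) : ℕ :=
  27 * (N / 2187 ^ (u / 27) % 2187 / 27) + (N / 2187 ^ (u / 27) % 2187 + u) % 27

/-- The action on codes of the scalar `s`. -/
def scalarStep (s u : ℕ) : ℕ := 27 * (u / 27) + (u + s) % 27

theorem monomialStep_lt (N u : ℕ) : monomialStep N u < 2187 := by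
  unfold monomialStep
  have : N / 2187 ^ (u / 27) % 2187 < 2187 := Nat.mod_lt _ (by norm_num)
  omega

theorem scalarStep_lt (s : ℕ) {u : ℕ} (hu : u < 2187) : scalarStep s u < 2187 := by
  unfold scalarStep
  omega

theorem commute_monomialStep_scalarStep (N s : ℕ) :
    Function.Commute (monomialStep N) (scalarStep s) := fun u => by
  unfold monomialStep scalarStep
  have : (27 * (u / 27) + (u + s) % 27) / 27 = u / 27 := by omega
  rw [this]
  omega

/-- A map commuting with scalars is determined by its values at the points `(x, 0)`, so relations
need only be checked at 81 codes. -/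
theorem eq_of_commute_scalarStep {f g : ℕ → ℕ} (hf : ∀ s, Function.Commute f (scalarStep s))
    (hg : ∀ s, Function.Commute g (scalarStep s)) (h : ∀ x < 81, f (27 * x) = g (27 * x)) {u : ℕ}
    (hu : u < 2187) : f u = g u := by
  have hu' : scalarStep (u % 27) (27 * (u / 27)) = u := by
    unfold scalarStep; omega
  rw [← hu', (hf _).eq, (hg _).eq, h _ (by omega)]

/-- The relations satisfied by the codes of a monomial representation of a Macdonald group in which
the `27`-th powers of the generators are the scalars `9` and `18`. -/
def IsMonomialModel (α A B C : ℕ) : Prop :=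
  ∀ x < 81, monomialStep A (monomialStep B (27 * x)) =
      monomialStep B (monomialStep A (monomialStep C (27 * x))) ∧
    monomialStep A (monomialStep C (27 * x)) = monomialStep C ((monomialStep A)^[α] (27 * x)) ∧
    monomialStep C (monomialStep B (27 * x)) = (monomialStep B)^[α] (monomialStep C (27 * x)) ∧
    (monomialStep A)^[27] (27 * x) = scalarStep 9 (27 * x) ∧
    (monomialStep B)^[27] (27 * x) = scalarStep 18 (27 * x)

instance (α A B C : ℕ) : Decidable (IsMonomialModel α A B C) :=
  inferInstanceAs (Decidable (∀ x < 81, _))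

-- A finite certificate: the three integers encode the images of `a`, `b` and `c`. The base
-- exponents 7, 16, 25 represent all classes modulo 27 that are 7 modulo 9.
set_option maxRecDepth 100000 in
theorem isMonomialModel_seven : IsMonomialModel 7
    359280927661522883801075106809005905169720177684533706468864202184302707708163846543341362990481775349499857362932141573774557632974093176870811782844887004224627195706671569658580588182758203189074107582950353426319397002333917990513103177481842941679748450209012428450
    2259162291330116105961331699872717413884676485080324270610349418494225909974028481432570307102702230849689717833948747726987117024809085548796142162876074698377913830961114054419697943354785454825273376812186603189763057647324062986732689549126616447609993550247970691474
    3253784642923555853599706104528012148455010878956642800704871721432178333713946985881176204693286066996683661856084259990605679948942984619913512535088268283416428960163994946703487154914983389210256135201751449373596293868272204048648720664536699963906982583533575856443 := by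
  decide

set_option maxRecDepth 100000 in
theorem isMonomialModel_sixteen : IsMonomialModel 16
    345402396477903415130828147630058646469168131622328533726704600937420805590260098433750390971796073068071967641002123405389516926911020442861173276559265223744651010531132902654916066874201102380993772891101766893459950803675720034415123648185485920270702297959282598805
    2282274162062504392998572870843083783463200099431463454576592391652542639082162454764287714486343834437347061275551528137783062888591184780009338829956586272359444391025608088320686134759637306504652671639393695893906465301695048600691209014871750300368646312838425964308
    3249158462962017612139214791950528700512264458703338297132036605502557822746398553004219865344420576872037656417517853395446140243309056924959677784249169697015753417015267454283114372826749323799920516158963996899629201614866245716289617311330997478314425467736198931406 := by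
  decide

set_option maxRecDepth 100000 in
theorem isMonomialModel_twentyFive : IsMonomialModel 25
    373159467546135789852523592781213655875698642963687028441416242598083612909738405500182793315688954803037007052051833046948362606447098184048554954503628905625283142035829893907150302534410822297112067708260520801902619421286682011996384518646535155281252256575031110842
    2263788471290327572798351180796903921045823294040896023245003137211859163235474166330503661134301024227304778133642335767110794659966045384607353265420201693444888629469062331882541487654754645322505324107489733846005378980386896421080807915069738102816626147268892502582
    3286167893953324650620060561400913957662250334734393699844272240672509399517898748365225355409348063385728790603956420012407865377093841200611840983638871492332883205090053962906690859814883632106528864036178097504187374301987115091194196290284118920235344669248153723880 := by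
  decide

/-- The permutation of `Fin n` induced by a periodic map. -/
def permOfIterate {n : ℕ} (f : ℕ → ℕ) (m : ℕ) (hf : ∀ u < n, f u < n)
    (hm : ∀ u < n, f^[m + 1] u = u) : Equiv.Perm (Fin n) where
  toFun u := ⟨f u, hf u u.2⟩
  invFun u := ⟨f^[m] u, by
    have : ∀ l, f^[l] u < n := fun l => by
      induction l with
      | zero => exact u.2
      | succ l ih => rw [Function.iterate_succ_apply']; exact hf _ ih
    exact this m⟩
  left_inv u := Fin.ext (hm u u.2)
  right_inv u := Fin.ext (by simpa [← Function.iterate_succ_apply'] using hm u u.2)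

theorem permOfIterate_pow_apply {n : ℕ} {f : ℕ → ℕ} {m : ℕ} (hf : ∀ u < n, f u < n)
    (hm : ∀ u < n, f^[m + 1] u = u) (l : ℕ) (u : Fin n) :
    (((permOfIterate f m hf hm) ^ l) u : ℕ) = f^[l] u := by
  induction l generalizing u with
  | zero => rfl
  | succ l ih => rw [pow_succ, Equiv.Perm.mul_apply, ih, Function.iterate_succ_apply]; rfl

theorem scalarStep_scalarStep (s t u : ℕ) :
    scalarStep s (scalarStep t u) = scalarStep (s + t) u := by
  unfold scalarStep; omega

theorem commute_scalarStep (s t : ℕ) : Function.Commute (scalarStep s) (scalarStep t) := fun u => by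
  rw [scalarStep_scalarStep, scalarStep_scalarStep, add_comm]

theorem scalarStep_of_dvd {s : ℕ} (hs : 27 ∣ s) (u : ℕ) : scalarStep s u = u := by
  unfold scalarStep; omega

theorem iterate_scalarStep (s l u : ℕ) : (scalarStep s)^[l] u = scalarStep (l * s) u := by
  induction l with
  | zero => rw [zero_mul, scalarStep_of_dvd (dvd_zero _)]; rfl
  | succ l ih => rw [Function.iterate_succ_apply', ih, scalarStep_scalarStep]; congr 1; ring

namespace IsMonomialModel

variable {α A B C : ℕ}

theorem exists_pair (h : IsMonomialModel α A B C) : ∃ (M : Type) (_ : Group M) (a b ζ : M),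
    IsMacdonaldPair α α a b ∧ Commute ζ a ∧ Commute ζ b ∧ ζ ^ 9 = 1 ∧ a ^ 27 = ζ ^ 3 ∧
      b ^ 27 * ζ ^ 3 = 1 ∧ ζ ^ 3 ≠ 1 := by
  set f := monomialStep A
  set g := monomialStep B
  set e := monomialStep C
  have hf : ∀ s, Function.Commute f (scalarStep s) := commute_monomialStep_scalarStep A
  have hg : ∀ s, Function.Commute g (scalarStep s) := commute_monomialStep_scalarStep B
  have he : ∀ s, Function.Commute e (scalarStep s) := commute_monomialStep_scalarStep C
  have h1 : ∀ u < 2187, f (g u) = g (f (e u)) := fun u hu =>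
    eq_of_commute_scalarStep (f := f ∘ g) (g := g ∘ f ∘ e) (fun s => (hf s).comp_left (hg s))
      (fun s => (hg s).comp_left ((hf s).comp_left (he s))) (fun x hx => (h x hx).1) hu
  have h2 : ∀ u < 2187, f (e u) = e (f^[α] u) := fun u hu =>
    eq_of_commute_scalarStep (f := f ∘ e) (g := e ∘ f^[α]) (fun s => (hf s).comp_left (he s))
      (fun s => (he s).comp_left ((hf s).iterate_left α)) (fun x hx => (h x hx).2.1) hu
  have h3 : ∀ u < 2187, e (g u) = g^[α] (e u) := fun u hu =>
    eq_of_commute_scalarStep (f := e ∘ g) (g := g^[α] ∘ e) (fun s => (he s).comp_left (hg s))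
      (fun s => ((hg s).iterate_left α).comp_left (he s)) (fun x hx => (h x hx).2.2.1) hu
  have h4 : ∀ u < 2187, f^[27] u = scalarStep 9 u := fun u hu =>
    eq_of_commute_scalarStep (fun s => (hf s).iterate_left 27)
      (fun s => commute_scalarStep 9 s) (fun x hx => (h x hx).2.2.2.1) hu
  have h5 : ∀ u < 2187, g^[27] u = scalarStep 18 u := fun u hu =>
    eq_of_commute_scalarStep (fun s => (hg s).iterate_left 27)
      (fun s => commute_scalarStep 18 s) (fun x hx => (h x hx).2.2.2.2) hu
  have hperiod : ∀ (k : ℕ → ℕ) (s : ℕ), 27 ∣ 3 * s → (∀ u < 2187, k^[27] u = scalarStep s u) →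
      ∀ u < 2187, k^[80 + 1] u = u := by
    intro k s hs hk u hu
    rw [show 80 + 1 = 27 + (27 + 27) by rfl, Function.iterate_add_apply, Function.iterate_add_apply,
      hk u hu, hk _ (scalarStep_lt s hu), hk _ (scalarStep_lt s (scalarStep_lt s hu)),
      scalarStep_scalarStep, scalarStep_scalarStep, scalarStep_of_dvd (by omega)]
  let a : Equiv.Perm (Fin 2187) := permOfIterate f 80 (fun u _ => monomialStep_lt A u)
    (hperiod f 9 (by norm_num) h4)
  let b : Equiv.Perm (Fin 2187) := permOfIterate g 80 (fun u _ => monomialStep_lt B u)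
    (hperiod g 18 (by norm_num) h5)
  -- The scalar 3 has order 9 modulo 27; the scalars 9 and 18 are its cube and the inverse of its
  -- cube.
  let ζ : Equiv.Perm (Fin 2187) := permOfIterate (scalarStep 3) 8 (fun u => scalarStep_lt 3)
    (fun u _ => by rw [iterate_scalarStep, scalarStep_of_dvd (by norm_num)])
  have ha : ∀ (l : ℕ) (u : Fin 2187), ((a ^ l) u : ℕ) = f^[l] u := permOfIterate_pow_apply _ _
  have hb : ∀ (l : ℕ) (u : Fin 2187), ((b ^ l) u : ℕ) = g^[l] u := permOfIterate_pow_apply _ _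
  have hζ : ∀ (l : ℕ) (u : Fin 2187), ((ζ ^ l) u : ℕ) = (scalarStep 3)^[l] u :=
    permOfIterate_pow_apply _ _
  have ha1 : ∀ u : Fin 2187, ((a u : Fin 2187) : ℕ) = f u := fun u => rfl
  have hb1 : ∀ u : Fin 2187, ((b u : Fin 2187) : ℕ) = g u := fun u => rfl
  have hζ1 : ∀ u : Fin 2187, ((ζ u : Fin 2187) : ℕ) = scalarStep 3 u := fun u => rfl
  have hc : ∀ u : Fin 2187, ((rcomm a b u : Fin 2187) : ℕ) = e u := fun u => by
    have hlt : e u < 2187 := monomialStep_lt C u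
    have : rcomm a b u = ⟨e u, hlt⟩ := by
      apply (b * a).injective
      have h6 : b * a * rcomm a b = a * b := by simp [rcomm, mul_assoc]
      rw [← Equiv.Perm.mul_apply, h6]
      exact Fin.ext (h1 u u.2)
    rw [this]
  refine ⟨_, inferInstance, a, b, ζ, ⟨?_, ?_⟩, ?_, ?_, ?_, ?_, ?_, ?_⟩
  · rw [rconj, mul_assoc, inv_mul_eq_iff_eq_mul, zpow_natCast]
    refine Equiv.ext fun u => Fin.ext ?_
    rw [Equiv.Perm.mul_apply, Equiv.Perm.mul_apply, ha1, hc, hc, ha]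
    exact h2 u u.2
  · rw [rconj, ← rcomm_inv a b, inv_inv, mul_inv_eq_iff_eq_mul, zpow_natCast]
    refine Equiv.ext fun u => Fin.ext ?_
    rw [Equiv.Perm.mul_apply, Equiv.Perm.mul_apply, hc, hb1, hb, hc]
    exact h3 u u.2
  · exact Equiv.ext fun u => Fin.ext ((hf 3).eq u).symm
  · exact Equiv.ext fun u => Fin.ext ((hg 3).eq u).symm
  · refine Equiv.ext fun u => Fin.ext ?_
    rw [hζ, iterate_scalarStep, scalarStep_of_dvd (by norm_num)]; rfl
  · refine Equiv.ext fun u => Fin.ext ?_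
    rw [ha, hζ, h4 u u.2, iterate_scalarStep]
  · refine Equiv.ext fun u => Fin.ext ?_
    rw [Equiv.Perm.mul_apply, hb, hζ, h5 _ (by rw [iterate_scalarStep]; exact scalarStep_lt _ u.2),
      iterate_scalarStep, scalarStep_scalarStep, scalarStep_of_dvd (by norm_num)]; rfl
  · intro h7
    have h8 := hζ 3 0
    rw [h7, iterate_scalarStep] at h8
    exact absurd h8 (by decide)

end IsMonomialModel

/-! ### Twisting the models by central elements. -/

theorem Commute.rcomm_right {M : Type*} [Group M] {a b x : M} (ha : Commute x a)
    (hb : Commute x b) : Commute x (rcomm a b) :=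
  ((ha.inv_right.mul_right hb.inv_right).mul_right ha).mul_right hb

theorem rcomm_mul_left {M : Type*} [Group M] {a b x : M} (ha : Commute x a) (hb : Commute x b) :
    rcomm (a * x) b = rcomm a b := by
  have h1 : rcomm (a * x) b = x⁻¹ * rcomm a b * x := by
    simp only [rcomm, mul_inv_rev, mul_assoc, hb.eq]
  rw [h1, mul_assoc, ← (ha.rcomm_right hb).eq, inv_mul_cancel_left]

theorem rcomm_mul_right {M : Type*} [Group M] {a b x : M} (ha : Commute x a) (hb : Commute x b) :
    rcomm a (b * x) = rcomm a b := by
  rw [← rcomm_inv, rcomm_mul_left hb ha, rcomm_inv]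

namespace IsMacdonaldPair

variable {M : Type*} [Group M] {α β : ℤ} {a b ζ : M}

/-- The twist does not change `c`, and `ζ ^ i` is central, so the two sides differ only in the
exponent of `ζ`: `i` against `3 * i + i * α` modulo 9. These agree because `α` is 7 modulo 9. -/
theorem rconj_twist (h : IsMacdonaldPair α β a b) (hα : 9 ∣ α + 2) (hζa : Commute ζ a)
    (hζb : Commute ζ b) (hζ : ζ ^ 9 = 1) (ha : a ^ 27 = ζ ^ 3) (i : ℤ) :
    rconj (a * ζ ^ i) (rcomm a b) = (a * ζ ^ i) ^ (α + 27 * i) := by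
  obtain ⟨r, hr⟩ := hα
  have hi : Commute (ζ ^ i) a := hζa.zpow_left i
  have h3 : rconj (a * ζ ^ i) (rcomm a b) = a ^ α * ζ ^ i := by
    rw [← h.conj_left]
    simp only [rconj, mul_assoc]
    rw [((hζa.zpow_left i).rcomm_right (hζb.zpow_left i)).eq]
  have h4 : a ^ (27 * i) = ζ ^ (3 * i) := by
    rw [zpow_mul, zpow_mul]; norm_cast; rw [ha]
  rw [h3, hi.symm.mul_zpow, zpow_add, h4, ← zpow_mul, mul_assoc, ← zpow_add]
  have h5 : ζ ^ (9 * (i * r + 3 * i * i)) = 1 := by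
    rw [zpow_mul]; norm_cast; rw [hζ, one_zpow]
  rw [show 3 * i + i * (α + 27 * i) = i + 9 * (i * r + 3 * i * i) by linear_combination i * hr,
    zpow_add ζ i, h5, mul_one]

/-- Twisting a Macdonald pair by central elements of order `9`. -/
theorem twist (h : IsMacdonaldPair α α a b) (hα : 9 ∣ α + 2) (hζa : Commute ζ a)
    (hζb : Commute ζ b) (hζ : ζ ^ 9 = 1) (ha : a ^ 27 = ζ ^ 3) (hb : b ^ 27 * ζ ^ 3 = 1)
    (i j : ℤ) :
    IsMacdonaldPair (α + 27 * i) (α + 27 * j) (a * ζ ^ i) (b * ζ⁻¹ ^ j) := by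
  have hxa : Commute (ζ ^ i) a := hζa.zpow_left i
  have hxb : Commute (ζ ^ i) b := hζb.zpow_left i
  have hya : Commute (ζ⁻¹ ^ j) a := hζa.inv_left.zpow_left j
  have hyb : Commute (ζ⁻¹ ^ j) b := hζb.inv_left.zpow_left j
  have hyx : Commute (ζ⁻¹ ^ j) (ζ ^ i) :=
    (((Commute.refl ζ).inv_left).zpow_left j).zpow_right i
  have hrc : rcomm (a * ζ ^ i) (b * ζ⁻¹ ^ j) = rcomm a b := by
    rw [rcomm_mul_right (hya.mul_right hyx) hyb, rcomm_mul_left hxa hxb]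
  constructor
  · rw [hrc]
    exact h.rconj_twist hα hζa hζb hζ ha i
  · rw [← rcomm_inv, hrc, rcomm_inv]
    exact h.symm.rconj_twist hα hζb.inv_left hζa.inv_left (by rw [inv_pow, hζ, inv_one])
      (by rw [inv_pow, eq_inv_of_mul_eq_one_left hb]) j

end IsMacdonaldPair

/-- A Macdonald pair in which the order of the first element is exactly `81`. -/
theorem exists_pair_of_modEq_seven {α β : ℤ} (hα : α ≡ 7 [ZMOD 9])
    (hαβ : α ≡ β [ZMOD 27]) : ∃ (M : Type) (_ : Group M) (a b : M),
      IsMacdonaldPair α β a b ∧ a ^ 81 = 1 ∧ b ^ 81 = 1 ∧ a ^ 27 ≠ 1 := by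
  have key : ∀ {α₀ A B C : ℕ}, IsMonomialModel α₀ A B C → (α₀ : ℤ) ≡ 7 [ZMOD 9] →
      (α₀ : ℤ) ≡ α [ZMOD 27] → ∃ (M : Type) (_ : Group M) (a b : M),
      IsMacdonaldPair α β a b ∧ a ^ 81 = 1 ∧ b ^ 81 = 1 ∧ a ^ 27 ≠ 1 := by
    intro α₀ A B C hm h7 h27
    obtain ⟨M, _, a, b, ζ, h, hζa, hζb, hζ, ha, hb, hne⟩ := hm.exists_pair
    obtain ⟨i, hi⟩ := h27.dvd
    obtain ⟨j, hj⟩ := (h27.trans hαβ).dvd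
    have ht := h.twist (by have := h7.dvd; omega) hζa hζb hζ ha hb i j
    rw [← hi, ← hj, add_sub_cancel, add_sub_cancel] at ht
    have hz27 : ∀ n : ℤ, (ζ ^ n) ^ 27 = 1 := fun n => by
      rw [← zpow_natCast, zpow_comm, zpow_natCast, show 27 = 9 * 3 by rfl, pow_mul, hζ, one_pow,
        one_zpow]
    have h27a : (a * ζ ^ i) ^ 27 = ζ ^ 3 := by
      rw [(hζa.zpow_left i).symm.mul_pow, hz27, mul_one, ha]
    have h27b : (b * ζ⁻¹ ^ j) ^ 27 = (ζ ^ 3)⁻¹ := by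
      rw [(hζb.inv_left.zpow_left _).symm.mul_pow, inv_zpow, inv_pow, hz27, inv_one, mul_one, eq_inv_of_mul_eq_one_left hb]
    refine ⟨M, _, _, _, ht, ?_, ?_, ?_⟩
    · rw [show 81 = 27 * 3 by rfl, pow_mul, h27a, ← pow_mul, hζ]
    · rw [show 81 = 27 * 3 by rfl, pow_mul, h27b, inv_pow, ← pow_mul, hζ, inv_one]
    · rwa [h27a]
  have h3 : α ≡ 7 [ZMOD 27] ∨ α ≡ 16 [ZMOD 27] ∨ α ≡ 25 [ZMOD 27] := by
    simp only [Int.ModEq] at hα ⊢; omega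
  rcases h3 with h3 | h3 | h3
  · exact key isMonomialModel_seven (by decide) h3.symm
  · exact key isMonomialModel_sixteen (by decide) h3.symm
  · exact key isMonomialModel_twentyFive (by decide) h3.symm

/-! ### Finiteness and the `p`-group property from nilpotency. -/

open scoped commutatorElement in
theorem finite_commutatorSet_of_finite_quotient_center {G : Type*} [Group G]
    [Finite (G ⧸ Subgroup.center G)] : Finite (commutatorSet G) := by
  let f : (G ⧸ Subgroup.center G) × (G ⧸ Subgroup.center G) → G := fun x => ⁅x.1.out, x.2.out⁆
  refine Set.Finite.subset (Set.finite_range f) ?_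
  rintro _ ⟨x, y, rfl⟩
  have key : ∀ {x x' y : G}, x'⁻¹ * x ∈ Subgroup.center G → ⁅x', y⁆ = ⁅x, y⁆ := by
    intro x x' y hx
    obtain ⟨z, hz⟩ : ∃ z, z = x'⁻¹ * x := ⟨_, rfl⟩
    have hx' : x = x' * z := by rw [hz, mul_inv_cancel_left]
    rw [← hz, Subgroup.mem_center_iff] at hx
    have h1 := hx y
    rw [hx', commutatorElement_def, commutatorElement_def, mul_inv_rev, mul_assoc x' z, ← h1,
      ← mul_assoc x' y, mul_assoc (x' * y) z, mul_inv_cancel_left]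
  refine ⟨((x : G ⧸ Subgroup.center G), (y : G ⧸ Subgroup.center G)), ?_⟩
  have h1 : ∀ x : G, (Quotient.out (x : G ⧸ Subgroup.center G))⁻¹ * x ∈ Subgroup.center G :=
    fun x => QuotientGroup.eq.1 (QuotientGroup.out_eq' _)
  simp only [f]
  rw [key (h1 x), ← inv_inj, commutatorElement_inv, commutatorElement_inv, key (h1 y)]

/-- By induction the quotient by the center is finite, so there are finitely many commutators and
the derived subgroup is finite; the abelianization is finitely generated and torsion. -/
theorem finite_of_closure_pair {n : ℕ} : ∀ {G : Type*} [Group G] {a b : G},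
    Subgroup.closure {a, b} = ⊤ → IsOfFinOrder a → IsOfFinOrder b →
    Subgroup.upperCentralSeries G n = ⊤ → Finite G := by
  induction n with
  | zero =>
    intro G _ a b _ _ _ hn
    have := Subgroup.subsingleton_iff.1 (subsingleton_of_bot_eq_top hn)
    infer_instance
  | succ n ih =>
    intro G _ a b hG ha hb hn
    have hq : Finite (G ⧸ Subgroup.center G) := by
      refine ih (IsMacdonaldPair.closure_mk_center hG) ?_ ?_ ?_
      · exact (QuotientGroup.mk' (Subgroup.center G)).isOfFinOrder ha
      · exact (QuotientGroup.mk' (Subgroup.center G)).isOfFinOrder hb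
      · rw [← Subgroup.comap_upperCentralSeries_quotient_center] at hn
        exact Subgroup.comap_injective (QuotientGroup.mk'_surjective _) (hn.trans rfl)
    have := finite_commutatorSet_of_finite_quotient_center (G := G)
    have hAb : Subgroup.closure {Abelianization.of a, Abelianization.of b} = ⊤ :=
      Subgroup.closure_pair_map_eq_top hG (QuotientGroup.mk'_surjective _)
    have : Group.FG (Abelianization G) := Group.fg_iff.2 ⟨_, hAb, by simp⟩
    have hab : Finite (Abelianization G) := by
      refine CommGroup.finite_of_fg_isMulTorsion _ fun x => ?_
      have h1 : Subgroup.closure {Abelianization.of a, Abelianization.of b} ≤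
          CommGroup.torsion (Abelianization G) := by
        rw [Subgroup.closure_le]
        rintro y (rfl | rfl)
        · exact Abelianization.of.isOfFinOrder ha
        · exact Abelianization.of.isOfFinOrder hb
      exact h1 (hAb ▸ Subgroup.mem_top x)
    have : Finite (G ⧸ commutator G) := hab
    exact Finite.of_subgroup_quotient (commutator G)

theorem isPGroup_of_closure_pair {p n k : ℕ} [Fact p.Prime] {G : Type*} [Group G] {a b : G}
    (hG : Subgroup.closure {a, b} = ⊤) (ha : a ^ p ^ k = 1) (hb : b ^ p ^ k = 1)
    (hn : Subgroup.upperCentralSeries G n = ⊤) : IsPGroup p G := by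
  have hpos : 0 < p ^ k := Nat.pow_pos (Fact.out : p.Prime).pos
  have : Finite G := finite_of_closure_pair hG (isOfFinOrder_iff_pow_eq_one.2 ⟨_, hpos, ha⟩)
    (isOfFinOrder_iff_pow_eq_one.2 ⟨_, hpos, hb⟩) hn
  have : Group.IsNilpotent G := ⟨n, hn⟩
  obtain ⟨P⟩ : Nonempty (Sylow p G) := inferInstance
  have hmem : ∀ x : G, x ^ p ^ k = 1 → x ∈ (P : Subgroup G) := by
    intro x hx
    have h1 : IsPGroup p (Subgroup.zpowers x) := by
      rintro ⟨_, i, rfl⟩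
      refine ⟨k, Subtype.ext (?_ : (x ^ i) ^ p ^ k = 1)⟩
      rw [← zpow_natCast, zpow_comm, zpow_natCast, hx, one_zpow]
    obtain ⟨Q, hQ⟩ := h1.exists_le_sylow
    have := Sylow.unique_of_normal P inferInstance
    rw [Subsingleton.elim P Q]
    exact hQ (Subgroup.mem_zpowers x)
  have htop : (P : Subgroup G) = ⊤ := by
    rw [eq_top_iff, ← hG, Subgroup.closure_le]
    rintro x (rfl | rfl)
    · exact hmem _ ha
    · exact hmem _ hb
  have := P.isPGroup'
  rw [htop] at this
  exact this.of_equiv Subgroup.topEquiv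

/-! ### Primary components as Sylow subgroups. -/

namespace MacdonaldGroup

variable {α β : ℤ}

section Primary

variable {p : ℕ}

theorem primaryHom_A (hα : α ≠ 1) (hβ : β ≠ 1) (hp : p.Prime) : primaryHom hα hβ hp (A α β) =
    A α β ^ primaryIdempotent (exponentBound α β) p := lift_A _

theorem primaryHom_B (hα : α ≠ 1) (hβ : β ≠ 1) (hp : p.Prime) : primaryHom hα hβ hp (B α β) =
    B α β ^ primaryIdempotent (exponentBound α β) p := lift_B _

theorem primaryHom_primaryHom (hα : α ≠ 1) (hβ : β ≠ 1) (hp : p.Prime) (x : MacdonaldGroup α β) :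
    primaryHom hα hβ hp (primaryHom hα hβ hp x) = primaryHom hα hβ hp x := by
  have hdvd := (primaryIdempotent_isSplitting (exponentBound_ne_zero hα hβ) hp).dvd_mul_self_sub
  have key : ∀ y : MacdonaldGroup α β, orderOf y ∣ exponentBound α β →
      (y ^ primaryIdempotent (exponentBound α β) p) ^ primaryIdempotent (exponentBound α β) p =
        y ^ primaryIdempotent (exponentBound α β) p := by
    intro y hy
    rw [← pow_mul, ← Nat.sub_add_cancel (Nat.le_mul_self (primaryIdempotent _ p)), pow_add,
      orderOf_dvd_iff_pow_eq_one.1 (hy.trans hdvd), one_mul]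
  have : (primaryHom hα hβ hp).comp (primaryHom hα hβ hp) = primaryHom hα hβ hp := by
    apply hom_ext
    · rw [MonoidHom.comp_apply, primaryHom_A, map_pow, primaryHom_A, key _ (orderOf_A_dvd α β)]
    · rw [MonoidHom.comp_apply, primaryHom_B, map_pow, primaryHom_B, key _ (orderOf_B_dvd α β)]
  exact DFunLike.congr_fun this x

theorem isMacdonaldPair_range (hα : α ≠ 1) (hβ : β ≠ 1) (hp : p.Prime) :
    IsMacdonaldPair α β ((primaryHom hα hβ hp).rangeRestrict (A α β))
      ((primaryHom hα hβ hp).rangeRestrict (B α β)) :=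
  (isMacdonaldPair α β).map _

theorem closure_range (hα : α ≠ 1) (hβ : β ≠ 1) (hp : p.Prime) :
    Subgroup.closure {(primaryHom hα hβ hp).rangeRestrict (A α β),
      (primaryHom hα hβ hp).rangeRestrict (B α β)} = ⊤ :=
  Subgroup.closure_pair_map_eq_top (closure_eq_top α β) (MonoidHom.rangeRestrict_surjective _)

theorem range_A_pow (hα : α ≠ 1) (hβ : β ≠ 1) (hp : p.Prime) :
    (primaryHom hα hβ hp).rangeRestrict (A α β) ^ p ^ (exponentBound α β).factorization p = 1 := by
  apply Subtype.ext
  rw [Subgroup.coe_pow, MonoidHom.coe_rangeRestrict, primaryHom_A, ← pow_mul]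
  exact orderOf_dvd_iff_pow_eq_one.1 ((orderOf_A_dvd α β).trans
    (dvd_primaryIdempotent_mul (exponentBound_ne_zero hα hβ) hp))

theorem range_B_pow (hα : α ≠ 1) (hβ : β ≠ 1) (hp : p.Prime) :
    (primaryHom hα hβ hp).rangeRestrict (B α β) ^ p ^ (exponentBound α β).factorization p = 1 := by
  apply Subtype.ext
  rw [Subgroup.coe_pow, MonoidHom.coe_rangeRestrict, primaryHom_B, ← pow_mul]
  exact orderOf_dvd_iff_pow_eq_one.1 ((orderOf_B_dvd α β).trans
    (dvd_primaryIdempotent_mul (exponentBound_ne_zero hα hβ) hp))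

theorem upperCentralSeries_range_seven (hα : α ≠ 1) (hβ : β ≠ 1) (hp : p.Prime) :
    Subgroup.upperCentralSeries (primaryHom hα hβ hp).range 7 = ⊤ := by
  by_cases hs : p = 3 ∧ α ≡ 7 [ZMOD 9] ∧ β ≡ 7 [ZMOD 9] ∧ α ≡ β [ZMOD 27]
  · obtain ⟨rfl, h1, h2, h3⟩ := hs
    exact (isMacdonaldPair_range hα hβ hp).upperCentralSeries_seven_of_modEq_seven
      (closure_range hα hβ hp) (range_A_pow hα hβ hp) (range_B_pow hα hβ hp) h1 h2 h3
  · have := (isMacdonaldPair_range hα hβ hp).upperCentralSeries_six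
      (closure_range hα hβ hp) hp (range_A_pow hα hβ hp) (range_B_pow hα hβ hp) hα hβ hs
    exact top_le_iff.1 (this ▸ Subgroup.upperCentralSeries_mono _ (by norm_num))

theorem isPGroup_range (hα : α ≠ 1) (hβ : β ≠ 1) (hp : p.Prime) :
    IsPGroup p (primaryHom hα hβ hp).range :=
  have : Fact p.Prime := ⟨hp⟩
  isPGroup_of_closure_pair (closure_range hα hβ hp) (range_A_pow hα hβ hp) (range_B_pow hα hβ hp)
    (upperCentralSeries_range_seven hα hβ hp)

theorem lowerCentralSeries_eq_bot (hα : α ≠ 1) (hβ : β ≠ 1) {n : ℕ}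
    (h : ∀ (p : ℕ) (hp : p.Prime),
      Subgroup.upperCentralSeries (primaryHom hα hβ hp).range n = ⊤) :
    (⊤ : Subgroup (MacdonaldGroup α β)).lowerCentralSeries n = ⊥ := by
  rw [eq_bot_iff]
  intro x hx
  refine primaryHom_injective hα hβ fun p hp' => ?_
  have hp := Nat.prime_of_mem_primeFactors hp'
  have h1 := Subgroup.mem_map_of_mem (primaryHom hα hβ hp).rangeRestrict hx
  rw [Subgroup.map_lowerCentralSeries, Subgroup.map_top_of_surjective _
    (MonoidHom.rangeRestrict_surjective _),
    Subgroup.lowerCentralSeries_eq_bot_iff_upperCentralSeries_eq_top.2 (h p hp),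
    Subgroup.mem_bot] at h1
  exact congrArg Subtype.val h1

theorem upperCentralSeries_seven (hα : α ≠ 1) (hβ : β ≠ 1) :
    Subgroup.upperCentralSeries (MacdonaldGroup α β) 7 = ⊤ :=
  Subgroup.lowerCentralSeries_eq_bot_iff_upperCentralSeries_eq_top.1
    (lowerCentralSeries_eq_bot hα hβ fun _ hp => upperCentralSeries_range_seven hα hβ hp)

theorem upperCentralSeries_six (hα : α ≠ 1) (hβ : β ≠ 1)
    (h : ¬ (α ≡ 7 [ZMOD 9] ∧ β ≡ 7 [ZMOD 9] ∧ α ≡ β [ZMOD 27])) :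
    Subgroup.upperCentralSeries (MacdonaldGroup α β) 6 = ⊤ :=
  Subgroup.lowerCentralSeries_eq_bot_iff_upperCentralSeries_eq_top.1
    (lowerCentralSeries_eq_bot hα hβ fun _ hp =>
      (isMacdonaldPair_range hα hβ hp).upperCentralSeries_six
        (closure_range hα hβ hp) hp (range_A_pow hα hβ hp) (range_B_pow hα hβ hp) hα hβ
        fun hs => h hs.2)

theorem finite (hα : α ≠ 1) (hβ : β ≠ 1) : Finite (MacdonaldGroup α β) :=
  finite_of_closure_pair (closure_eq_top α β) (isOfFinOrder_A hα hβ) (isOfFinOrder_B hα hβ)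
    (upperCentralSeries_seven hα hβ)

/-- An element of order `p` in the kernel is killed by every other primary map too, since the image
there is a `q`-group; joint injectivity makes it trivial. -/
theorem not_dvd_card_ker (hα : α ≠ 1) (hβ : β ≠ 1) (hp : p.Prime) :
    ¬ p ∣ Nat.card (primaryHom hα hβ hp).ker := by
  intro hdvd
  have := finite hα hβ
  have : Fact p.Prime := ⟨hp⟩
  obtain ⟨x, hx⟩ := exists_prime_orderOf_dvd_card' p hdvd
  have hxp : (x : MacdonaldGroup α β) ^ p = 1 := by
    have := pow_orderOf_eq_one x
    rw [hx] at this
    exact congrArg Subtype.val this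
  have hx1 : (x : MacdonaldGroup α β) = 1 := by
    refine primaryHom_injective hα hβ fun q hq' => ?_
    have hq := Nat.prime_of_mem_primeFactors hq'
    by_cases hqp : q = p
    · subst hqp; exact x.2
    · obtain ⟨k, hk⟩ := isPGroup_range hα hβ hq ((primaryHom hα hβ hq).rangeRestrict x)
      have h1 : primaryHom hα hβ hq x ^ q ^ k = 1 := congrArg Subtype.val hk
      have h2 : primaryHom hα hβ hq x ^ p = 1 := by rw [← map_pow, hxp, map_one]
      have h3 := Nat.dvd_gcd (orderOf_dvd_of_pow_eq_one h1) (orderOf_dvd_of_pow_eq_one h2)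
      rw [Nat.Coprime.gcd_eq_one (Nat.Coprime.pow_left _ ((Nat.coprime_primes hq hp).2 hqp)),
        Nat.dvd_one, orderOf_eq_one_iff] at h3
      exact h3
  have : x = 1 := Subtype.ext hx1
  rw [this, orderOf_one] at hx
  exact hp.one_lt.ne hx

theorem sylow_eq_range (hα : α ≠ 1) (hβ : β ≠ 1) [hp : Fact p.Prime]
    (P : Sylow p (MacdonaldGroup α β)) :
    (P : Subgroup (MacdonaldGroup α β)) = (primaryHom hα hβ hp.out).range := by
  have := finite hα hβ
  have : Group.IsNilpotent (MacdonaldGroup α β) := ⟨7, upperCentralSeries_seven hα hβ⟩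
  have := Sylow.unique_of_normal P inferInstance
  obtain ⟨Q, hQ⟩ := (isPGroup_range hα hβ hp.out).exists_le_sylow
  rw [Subsingleton.elim Q P] at hQ
  refine le_antisymm (fun x hx => ?_) hQ
  set θ := primaryHom hα hβ hp.out
  have hθ : ∀ y, θ (θ y) = θ y := primaryHom_primaryHom hα hβ hp.out
  -- This element has order a power of `p`, and also order prime to `p` because it lies in the
  -- kernel.
  have hy : x * (θ x)⁻¹ ∈ θ.ker := by
    rw [MonoidHom.mem_ker, map_mul, map_inv, hθ, mul_inv_cancel]
  have hyP : x * (θ x)⁻¹ ∈ (P : Subgroup _) := mul_mem hx (inv_mem (hQ ⟨x, rfl⟩))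
  obtain ⟨k, hk⟩ := P.isPGroup' ⟨_, hyP⟩
  have h1 : (x * (θ x)⁻¹) ^ p ^ k = 1 := congrArg Subtype.val hk
  have h2 : (x * (θ x)⁻¹) ^ Nat.card θ.ker = 1 :=
    congrArg Subtype.val (pow_card_eq_one' (x := (⟨_, hy⟩ : θ.ker)))
  have h3 := Nat.dvd_gcd (orderOf_dvd_of_pow_eq_one h1) (orderOf_dvd_of_pow_eq_one h2)
  rw [Nat.Coprime.gcd_eq_one (Nat.Coprime.pow_left _
    ((Nat.Prime.coprime_iff_not_dvd hp.out).2 (not_dvd_card_ker hα hβ hp.out))),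
    Nat.dvd_one, orderOf_eq_one_iff, mul_inv_eq_one] at h3
  exact ⟨x, h3.symm⟩

end Primary

/-- In the exceptional case, the image of `A` in the `3`-primary component has order `81`. -/
theorem range_A_pow_ne_one (hα : α ≠ 1) (hβ : β ≠ 1)
    (hα7 : α ≡ 7 [ZMOD 9]) (hαβ : α ≡ β [ZMOD 27]) :
    (primaryHom hα hβ Nat.prime_three).rangeRestrict (A α β) ^ 3 ^ 3 ≠ 1 := by
  intro h1
  obtain ⟨M, _, a, b, h, ha, -, hne⟩ := exists_pair_of_modEq_seven hα7 hαβ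
  have hN := exponentBound_ne_zero hα hβ
  have h81 : orderOf a = 3 ^ 4 := by
    have : Fact (Nat.Prime 3) := ⟨Nat.prime_three⟩
    exact orderOf_eq_prime_pow hne ha
  have hdvd : 3 ^ 4 ∣ exponentBound α β := by
    rw [← h81]
    refine (orderOf_dvd_of_pow_eq_one ?_).trans (orderOf_A_dvd α β)
    rw [← lift_A h, ← map_pow, pow_orderOf_eq_one, map_one]
  -- The idempotent is 1 modulo 81, so it fixes the element `a` of the model.
  obtain ⟨n, hn, hn'⟩ := primaryIdempotent_eq hN Nat.prime_three
  have h2 := congrArg (fun x => lift h (Subtype.val x)) h1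
  simp only [Subgroup.coe_pow, MonoidHom.coe_rangeRestrict, primaryHom_A, map_pow, lift_A,
    Subgroup.coe_one, map_one] at h2
  obtain ⟨m, rfl⟩ := ((Nat.prime_three.pow_dvd_iff_dvd_ordProj hN).1 hdvd).trans hn'
  rw [hn, pow_add, pow_one, pow_mul, ← h81, pow_orderOf_eq_one, one_pow, mul_one] at h2
  exact hne h2

end MacdonaldGroup

/-! ### The canonical projection and the exact class. -/

/-- `(π x)⁻¹ * x` lies in the kernel of `π`, so its order is prime to `p`; its image under `π'` lies
in a `p`-group and is therefore trivial. -/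
theorem IsSylowProjection.eq {T : Type*} [Group T] {p : ℕ} {P : Sylow p T} {π π' : T →* P}
    (h : IsSylowProjection P π) (h' : IsSylowProjection P π') : π = π' := by
  ext x
  have hk : ((π x : T))⁻¹ * x ∈ π.ker := by
    rw [MonoidHom.mem_ker, map_mul, map_inv, h.1, inv_mul_cancel]
  have := h.2.1
  have h1 : (((π x : T))⁻¹ * x) ^ Nat.card π.ker = 1 :=
    congrArg Subtype.val (pow_card_eq_one' (x := (⟨_, hk⟩ : π.ker)))
  obtain ⟨k, h2⟩ := P.isPGroup' (π' (((π x : T))⁻¹ * x))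
  have h3 : π' (((π x : T))⁻¹ * x) ^ Nat.card π.ker = 1 := by rw [← map_pow, h1, map_one]
  have h4 := Nat.dvd_gcd (orderOf_dvd_of_pow_eq_one h3) (orderOf_dvd_of_pow_eq_one h2)
  rw [Nat.Coprime.gcd_eq_one (h.2.2.pow_right _), Nat.dvd_one, orderOf_eq_one_iff, map_mul,
    map_inv, h'.1, inv_mul_eq_one] at h4
  rw [h4]

namespace MacdonaldGroup

variable {α β : ℤ}

theorem nilpotencyClass_range_eq_seven (hα : α ≠ 1) (hβ : β ≠ 1)
    (hα7 : α ≡ 7 [ZMOD 9]) (hαβ : α ≡ β [ZMOD 27]) :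
    Group.nilpotencyClass (primaryHom hα hβ Nat.prime_three).range = 7 := by
  have hU := upperCentralSeries_range_seven hα hβ Nat.prime_three
  have : Group.IsNilpotent (primaryHom hα hβ Nat.prime_three).range := ⟨7, hU⟩
  refine le_antisymm (Subgroup.upperCentralSeries_eq_top_iff_nilpotencyClass_le.1 hU) ?_
  by_contra hlt
  have h6 := Subgroup.lowerCentralSeries_eq_bot_iff_nilpotencyClass_le.2 (Nat.le_of_lt_succ
    (not_le.1 hlt))
  have hmem := (isMacdonaldPair_range hα hβ Nat.prime_three).left_pow_mem_lowerCentralSeries_six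
    (range_A_pow hα hβ Nat.prime_three) (IsMacdonaldPair.pow_val_three_of_modEq_seven hα7)
  rw [h6, Subgroup.mem_bot] at hmem
  exact range_A_pow_ne_one hα hβ hα7 hαβ hmem

theorem nilpotencyClass_eq_seven_iff (hα : α ≠ 1) (hβ : β ≠ 1) :
    Group.nilpotencyClass (MacdonaldGroup α β) = 7 ↔
      α ≡ 7 [ZMOD 9] ∧ β ≡ 7 [ZMOD 9] ∧ α ≡ β [ZMOD 27] := by
  have hU := upperCentralSeries_seven hα hβ
  have : Group.IsNilpotent (MacdonaldGroup α β) := ⟨7, hU⟩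
  refine ⟨fun h => ?_, fun ⟨h1, _, h3⟩ => ?_⟩
  · by_contra hs
    have := Subgroup.upperCentralSeries_eq_top_iff_nilpotencyClass_le.1
      (upperCentralSeries_six hα hβ hs)
    omega
  · refine le_antisymm (Subgroup.upperCentralSeries_eq_top_iff_nilpotencyClass_le.1 hU) ?_
    rw [← nilpotencyClass_range_eq_seven hα hβ h1 h3]
    exact Subgroup.nilpotencyClass_le _

/-- The canonical projection onto a Sylow subgroup. -/
noncomputable def sylowProjection {p : ℕ} [hp : Fact p.Prime] (hα : α ≠ 1) (hβ : β ≠ 1)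
    (P : Sylow p (MacdonaldGroup α β)) : MacdonaldGroup α β →* P :=
  (primaryHom hα hβ hp.out).codRestrict (P : Subgroup (MacdonaldGroup α β))
    fun x => by rw [sylow_eq_range hα hβ P]; exact ⟨x, rfl⟩

theorem isSylowProjection_sylowProjection {p : ℕ} [hp : Fact p.Prime] (hα : α ≠ 1) (hβ : β ≠ 1)
    (P : Sylow p (MacdonaldGroup α β)) : IsSylowProjection P (sylowProjection hα hβ P) := by
  have hker : (sylowProjection hα hβ P).ker = (primaryHom hα hβ hp.out).ker :=
    MonoidHom.ker_codRestrict _ _ _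
  have := finite hα hβ
  refine ⟨fun x => Subtype.ext ?_, inferInstance, ?_⟩
  · have hx : (x : MacdonaldGroup α β) ∈ (primaryHom hα hβ hp.out).range := by
      rw [← sylow_eq_range hα hβ P]; exact x.2
    obtain ⟨y, hy⟩ := hx
    change primaryHom hα hβ hp.out x = x
    rw [← hy, primaryHom_primaryHom]
  · rw [hker]
    exact ((Nat.Prime.coprime_iff_not_dvd hp.out).2 (not_dvd_card_ker hα hβ hp.out)).symm

end MacdonaldGroup

theorem mainTheorem4 (α β : ℤ) (hα : α ≠ 1) (hβ : β ≠ 1) :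
    (α ≡ 7 [ZMOD 9] → β ≡ 7 [ZMOD 9] → α ≡ β [ZMOD 27] →
      ∀ P : Sylow 3 (MacdonaldGroup α β),
        Nat.card P = 3 ^ 10 ∧
        Group.IsNilpotent P ∧ Group.nilpotencyClass P = 7 ∧
        (∃! π : MacdonaldGroup α β →* P, IsSylowProjection P π) ∧
        ∀ π : MacdonaldGroup α β →* P, IsSylowProjection P π →
          orderOf (π (MacdonaldGroup.A α β)) = 81 ∧
          orderOf (π (MacdonaldGroup.B α β)) = 81 ∧
          orderOf (π (MacdonaldGroup.C α β)) = 27) ∧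
    Finite (MacdonaldGroup α β) ∧
    Group.IsNilpotent (MacdonaldGroup α β) ∧
    Group.nilpotencyClass (MacdonaldGroup α β) ≤ 7 ∧
    (Group.nilpotencyClass (MacdonaldGroup α β) = 7 ↔
      α ≡ 7 [ZMOD 9] ∧ β ≡ 7 [ZMOD 9] ∧ α ≡ β [ZMOD 27]) := by
  have hU := MacdonaldGroup.upperCentralSeries_seven hα hβ
  have hnil : Group.IsNilpotent (MacdonaldGroup α β) := ⟨7, hU⟩
  refine ⟨fun hα7 hβ7 hαβ P => ?_, MacdonaldGroup.finite hα hβ, hnil,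
    Subgroup.upperCentralSeries_eq_top_iff_nilpotencyClass_le.1 hU,
    MacdonaldGroup.nilpotencyClass_eq_seven_iff hα hβ⟩
  have : Fact (Nat.Prime 3) := ⟨Nat.prime_three⟩
  have hP := MacdonaldGroup.sylow_eq_range hα hβ P
  have h := MacdonaldGroup.isMacdonaldPair_range hα hβ Nat.prime_three
  have hH := MacdonaldGroup.closure_range hα hβ Nat.prime_three
  have ha := MacdonaldGroup.range_A_pow hα hβ Nat.prime_three
  have hb := MacdonaldGroup.range_B_pow hα hβ Nat.prime_three
  have hne := MacdonaldGroup.range_A_pow_ne_one hα hβ hα7 hαβ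
  have hπ := MacdonaldGroup.isSylowProjection_sylowProjection hα hβ P
  have hclass : ∀ S : Subgroup (MacdonaldGroup α β),
      S = (MacdonaldGroup.primaryHom hα hβ Nat.prime_three).range →
        Nat.card S = 3 ^ 10 ∧ Group.IsNilpotent S ∧ Group.nilpotencyClass S = 7 := by
    rintro S rfl
    exact ⟨h.card_of_modEq_seven hH ha hb hα7 hβ7 hαβ hne, inferInstance,
      MacdonaldGroup.nilpotencyClass_range_eq_seven hα hβ hα7 hαβ⟩
  obtain ⟨h1, h2, h3⟩ := hclass _ hP
  refine ⟨h1, h2, h3, ⟨_, hπ, fun π' hπ' => hπ'.eq hπ⟩, fun π' hπ' => ?_⟩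
  rw [hπ'.eq hπ]
  have horder : ∀ x, orderOf (MacdonaldGroup.sylowProjection hα hβ P x) =
      orderOf ((MacdonaldGroup.primaryHom hα hβ Nat.prime_three).rangeRestrict x) := fun x => by
    rw [← Subgroup.orderOf_coe, ← Subgroup.orderOf_coe]; rfl
  refine ⟨?_, ?_, ?_⟩
  · rw [horder]; exact h.orderOf_left_of_modEq_seven ha hb hα7 hβ7 hαβ hne
  · rw [horder]; exact h.orderOf_right_of_modEq_seven ha hb hα7 hβ7 hαβ hne
  · rw [horder, MacdonaldGroup.C, map_rcomm]
    exact h.orderOf_comm_of_modEq_seven hH ha hb hα7 hβ7 hαβ hne
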